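/- For a compact interval $J=[\eta,\zeta]\subset\mathbb{R}$, $\eta<\zeta$, with dyadic rational endpoints, let $PL_2(J)$ be the group (under composition) of piecewise linear orientation-preserving homeomorphisms of $J$ with finitely many breakpoints such that all slopes are integral powers of $2$ and all breakpoints lie in $\mathbb{Z}[\tfrac12]$. An element of $PL_2(J)$ is given by a finite list $(d_1,e_1),\dots,(d_n,e_n)$ with $\eta=d_0<d_1<\dots<d_n=\zeta$ dyadic rationals and $e_i\in\mathbb{Z}$, meaning that it is affine with slope $2^{e_i}$ on $[d_{i-1},d_i]$; every element has such a description, and the description determines it. Dyadic rationals are given as pairs $(m,n)\in\mathbb{Z}\times\mathbb{N}$ standing for $m/2^n$. **Proposition.** There is an algorithm which, given $J$, a number $k$ and elements $x_1,\dots,x_k,y,z\in PL_2(J)$, determines whether or not there is an element $$g\in C=C_{PL_2(J)}(x_1)\cap\dots\cap C_{PL_2(J)}(x_k)$$ such that $g^{-1}yg=z$. -/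

import Mathlib

namespace ThompsonPL

open Set

/-- Membership in the ring `ℤ[1/2]` of dyadic rational numbers. -/
def IsDyadic (x : ℝ) : Prop := ∃ (m : ℤ) (n : ℕ), x = m / 2 ^ n

theorem IsDyadic.add {x y : ℝ} (hx : IsDyadic x) (hy : IsDyadic y) : IsDyadic (x + y) := by
  obtain ⟨m, n, rfl⟩ := hx
  obtain ⟨k, l, rfl⟩ := hy
  refine ⟨m * 2 ^ l + k * 2 ^ n, n + l, ?_⟩
  push_cast
  rw [pow_add]
  field_simp

theorem IsDyadic.sub {x y : ℝ} (hx : IsDyadic x) (hy : IsDyadic y) : IsDyadic (x - y) := by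
  obtain ⟨m, n, rfl⟩ := hx
  obtain ⟨k, l, rfl⟩ := hy
  refine ⟨m * 2 ^ l - k * 2 ^ n, n + l, ?_⟩
  push_cast
  rw [pow_add]
  field_simp

theorem IsDyadic.zpow_mul {x : ℝ} (hx : IsDyadic x) (e : ℤ) : IsDyadic ((2 : ℝ) ^ e * x) := by
  obtain ⟨m, n, rfl⟩ := hx
  obtain ⟨k, rfl | rfl⟩ := e.eq_nat_or_neg
  · refine ⟨m * 2 ^ k, n, ?_⟩
    push_cast
    rw [zpow_natCast]
    ring
  · refine ⟨m, n + k, ?_⟩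
    rw [zpow_neg, zpow_natCast, pow_add]
    field_simp

/-- A nondegenerate compact interval `J = [left, right]` of `ℝ` with dyadic endpoints. -/
structure DyadicInterval where
  left : ℝ
  right : ℝ
  left_dyadic : IsDyadic left
  right_dyadic : IsDyadic right
  left_lt_right : left < right

/-- The points of the interval `J`. -/
abbrev DyadicInterval.Pt (J : DyadicInterval) : Type := Icc J.left J.right

/-- The left endpoint as a point of `J`. -/
def DyadicInterval.bot (J : DyadicInterval) : J.Pt := ⟨J.left, le_refl _, J.left_lt_right.le⟩

/-- `f` is piecewise linear, with finitely many breakpoints, all of them dyadic, and all slopes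
integral powers of `2`: there is a finite set `S` of dyadic numbers such that `f` is affine,
with slope a power of `2`, on each subinterval `[a, b]` with no point of `S` in its interior. -/
def IsPL2 {J : DyadicInterval} (f : J.Pt ≃o J.Pt) : Prop :=
  ∃ S : Finset ℝ, (∀ s ∈ S, IsDyadic s) ∧
    ∀ a b : J.Pt, a < b → (∀ s ∈ S, s ∉ Ioo (a : ℝ) b) →
      ∃ (n : ℤ) (c : ℝ), ∀ t : J.Pt, a ≤ t → t ≤ b → (f t : ℝ) = 2 ^ n * t + c

theorem map_bot {J : DyadicInterval} (f : J.Pt ≃o J.Pt) : f J.bot = J.bot := by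
  apply le_antisymm
  · rw [← f.le_symm_apply]
    exact (f.symm J.bot).2.1
  · exact (f J.bot).2.1

theorem IsPL2.dyadic_iff {J : DyadicInterval} {f : J.Pt ≃o J.Pt} (hf : IsPL2 f) (t : J.Pt) :
    IsDyadic (f t) ↔ IsDyadic t := by
  classical
  obtain ⟨S, hS, hlin⟩ := hf
  -- one affine piece transports the equivalence from its left end to its right end
  have step : ∀ a b : J.Pt, a < b → (∀ s ∈ S, s ∉ Ioo (a : ℝ) b) → IsDyadic a → IsDyadic (f a) →
      (IsDyadic (f b) ↔ IsDyadic b) := by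
    intro a b hab h ha hfa
    obtain ⟨n, c, hc⟩ := hlin a b hab h
    have h1 := hc a le_rfl hab.le
    have h2 := hc b hab.le le_rfl
    constructor
    · intro hb
      have : (b : ℝ) = 2 ^ (-n) * ((f b : ℝ) - f a) + a := by
        rw [h1, h2, zpow_neg]
        field_simp
        ring
      rw [this]
      exact ((hb.sub hfa).zpow_mul _).add ha
    · intro hb
      have : (f b : ℝ) = 2 ^ n * ((b : ℝ) - a) + f a := by
        rw [h1, h2]
        ring
      rw [this]
      exact ((hb.sub ha).zpow_mul _).add hfa
  induction h : (S.filter (fun s => s ∈ Ioo J.left (t : ℝ))).card using Nat.strong_induction_on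
    generalizing t with
  | _ k ih =>
    rcases eq_or_lt_of_le (show J.bot ≤ t from t.2.1) with rfl | hlt
    · rw [map_bot]
    · by_cases hne : (S.filter (fun s => s ∈ Ioo J.left (t : ℝ))).Nonempty
      · obtain ⟨s, hs, hmax⟩ := (S.filter (fun s => s ∈ Ioo J.left (t : ℝ))).exists_max_image id hne
        rw [Finset.mem_filter] at hs
        have hsJ : s ∈ Icc J.left J.right := ⟨hs.2.1.le, hs.2.2.le.trans t.2.2⟩
        have hds : IsDyadic (f ⟨s, hsJ⟩) := by
          refine (ih _ ?_ ⟨s, hsJ⟩ rfl).2 (hS s hs.1)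
          rw [← h]
          refine Finset.card_lt_card ((Finset.ssubset_iff_of_subset ?_).2 ⟨s, ?_, ?_⟩)
          · intro u hu
            rw [Finset.mem_filter] at hu ⊢
            exact ⟨hu.1, hu.2.1, hu.2.2.trans hs.2.2⟩
          · exact Finset.mem_filter.2 hs
          · simp
        refine step ⟨s, hsJ⟩ t hs.2.2 ?_ (hS s hs.1) hds
        intro u hu hu'
        have := hmax u (Finset.mem_filter.2 ⟨hu, hs.2.1.trans hu'.1, hu'.2⟩)
        exact absurd hu'.1 (not_lt.2 this)
      · refine step J.bot t hlt ?_ J.left_dyadic ?_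
        · intro s hs hs'
          exact hne ⟨s, Finset.mem_filter.2 ⟨hs, hs'⟩⟩
        · rw [map_bot]
          exact J.left_dyadic

/-- The group `PL₂(J)` of piecewise linear orientation-preserving homeomorphisms of `J` (that is,
order automorphisms of `J`), with finitely many breakpoints, such that all slopes are integral
powers of `2` and all breakpoints are dyadic.  The product is composition of functions. -/
def PL2 (J : DyadicInterval) : Subgroup (J.Pt ≃o J.Pt) where
  carrier := {f | IsPL2 f}
  one_mem' := ⟨∅, by simp, fun _ _ _ _ => ⟨0, 0, fun t _ _ => by simp⟩⟩
  mul_mem' := by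
    classical
    intro f g hf hg
    have hgd := hg.dyadic_iff
    obtain ⟨S, hS, hSl⟩ := hf
    obtain ⟨T, hT, hTl⟩ := hg
    refine ⟨T ∪ (S.subtype (· ∈ Icc J.left J.right)).image (fun s => ((g.symm s : J.Pt) : ℝ)),
      ?_, ?_⟩
    · intro s hs
      rcases Finset.mem_union.1 hs with hs | hs
      · exact hT s hs
      · obtain ⟨u, hu, rfl⟩ := Finset.mem_image.1 hs
        rw [← hgd, g.apply_symm_apply]
        exact hS _ (Finset.mem_subtype.1 hu)
    · intro a b hab h
      obtain ⟨n, c, hn⟩ := hTl a b hab (fun s hs => h s (Finset.mem_union_left _ hs))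
      obtain ⟨m, d, hm⟩ := hSl (g a) (g b) (g.lt_iff_lt.2 hab) (by
        intro s hs hs'
        have hsJ : s ∈ Icc J.left J.right := ⟨(g a).2.1.trans hs'.1.le, hs'.2.le.trans (g b).2.2⟩
        refine h _ (Finset.mem_union_right _ (Finset.mem_image.2
          ⟨⟨s, hsJ⟩, Finset.mem_subtype.2 hs, rfl⟩)) ⟨?_, ?_⟩
        · exact (g.lt_symm_apply (x := a) (y := ⟨s, hsJ⟩)).2 hs'.1
        · exact (g.symm_apply_lt (x := b) (y := ⟨s, hsJ⟩)).2 hs'.2)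
      refine ⟨m + n, 2 ^ m * c + d, fun t hat htb => ?_⟩
      have h1 := hm (g t) (g.le_iff_le.2 hat) (g.le_iff_le.2 htb)
      rw [hn t hat htb] at h1
      change (f (g t) : ℝ) = _
      rw [h1, zpow_add₀ two_ne_zero]
      ring
  inv_mem' := by
    classical
    intro f hf
    have hfd := hf.dyadic_iff
    obtain ⟨S, hS, hSl⟩ := hf
    refine ⟨(S.subtype (· ∈ Icc J.left J.right)).image (fun s => ((f s : J.Pt) : ℝ)), ?_, ?_⟩
    · intro s hs
      obtain ⟨u, hu, rfl⟩ := Finset.mem_image.1 hs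
      rw [hfd]
      exact hS _ (Finset.mem_subtype.1 hu)
    · intro a b hab h
      obtain ⟨n, c, hn⟩ := hSl (f.symm a) (f.symm b) (f.symm.lt_iff_lt.2 hab) (by
        intro s hs hs'
        have hsJ : s ∈ Icc J.left J.right :=
          ⟨(f.symm a).2.1.trans hs'.1.le, hs'.2.le.trans (f.symm b).2.2⟩
        refine h _ (Finset.mem_image.2 ⟨⟨s, hsJ⟩, Finset.mem_subtype.2 hs, rfl⟩) ⟨?_, ?_⟩
        · exact (f.symm_apply_lt (x := ⟨s, hsJ⟩) (y := a)).1 hs'.1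
        · exact (f.lt_symm_apply (x := ⟨s, hsJ⟩) (y := b)).1 hs'.2)
      refine ⟨-n, -(2 ^ (-n) * c), fun t hat htb => ?_⟩
      have h1 := hn (f.symm t) (f.symm.le_iff_le.2 hat) (f.symm.le_iff_le.2 htb)
      rw [f.apply_symm_apply] at h1
      change (f.symm t : ℝ) = _
      rw [h1, zpow_neg]
      field_simp
      ring

/-- Finite codes of dyadic rational numbers: `(m, n)` stands for `m / 2 ^ n`. -/
abbrev DyadicCode : Type := ℤ × ℕ

/-- The dyadic rational number with code `d`. -/
noncomputable def DyadicCode.val (d : DyadicCode) : ℝ := d.1 / 2 ^ d.2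

/-- Finite codes of elements of `PL₂(J)`: lists of pairs `(dᵢ, eᵢ)`, where `d₁ < d₂ < ⋯ < dₙ` are
the right ends of the successive pieces and `2 ^ eᵢ` is the slope on the `i`-th piece. -/
abbrev PLCode : Type := List (DyadicCode × ℤ)

/-- `CodesFrom f a c`: the list `c` describes `f` on the part of `J` to the right of `a`. -/
def CodesFrom {J : DyadicInterval} (f : PL2 J) : ℝ → PLCode → Prop
  | a, [] => a = J.right
  | a, (d, e) :: c => a < DyadicCode.val d ∧
      (∀ s t : J.Pt, a ≤ s → s ≤ t → (t : ℝ) ≤ DyadicCode.val d →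
        (f.1 t : ℝ) - f.1 s = 2 ^ e * ((t : ℝ) - s)) ∧
      CodesFrom f (DyadicCode.val d) c

/-- `c` is a code of the element `f` of `PL₂(J)`. -/
def Codes {J : DyadicInterval} (c : PLCode) (f : PL2 J) : Prop := CodesFrom f J.left c

/-- Every element of `PL₂(J)` has a code. -/
theorem exists_codes {J : DyadicInterval} (f : PL2 J) : ∃ c : PLCode, Codes c f := by
  classical
  obtain ⟨S, hS, hlin⟩ := f.2
  have hcode : ∀ x, IsDyadic x → ∃ d : DyadicCode, DyadicCode.val d = x := by
    rintro x ⟨m, n, rfl⟩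
    exact ⟨(m, n), rfl⟩
  suffices H : ∀ (k : ℕ) (a : J.Pt), (S.filter (fun s => s ∈ Ioo (a : ℝ) J.right)).card = k →
      ∃ c, CodesFrom f a c from H _ J.bot rfl
  intro k
  induction k using Nat.strong_induction_on with
  | _ k ih =>
    intro a hk
    rcases eq_or_lt_of_le a.2.2 with ha | ha
    · exact ⟨[], ha⟩
    · -- `b` is the next breakpoint
      obtain ⟨b, hbd, hab, hfree, c, hc⟩ : ∃ b : J.Pt, IsDyadic b ∧ a < b ∧
          (∀ s ∈ S, s ∉ Ioo (a : ℝ) b) ∧ ∃ c, CodesFrom f b c := by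
        by_cases hne : (S.filter (fun s => s ∈ Ioo (a : ℝ) J.right)).Nonempty
        · obtain ⟨s, hs, hmin⟩ :=
            (S.filter (fun s => s ∈ Ioo (a : ℝ) J.right)).exists_min_image id hne
          rw [Finset.mem_filter] at hs
          have hsJ : s ∈ Icc J.left J.right := ⟨a.2.1.trans hs.2.1.le, hs.2.2.le⟩
          refine ⟨⟨s, hsJ⟩, hS s hs.1, hs.2.1, ?_, ih _ ?_ ⟨s, hsJ⟩ rfl⟩
          · intro u hu hu'
            have := hmin u (Finset.mem_filter.2 ⟨hu, hu'.1, hu'.2.trans hs.2.2⟩)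
            exact absurd hu'.2 (not_lt.2 this)
          · rw [← hk]
            refine Finset.card_lt_card ((Finset.ssubset_iff_of_subset ?_).2 ⟨s, ?_, ?_⟩)
            · intro u hu
              rw [Finset.mem_filter] at hu ⊢
              exact ⟨hu.1, hs.2.1.trans hu.2.1, hu.2.2⟩
            · exact Finset.mem_filter.2 hs
            · simp
        · refine ⟨⟨J.right, J.left_lt_right.le, le_rfl⟩, J.right_dyadic, ha, ?_, [], rfl⟩
          intro s hs hs'
          exact hne ⟨s, Finset.mem_filter.2 ⟨hs, hs'⟩⟩
      obtain ⟨d, hd⟩ := hcode b hbd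
      obtain ⟨n, e, hn⟩ := hlin a b hab hfree
      refine ⟨(d, n) :: c, ?_, ?_, ?_⟩
      · rw [hd]
        exact hab
      · intro s t has hst htb
        rw [hd] at htb
        have has' : a ≤ s := has
        have htb' : t ≤ b := htb
        rw [hn t (has'.trans hst) htb', hn s has' (hst.trans htb')]
        ring
      · rw [hd]
        exact hc

/-- A code determines the element of `PL₂(J)` that it describes. -/
theorem Codes.unique {J : DyadicInterval} {c : PLCode} {f g : PL2 J} (hf : Codes c f)
    (hg : Codes c g) : f = g := by
  suffices H : ∀ (c : PLCode) (a : ℝ) (haJ : a ∈ Icc J.left J.right), CodesFrom f a c →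
      CodesFrom g a c → f.1 ⟨a, haJ⟩ = g.1 ⟨a, haJ⟩ → ∀ t : J.Pt, a ≤ t → f.1 t = g.1 t by
    refine Subtype.ext (RelIso.ext fun t => H c J.left J.bot.2 hf hg ?_ t t.2.1)
    exact (map_bot f.1).trans (map_bot g.1).symm
  have hle : ∀ (c : PLCode) (a : ℝ), CodesFrom f a c → a ≤ J.right := by
    intro c
    induction c with
    | nil => exact fun a h => le_of_eq h
    | cons p c ih => exact fun a h => h.1.le.trans (ih _ h.2.2)
  intro c
  induction c with
  | nil =>
    intro a haJ h1 _ h t hat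
    have : t = ⟨a, haJ⟩ := Subtype.ext (le_antisymm (t.2.2.trans (le_of_eq h1.symm)) hat)
    rw [this, h]
  | cons p c ih =>
    obtain ⟨d, e⟩ := p
    intro a haJ h1 h2 h
    have key : ∀ t : J.Pt, a ≤ t → (t : ℝ) ≤ DyadicCode.val d → f.1 t = g.1 t := by
      intro t hat htd
      have e1 := h1.2.1 ⟨a, haJ⟩ t le_rfl hat htd
      have e2 := h2.2.1 ⟨a, haJ⟩ t le_rfl hat htd
      rw [h] at e1
      exact Subtype.ext (by linarith)
    intro t hat
    rcases le_total (t : ℝ) (DyadicCode.val d) with htd | htd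
    · exact key t hat htd
    · have hdJ : DyadicCode.val d ∈ Icc J.left J.right :=
        ⟨haJ.1.trans h1.1.le, hle c _ h1.2.2⟩
      exact ih _ hdJ h1.2.2 h2.2.2 (key ⟨_, hdJ⟩ h1.1.le le_rfl) t htd

end ThompsonPL

/-!
The element `g` has to conjugate `x i` to itself for each `i`, and `z` to `y`. More generally, given
two finite families `A`, `B` of piecewise linear maps supported in `[L, R]`, it is decidable whether
some piecewise linear `g` supported in `[L, R]` conjugates each `A i` to `B i`. By Post's theorem it
is enough that both the existence and the nonexistence of `g` are semidecidable. For existence, one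
searches through all codes. Nonexistence amounts to the existence of a finite refutation (`Refuted`)
in a system of deduction rules for statements `P.1 ↦ P.2`, meaning `g P.1 = P.2`, between dyadic
numbers.

The rules work on two levels. Inside an interval between consecutive dyadic common fixed points of
the `A i`, a single value of `g` forces others (`Forced`). First, `x ↦ x'` implies `A i x ↦ B i x'`,
and conversely. Secondly, if `A i` and `B i` are affine and not translations near fixed points, then
iteration shows that `g`, being affine on a small neighborhood of the fixed point, is affine as far
as `A i` and `B i` are, and one value determines its slope (`ConjZone.slope`, `ConjZone.extend`,
`ZoneStep.sound`). This is valid on one side of the fixed point, or on both sides if the fixed point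
is not dyadic, as `g` cannot have a breakpoint there. A contradiction is a failure of monotonicity,
or a fixed point where the slopes do not match or where the slope of `g` would not be a power of `2`
(`ChainContra`).

On the second level, the images of the dyadic common fixed points are deduced from left to right
(`FrameStep`), starting with `L ↦ L`. Over an interval of common fixed points, `g` may be any
piecewise linear map between the intervals (`exists_fill`). Otherwise some `A i` moves points right
after the common fixed point `P.1`, and finitely many values are enough as seeds for the deduction
of all others (`Seeds`). If `A i` commutes with the family up to the next dyadic common fixed point,
then `g` may be composed with powers of `A i` there, so that only finitely many slopes at `P.1` have
to be considered. If it does not, then `g` maps the first point after which `A i` fails to commute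
with the family to the corresponding point for `B i`. All seeds without contradiction lead to the
same image of the next common fixed point (`not_lt_of_conj`).

The rules are sound (`Refuted.sound`). They are also complete (`exists_isSol`): the values forced by
a seed without contradiction form the graph of a conjugacy (`Forcing.exists_conj`). Indeed they
accumulate at a common fixed point, near which they contain a line segment (`Forcing.fixedPoint`),
and the set of points near which they form a piecewise linear graph spreads from there over the
whole interval (`Forcing.sweep`). A supremum argument shows that finitely many intervals suffice.

Finally, the rules are semidecidable. Sums of dyadic numbers, their multiples by powers of `2`, the
values of maps given by codes, and affinity on an interval are primitive recursive in the codes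
(`PrimDyadic`, `PrimDyadic.plMap`, `PrimDyadic.affOn`). Equality of two compositions of maps on an
interval is certified by a chain of affine pieces (`eqOn_iff_reflTransGen`). The predicates `Sig1`,
given by an existential quantifier in front of a primitive recursive condition, are closed under the
operations from which the rules are built, including reachability (`Sig1.reflTransGen`). Hence
`Sig1.refuted`, and with it `exists_decision`.
-/

namespace ThompsonPL

open Set

/-! ### Dyadic numbers -/

theorem IsDyadic.intCast (m : ℤ) : IsDyadic m := ⟨m, 0, by simp⟩

theorem IsDyadic.zero : IsDyadic 0 := by simpa using IsDyadic.intCast 0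

theorem IsDyadic.neg {x : ℝ} (hx : IsDyadic x) : IsDyadic (-x) := by
  simpa using IsDyadic.zero.sub hx

theorem isDyadic_neg {x : ℝ} : IsDyadic (-x) ↔ IsDyadic x :=
  ⟨fun h => by simpa using h.neg, IsDyadic.neg⟩

theorem IsDyadic.affine {x y z : ℝ} (hx : IsDyadic x) (hy : IsDyadic y) (hz : IsDyadic z) (e : ℤ) :
    IsDyadic (z + 2 ^ e * (y - x)) := hz.add ((hy.sub hx).zpow_mul e)

theorem isDyadic_affine_iff {x y z : ℝ} (hx : IsDyadic x) (hz : IsDyadic z) (e : ℤ) :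
    IsDyadic (z + 2 ^ e * (y - x)) ↔ IsDyadic y := by
  refine ⟨fun h => ?_, fun hy => hx.affine hy hz e⟩
  have : y = x + 2 ^ (-e) * ((z + 2 ^ e * (y - x)) - z) := by
    rw [zpow_neg]; field_simp; ring
  rw [this]
  exact hz.affine h hx _

theorem exists_dyadic_between {u v : ℝ} (h : u < v) : ∃ d, IsDyadic d ∧ u < d ∧ d < v := by
  obtain ⟨n, hn⟩ := pow_unbounded_of_one_lt (1 / (v - u)) (one_lt_two)
  have h2 : (0 : ℝ) < 2 ^ n := by positivity
  have hvu : 0 < v - u := sub_pos.2 h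
  have h3 : 1 < (v - u) * 2 ^ n := by
    rw [div_lt_iff₀ hvu] at hn; linarith
  refine ⟨(⌊u * 2 ^ n⌋ + 1 : ℤ) / 2 ^ n, ⟨_, n, rfl⟩, ?_, ?_⟩
  · rw [lt_div_iff₀ h2]; push_cast; exact Int.lt_floor_add_one _
  · rw [div_lt_iff₀ h2]; push_cast
    have := Int.floor_le (u * 2 ^ n)
    nlinarith

theorem two_zpow_pos (e : ℤ) : (0 : ℝ) < 2 ^ e := by positivity

theorem two_zpow_inj {e e' : ℤ} (h : (2 : ℝ) ^ e = 2 ^ e') : e = e' :=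
  zpow_right_injective₀ (by norm_num) (by norm_num) h

theorem two_zpow_eq_one {e : ℤ} (h : (2 : ℝ) ^ e = 1) : e = 0 :=
  two_zpow_inj (by simpa using h)

/-! ### Affine pieces -/

/-- `f` is affine with slope `2 ^ e` on `[u, v]`. -/
def AffOn (f : ℝ → ℝ) (u v : ℝ) (e : ℤ) : Prop :=
  ∀ x ∈ Icc u v, ∀ y ∈ Icc u v, f y = f x + 2 ^ e * (y - x)

theorem AffOn.mono {f : ℝ → ℝ} {u v u' v' : ℝ} {e : ℤ} (h : AffOn f u v e) (hu : u ≤ u')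
    (hv : v' ≤ v) : AffOn f u' v' e :=
  fun x hx y hy => h x ⟨hu.trans hx.1, hx.2.trans hv⟩ y ⟨hu.trans hy.1, hy.2.trans hv⟩

theorem AffOn.congr {f g : ℝ → ℝ} {u v : ℝ} {e : ℤ} (h : AffOn f u v e)
    (hfg : ∀ x ∈ Icc u v, f x = g x) : AffOn g u v e :=
  fun x hx y hy => by rw [← hfg x hx, ← hfg y hy]; exact h x hx y hy

theorem AffOn.of_base {f : ℝ → ℝ} {u v : ℝ} {e : ℤ} (z c : ℝ)
    (h : ∀ x ∈ Icc u v, f x = c + 2 ^ e * (x - z)) : AffOn f u v e :=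
  fun x hx y hy => by rw [h x hx, h y hy]; ring

theorem AffOn.image {f : ℝ → ℝ} {u v : ℝ} {e : ℤ} (h : AffOn f u v e) {x y : ℝ}
    (hx : x ∈ Icc u v) (hy : y ∈ Icc u v) (hxy : x ≤ y) : f x ≤ f y := by
  rw [h x hx y hy]
  have := mul_nonneg (two_zpow_pos e).le (sub_nonneg.2 hxy)
  linarith

theorem AffOn.comp {f g : ℝ → ℝ} {u v : ℝ} {e e' : ℤ} (hf : AffOn f u v e)
    (hg : AffOn g (f u) (f v) e') : AffOn (g ∘ f) u v (e' + e) := by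
  intro x hx y hy
  have huv : u ≤ v := hx.1.trans hx.2
  have key : ∀ z ∈ Icc u v, f z ∈ Icc (f u) (f v) := fun z hz =>
    ⟨hf.image ⟨le_rfl, huv⟩ hz hz.1, hf.image hz ⟨huv, le_rfl⟩ hz.2⟩
  simp only [Function.comp]
  rw [hg _ (key x hx) _ (key y hy), hf x hx y hy, zpow_add₀ two_ne_zero]
  ring

theorem AffOn.union {f : ℝ → ℝ} {u v w : ℝ} {e : ℤ} (h1 : AffOn f u v e) (h2 : AffOn f v w e)
    (huv : u ≤ v) (hvw : v ≤ w) : AffOn f u w e := by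
  refine AffOn.of_base v (f v) fun x hx => ?_
  rcases le_total x v with h | h
  · exact h1 v ⟨huv, le_rfl⟩ x ⟨hx.1, h⟩
  · exact h2 v ⟨le_rfl, hvw⟩ x ⟨h, hx.2⟩

theorem AffOn.unique {f : ℝ → ℝ} {u v : ℝ} {e e' : ℤ} (h : AffOn f u v e) (h' : AffOn f u v e')
    (huv : u < v) : e = e' := by
  have h1 := h u ⟨le_rfl, huv.le⟩ v ⟨huv.le, le_rfl⟩
  have h2 := h' u ⟨le_rfl, huv.le⟩ v ⟨huv.le, le_rfl⟩
  apply two_zpow_inj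
  have : (2 : ℝ) ^ e * (v - u) = 2 ^ e' * (v - u) := by linarith
  exact mul_right_cancel₀ (sub_pos.2 huv).ne' this

theorem AffOn.symm {f : ℝ ≃o ℝ} {u v : ℝ} {e : ℤ} (h : AffOn f u v e) :
    AffOn f.symm (f u) (f v) (-e) := by
  have key : ∀ z ∈ Icc (f u) (f v), f.symm z ∈ Icc u v := fun z hz =>
    ⟨(f.le_symm_apply).2 hz.1, (f.symm_apply_le).2 hz.2⟩
  intro x hx y hy
  have := h _ (key x hx) _ (key y hy)
  rw [f.apply_symm_apply, f.apply_symm_apply] at this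
  have h2 : (2 : ℝ) ^ (-e) * 2 ^ e = 1 := by rw [← zpow_add₀ two_ne_zero]; simp
  linear_combination (-2 ^ (-e)) * this - (f.symm y - f.symm x) * h2

/-! ### Locally piecewise linear maps -/

/-- `f` is locally piecewise linear with slopes powers of `2` and dyadic breakpoints, and it
preserves dyadic numbers in both directions. -/
structure IsLPL (f : ℝ → ℝ) : Prop where
  right : ∀ x, ∃ v, x < v ∧ ∃ e, AffOn f x v e
  left : ∀ x, ∃ u, u < x ∧ ∃ e, AffOn f u x e
  two : ∀ x, ¬ IsDyadic x → ∃ u v, u < x ∧ x < v ∧ ∃ e, AffOn f u v e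
  dyadic : ∀ x, IsDyadic (f x) ↔ IsDyadic x

theorem IsLPL.comp {f : ℝ → ℝ} {g : ℝ ≃o ℝ} (hf : IsLPL f) (hg : IsLPL g) :
    IsLPL (f ∘ g) where
  right x := by
    obtain ⟨v, hv, e, he⟩ := hg.right x
    obtain ⟨w, hw, e', he'⟩ := hf.right (g x)
    refine ⟨min v (g.symm w), lt_min hv (g.lt_symm_apply.2 hw), e' + e, ?_⟩
    refine (he.mono le_rfl (min_le_left _ _)).comp (he'.mono le_rfl ?_)
    exact (g.monotone (min_le_right _ _)).trans_eq (g.apply_symm_apply w)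
  left x := by
    obtain ⟨v, hv, e, he⟩ := hg.left x
    obtain ⟨w, hw, e', he'⟩ := hf.left (g x)
    refine ⟨max v (g.symm w), max_lt hv (g.symm_apply_lt.2 hw), e' + e, ?_⟩
    refine (he.mono (le_max_left _ _) le_rfl).comp (he'.mono ?_ le_rfl)
    exact (g.apply_symm_apply w).symm.trans_le (g.monotone (le_max_right _ _))
  two x hx := by
    obtain ⟨u, v, hu, hv, e, he⟩ := hg.two x hx
    obtain ⟨w, w', hw, hw', e', he'⟩ := hf.two (g x) (mt (hg.dyadic x).1 hx)
    refine ⟨max u (g.symm w), min v (g.symm w'), max_lt hu (g.symm_apply_lt.2 hw),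
      lt_min hv (g.lt_symm_apply.2 hw'), e' + e, ?_⟩
    refine (he.mono (le_max_left _ _) (min_le_left _ _)).comp (he'.mono ?_ ?_)
    · exact (g.apply_symm_apply w).symm.trans_le (g.monotone (le_max_right _ _))
    · exact (g.monotone (min_le_right _ _)).trans_eq (g.apply_symm_apply w')
  dyadic x := (hf.dyadic _).trans (hg.dyadic x)

theorem IsLPL.symm {g : ℝ ≃o ℝ} (hg : IsLPL g) : IsLPL g.symm where
  right y := by
    obtain ⟨v, hv, e, he⟩ := hg.right (g.symm y)
    refine ⟨g v, g.symm_apply_lt.1 hv, -e, ?_⟩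
    simpa using he.symm
  left y := by
    obtain ⟨v, hv, e, he⟩ := hg.left (g.symm y)
    refine ⟨g v, g.lt_symm_apply.1 hv, -e, ?_⟩
    simpa using he.symm
  two y hy := by
    obtain ⟨u, v, hu, hv, e, he⟩ := hg.two (g.symm y) fun h => hy (by
      simpa using (hg.dyadic (g.symm y)).2 h)
    exact ⟨g u, g v, g.lt_symm_apply.1 hu, g.symm_apply_lt.1 hv, -e, he.symm⟩
  dyadic y := by rw [← hg.dyadic (g.symm y), g.apply_symm_apply]

theorem IsLPL.affine {f : ℝ → ℝ} {z c : ℝ} (e : ℤ) (hz : IsDyadic z) (hc : IsDyadic c)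
    (h : ∀ x, f x = c + 2 ^ e * (x - z)) : IsLPL f where
  right x := ⟨x + 1, by linarith, e, AffOn.of_base z c fun x _ => h x⟩
  left x := ⟨x - 1, by linarith, e, AffOn.of_base z c fun x _ => h x⟩
  two x _ := ⟨x - 1, x + 1, by linarith, by linarith, e, AffOn.of_base z c fun x _ => h x⟩
  dyadic x := by rw [h]; exact isDyadic_affine_iff hz hc e

theorem IsLPL.one : IsLPL (1 : ℝ ≃o ℝ) :=
  IsLPL.affine 0 IsDyadic.zero IsDyadic.zero fun x => by simp

theorem IsLPL.zpow {g : ℝ ≃o ℝ} (hg : IsLPL g) (n : ℤ) : IsLPL (g ^ n : ℝ ≃o ℝ) := by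
  have hp : ∀ k : ℕ, IsLPL (g ^ k : ℝ ≃o ℝ) := by
    intro k
    induction k with
    | zero => simpa using IsLPL.one
    | succ k ih => rw [pow_succ]; exact IsLPL.comp ih hg
  obtain ⟨k, rfl | rfl⟩ := n.eq_nat_or_neg
  · simpa using hp k
  · rw [zpow_neg, zpow_natCast]; exact (hp k).symm

/-- The affine order automorphism of `ℝ` of slope `2 ^ e` that maps `p` to `q`. -/
noncomputable def affIso (e : ℤ) (p q : ℝ) : ℝ ≃o ℝ where
  toFun x := q + 2 ^ e * (x - p)
  invFun y := p + 2 ^ (-e) * (y - q)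
  left_inv x := by simp only [zpow_neg]; field_simp; ring
  right_inv x := by simp only [zpow_neg]; field_simp; ring
  map_rel_iff' := by
    intro x y
    have := two_zpow_pos e
    simp [this]

@[simp] theorem affIso_apply (e : ℤ) (p q x : ℝ) : affIso e p q x = q + 2 ^ e * (x - p) := rfl

theorem IsLPL.affIso (e : ℤ) {p q : ℝ} (hp : IsDyadic p) (hq : IsDyadic q) :
    IsLPL (affIso e p q) := IsLPL.affine e hp hq fun _ => rfl

/-- The order automorphism that is `f` to the left of `r` and `g` to the right of `r`. -/
noncomputable def splice (r : ℝ) (f g : ℝ ≃o ℝ) (h : f r = g r) : ℝ ≃o ℝ where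
  toFun x := if x ≤ r then f x else g x
  invFun y := if y ≤ f r then f.symm y else g.symm y
  left_inv x := by
    by_cases hx : x ≤ r
    · simp [hx]
    · have : ¬ g x ≤ f r := by rw [h]; simpa using hx
      simp [hx, this]
  right_inv y := by
    by_cases hy : y ≤ f r
    · simp [hy, f.symm_apply_le]
    · have : ¬ g.symm y ≤ r := by rw [g.symm_apply_le, ← h]; exact hy
      simp [hy, this]
  map_rel_iff' := by
    intro x y
    simp only [Equiv.coe_fn_mk]
    by_cases hx : x ≤ r <;> by_cases hy : y ≤ r
    · simp [hx, hy]
    · simp only [hx, hy, if_true, if_false]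
      refine ⟨fun _ => hx.trans (not_le.1 hy).le, fun _ => ?_⟩
      exact (f.monotone hx).trans (h.trans_le (g.monotone (not_le.1 hy).le))
    · simp only [hx, hy, if_true, if_false]
      refine ⟨fun h1 => absurd ?_ hx, fun h1 => absurd (h1.trans hy) hx⟩
      have := (h1.trans (f.monotone hy)).trans_eq h
      exact g.le_iff_le.1 this
    · simp [hx, hy]

theorem splice_of_le {r : ℝ} {f g : ℝ ≃o ℝ} {h : f r = g r} {x : ℝ} (hx : x ≤ r) :
    splice r f g h x = f x := if_pos hx

theorem splice_of_ge {r : ℝ} {f g : ℝ ≃o ℝ} {h : f r = g r} {x : ℝ} (hx : r ≤ x) :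
    splice r f g h x = g x := by
  rcases hx.eq_or_lt with rfl | hx
  · exact (splice_of_le le_rfl).trans h
  · exact if_neg (not_le.2 hx)

theorem IsLPL.splice {r : ℝ} {f g : ℝ ≃o ℝ} (h : f r = g r) (hr : IsDyadic r) (hf : IsLPL f)
    (hg : IsLPL g) : IsLPL (splice r f g h) where
  right x := by
    rcases lt_or_ge x r with hx | hx
    · obtain ⟨v, hv, e, he⟩ := hf.right x
      refine ⟨min v r, lt_min hv hx, e, (he.mono le_rfl (min_le_left _ _)).congr fun y hy => ?_⟩
      exact (splice_of_le (hy.2.trans (min_le_right _ _))).symm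
    · obtain ⟨v, hv, e, he⟩ := hg.right x
      exact ⟨v, hv, e, he.congr fun y hy => (splice_of_ge (hx.trans hy.1)).symm⟩
  left x := by
    rcases le_or_gt x r with hx | hx
    · obtain ⟨v, hv, e, he⟩ := hf.left x
      exact ⟨v, hv, e, he.congr fun y hy => (splice_of_le (hy.2.trans hx)).symm⟩
    · obtain ⟨v, hv, e, he⟩ := hg.left x
      refine ⟨max v r, max_lt hv hx, e, (he.mono (le_max_left _ _) le_rfl).congr fun y hy => ?_⟩
      exact (splice_of_ge ((le_max_right _ _).trans hy.1)).symm
  two x hx := by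
    rcases lt_trichotomy x r with hxr | rfl | hxr
    · obtain ⟨u, v, hu, hv, e, he⟩ := hf.two x hx
      refine ⟨u, min v r, hu, lt_min hv hxr, e,
        (he.mono le_rfl (min_le_left _ _)).congr fun y hy => ?_⟩
      exact (splice_of_le (hy.2.trans (min_le_right _ _))).symm
    · exact absurd hr hx
    · obtain ⟨u, v, hu, hv, e, he⟩ := hg.two x hx
      refine ⟨max u r, v, max_lt hu hxr, hv, e,
        (he.mono (le_max_left _ _) le_rfl).congr fun y hy => ?_⟩
      exact (splice_of_ge ((le_max_right _ _).trans hy.1)).symm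
  dyadic x := by
    rcases le_total x r with hx | hx
    · rw [splice_of_le hx]; exact hf.dyadic x
    · rw [splice_of_ge hx]; exact hg.dyadic x

/-- Any two nondegenerate dyadic intervals are related by a piecewise linear map: two pieces, with
slopes the two consecutive powers of `2` around the quotient of the lengths, are enough. -/
theorem exists_fill {p p' q q' : ℝ} (hp : IsDyadic p) (hp' : IsDyadic p') (hq : IsDyadic q)
    (hq' : IsDyadic q') (hpp : p < p') (hqq : q < q') :
    ∃ f : ℝ ≃o ℝ, IsLPL f ∧ f p = q ∧ f p' = q' := by
  have h0 : 0 < p' - p := sub_pos.2 hpp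
  have h1 : 0 < q' - q := sub_pos.2 hqq
  obtain ⟨e, he1, he2⟩ := exists_mem_Ico_zpow (div_pos h1 h0) (one_lt_two (α := ℝ))
  rw [le_div_iff₀ h0] at he1
  rw [div_lt_iff₀ h0] at he2
  have h2 := two_zpow_pos e
  have h3 : (2 : ℝ) ^ (e + 1) = 2 * 2 ^ e := by rw [zpow_add₀ two_ne_zero]; simp; ring
  -- the break `r` solves `2 ^ e * (r - p) + 2 ^ (e + 1) * (p' - r) = q' - q`
  set r := p + (2 * (p' - p) - 2 ^ (-e) * (q' - q)) with hr
  have h4 : (2 : ℝ) ^ e * 2 ^ (-e) = 1 := by rw [← zpow_add₀ two_ne_zero]; simp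
  have hrd : IsDyadic r := by
    refine hp.add (IsDyadic.sub ?_ ((hq'.sub hq).zpow_mul _))
    simpa using (hp'.sub hp).zpow_mul 1
  have hre : (2 : ℝ) ^ e * (r - p) = 2 * 2 ^ e * (p' - p) - (q' - q) := by
    rw [hr]; linear_combination (-(q' - q)) * h4
  have hpr : p ≤ r := by
    have : 0 < (2 : ℝ) ^ e * (r - p) := by rw [hre]; rw [h3] at he2; linarith
    have := pos_of_mul_pos_right this h2.le
    linarith
  have hrp : r ≤ p' := by
    have : 0 ≤ (2 : ℝ) ^ e * (p' - r) := by nlinarith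
    have := nonneg_of_mul_nonneg_right this h2
    linarith
  have hrq : IsDyadic (q + 2 ^ e * (r - p)) := hp.affine hrd hq e
  have hj : affIso e p q r = affIso (e + 1) r (q + 2 ^ e * (r - p)) r := by simp
  refine ⟨splice r (affIso e p q) (affIso (e + 1) r (q + 2 ^ e * (r - p))) hj,
    IsLPL.splice hj hrd (IsLPL.affIso e hp hq) (IsLPL.affIso _ hrd hrq), ?_, ?_⟩
  · rw [splice_of_le hpr]; simp
  · rw [splice_of_ge hrp, affIso_apply, h3]
    linear_combination -hre

/-- A local property of intervals gives a dyadic subdivision. The relation `Q u v` is assumed for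
short intervals on either side of each point, and also across each point that is not dyadic. -/
theorem exists_subdivision {Q : ℝ → ℝ → Prop}
    (hQ : ∀ u v u' v', Q u v → u ≤ u' → u' < v' → v' ≤ v → Q u' v')
    {p r : ℝ} (hp : IsDyadic p) (hr : IsDyadic r) (hpr : p ≤ r)
    (hright : ∀ x ∈ Ico p r, ∃ v, x < v ∧ Q x v) (hleft : ∀ x ∈ Ioc p r, ∃ u, u < x ∧ Q u x)
    (htwo : ∀ x ∈ Ioo p r, ¬ IsDyadic x → ∃ u v, u < x ∧ x < v ∧ Q u v) :
    Relation.ReflTransGen (fun u v => u < v ∧ IsDyadic u ∧ IsDyadic v ∧ Q u v) p r := by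
  set T := fun u v => u < v ∧ IsDyadic u ∧ IsDyadic v ∧ Q u v with hT
  set S := {x | x ∈ Icc p r ∧ IsDyadic x ∧ Relation.ReflTransGen T p x} with hS
  have hpS : p ∈ S := ⟨⟨le_rfl, hpr⟩, hp, .refl⟩
  have hbdd : BddAbove S := ⟨r, fun x hx => hx.1.2⟩
  set s := sSup S with hs
  have hsS : ∀ x ∈ S, x ≤ s := fun x hx => le_csSup hbdd hx
  have hsI : s ∈ Icc p r := ⟨hsS p hpS, csSup_le ⟨p, hpS⟩ fun x hx => hx.1.2⟩
  have happ : ∀ u < s, ∃ x ∈ S, u < x := fun u hu => exists_lt_of_lt_csSup ⟨p, hpS⟩ hu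
  by_cases hsd : IsDyadic s
  · have hsS' : s ∈ S := by
      rcases hsI.1.eq_or_lt with h | h
      · rwa [← h]
      obtain ⟨u, hu, hq⟩ := hleft s ⟨h, hsI.2⟩
      obtain ⟨x, hx, hux⟩ := happ u hu
      rcases (hsS x hx).eq_or_lt with h | h
      · rwa [← h]
      · exact ⟨hsI, hsd, hx.2.2.tail ⟨h, hx.2.1, hsd, hQ _ _ _ _ hq hux.le h le_rfl⟩⟩
    rcases hsI.2.eq_or_lt with h | h
    · rw [← h]; exact hsS'.2.2
    · exfalso
      obtain ⟨v, hv, hq⟩ := hright s ⟨hsI.1, h⟩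
      obtain ⟨d, hd, hsd', hdv⟩ := exists_dyadic_between (lt_min hv h)
      have : d ∈ S := ⟨⟨hsI.1.trans hsd'.le, (hdv.trans_le (min_le_right _ _)).le⟩, hd,
        hsS'.2.2.tail ⟨hsd', hsd, hd,
          hQ _ _ _ _ hq le_rfl hsd' (hdv.trans_le (min_le_left _ _)).le⟩⟩
      exact absurd (hsS d this) (not_le.2 hsd')
  · exfalso
    have hsr : s < r := lt_of_le_of_ne hsI.2 fun h => hsd (h ▸ hr)
    have hps : p < s := lt_of_le_of_ne hsI.1 fun h => hsd (h ▸ hp)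
    obtain ⟨u, v, hu, hv, hq⟩ := htwo s ⟨hps, hsr⟩ hsd
    obtain ⟨x, hx, hux⟩ := happ u hu
    have hxs := hsS x hx
    obtain ⟨d, hd, hsd', hdv⟩ := exists_dyadic_between (lt_min hv hsr)
    have : d ∈ S := ⟨⟨hsI.1.trans hsd'.le, (hdv.trans_le (min_le_right _ _)).le⟩, hd,
      hx.2.2.tail ⟨hxs.trans_lt hsd', hx.2.1, hd,
        hQ _ _ _ _ hq hux.le (hxs.trans_lt hsd') (hdv.trans_le (min_le_left _ _)).le⟩⟩
    exact absurd (hsS d this) (not_le.2 hsd')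

end ThompsonPL

namespace ThompsonPL

open Set Filter Topology Relation

/-! ### Conjugation near a fixed point -/

/-- The graph of `f` meets the diagonal over `[u, v]`, as witnessed by the values at the ends. -/
def HasFixIn (f : ℝ → ℝ) (u v : ℝ) : Prop := (u ≤ f u ∧ f v ≤ v) ∨ (f u ≤ u ∧ v ≤ f v)

theorem HasFixIn.exists_fix {f : ℝ ≃o ℝ} {u v : ℝ} (h : HasFixIn f u v) (huv : u ≤ v) :
    ∃ d ∈ Icc u v, f d = d := by
  have hc : ContinuousOn (fun x => f x - x) (Icc u v) :=
    (f.continuous.sub continuous_id).continuousOn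
  rcases h with ⟨h1, h2⟩ | ⟨h1, h2⟩
  · obtain ⟨d, hd, h⟩ := intermediate_value_Icc' huv hc (show (0 : ℝ) ∈ _ from
      ⟨sub_nonpos.2 h2, sub_nonneg.2 h1⟩)
    exact ⟨d, hd, sub_eq_zero.1 h⟩
  · obtain ⟨d, hd, h⟩ := intermediate_value_Icc huv hc (show (0 : ℝ) ∈ _ from
      ⟨sub_nonpos.2 h1, sub_nonneg.2 h2⟩)
    exact ⟨d, hd, sub_eq_zero.1 h⟩

theorem hasFixIn_of_fix {f : ℝ → ℝ} {u v d : ℝ} {s : ℤ} (h : AffOn f u v s) (hd : d ∈ Icc u v)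
    (hfd : f d = d) : HasFixIn f u v := by
  have huv := hd.1.trans hd.2
  have h1 := h d hd u ⟨le_rfl, huv⟩
  have h2 := h d hd v ⟨huv, le_rfl⟩
  rw [hfd] at h1 h2
  have h3 := sub_nonneg.2 hd.1
  have h4 := sub_nonneg.2 hd.2
  rcases le_total ((2 : ℝ) ^ s) 1 with hs | hs
  · left; constructor <;> nlinarith
  · right; constructor <;> nlinarith

/-- The fixed point of a nontrivial affine map, computed from any point and its image. -/
theorem fix_eq {f : ℝ → ℝ} {u v d x : ℝ} {s : ℤ} (h : AffOn f u v s) (hd : d ∈ Icc u v)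
    (hx : x ∈ Icc u v) (hfd : f d = d) (hs : s ≠ 0) : d = x + (f x - x) / (1 - 2 ^ s) := by
  have h1 := h d hd x hx
  have h2 : (1 : ℝ) - 2 ^ s ≠ 0 := fun h0 => hs (two_zpow_eq_one (by linarith))
  field_simp
  rw [hfd] at h1
  linear_combination -h1

theorem iterate_contract {f : ℝ → ℝ} {u v d : ℝ} {s : ℤ} (h : AffOn f u v s) (hd : d ∈ Icc u v)
    (hfd : f d = d) (hs : s < 0) {y : ℝ} (hy : y ∈ Icc u v) (n : ℕ) :
    f^[n] y = d + ((2 : ℝ) ^ s) ^ n * (y - d) := by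
  have h0 := two_zpow_pos s
  have h1 : (2 : ℝ) ^ s < 1 := zpow_lt_one_of_neg₀ one_lt_two hs
  have hmem : ∀ n : ℕ, d + ((2 : ℝ) ^ s) ^ n * (y - d) ∈ Icc u v := by
    intro n
    have h2 : ((2 : ℝ) ^ s) ^ n ≤ 1 := pow_le_one₀ h0.le h1.le
    have h3 : 0 < ((2 : ℝ) ^ s) ^ n := pow_pos h0 n
    obtain ⟨hd1, hd2⟩ := hd
    obtain ⟨hy1, hy2⟩ := hy
    constructor <;> nlinarith
  induction n with
  | zero => simp
  | succ n ih =>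
    rw [Function.iterate_succ_apply', ih, h d hd _ (hmem n), hfd, pow_succ]
    ring

theorem tendsto_contract {s : ℤ} (hs : s < 0) (d c : ℝ) :
    Tendsto (fun n : ℕ => d + ((2 : ℝ) ^ s) ^ n * c) atTop (𝓝 d) := by
  have := ((tendsto_pow_atTop_nhds_zero_of_lt_one (two_zpow_pos s).le
    (zpow_lt_one_of_neg₀ one_lt_two hs)).mul_const c).const_add d
  simpa using this

theorem iterate_comm {f h g : ℝ ≃o ℝ} (hg : ∀ x, g (f x) = h (g x)) (n : ℕ) (x : ℝ) :
    g (f^[n] x) = h^[n] (g x) := by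
  induction n generalizing x with
  | zero => rfl
  | succ n ih => rw [Function.iterate_succ_apply, Function.iterate_succ_apply, ih, hg]

/-- The data of two maps `f`, `h` that are affine and not translations near fixed points `d`, `d'`,
both contracting or both expanding, and a conjugacy `g` between them. -/
structure ConjZone (f h g : ℝ ≃o ℝ) (u v d u' v' d' : ℝ) (s s' : ℤ) : Prop where
  comm : ∀ x, g (f x) = h (g x)
  aff : AffOn f u v s
  mem : d ∈ Icc u v
  fix : f d = d
  aff' : AffOn h u' v' s'
  mem' : d' ∈ Icc u' v'
  fix' : h d' = d'
  sign : 0 < s * s'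

/-- Passing to the inverses exchanges the expanding and the contracting case. -/
theorem ConjZone.symm {f h g : ℝ ≃o ℝ} {u v d u' v' d' : ℝ} {s s' : ℤ}
    (H : ConjZone f h g u v d u' v' d' s s') (hs : 0 < s) :
    ConjZone f.symm h.symm g u v d u' v' d' (-s) (-s') := by
  have key : ∀ {f : ℝ ≃o ℝ} {u v d : ℝ} {s : ℤ}, AffOn f u v s → d ∈ Icc u v → f d = d → 0 < s →
      AffOn f.symm u v (-s) := by
    intro f u v d s h hd hfd hs
    have huv := hd.1.trans hd.2
    have h1 : (1 : ℝ) < 2 ^ s := one_lt_zpow₀ one_lt_two hs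
    refine h.symm.mono ?_ ?_
    · rw [h d hd u ⟨le_rfl, huv⟩, hfd]; nlinarith [hd.1]
    · rw [h d hd v ⟨huv, le_rfl⟩, hfd]; nlinarith [hd.2]
  have hs' : 0 < s' := pos_of_mul_pos_right H.sign hs.le
  refine ⟨fun x => ?_, key H.aff H.mem H.fix hs, H.mem, ?_, key H.aff' H.mem' H.fix' hs', H.mem',
    ?_, by have := H.sign; linarith [neg_mul_neg s s']⟩
  · rw [OrderIso.eq_symm_apply, ← H.comm, f.apply_symm_apply]
  · rw [f.symm_apply_eq, H.fix]
  · rw [h.symm_apply_eq, H.fix']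

/-- It is enough to consider contracting maps, for a claim about the exponents that is invariant
under their negation. -/
theorem ConjZone.neg_or {f h g : ℝ ≃o ℝ} {u v d u' v' d' : ℝ} {s s' : ℤ}
    (H : ConjZone f h g u v d u' v' d' s s') {P : ℤ → ℤ → Prop} (hP : ∀ s s', P (-s) (-s') → P s s')
    (hneg : ∀ (f h : ℝ ≃o ℝ) (s s' : ℤ), ConjZone f h g u v d u' v' d' s s' → s < 0 → s' < 0 →
      P s s') : P s s' := by
  have hs0 := H.sign
  rcases lt_trichotomy s 0 with hs | hs | hs
  · exact hneg f h s s' H hs (by by_contra hc; nlinarith)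
  · simp [hs] at hs0
  · have hs' : 0 < s' := pos_of_mul_pos_right hs0 hs.le
    exact hP _ _ (hneg _ _ _ _ (H.symm hs) (by omega) (by omega))

/-- The iterates of a point in the zone converge to the fixed point, so a conjugacy that maps one
point of a zone into the other zone maps fixed point to fixed point. -/
theorem ConjZone.map_fix {f h g : ℝ ≃o ℝ} {u v d u' v' d' : ℝ} {s s' : ℤ}
    (H : ConjZone f h g u v d u' v' d' s s') {x : ℝ} (hx : x ∈ Icc u v) (hx' : g x ∈ Icc u' v') :
    g d = d' := by
  refine H.neg_or (P := fun _ _ => g d = d') (fun _ _ h => h) fun f h s s' H hs hs' => ?_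
  have h1 : Tendsto (fun n => f^[n] x) atTop (𝓝 d) := by
    simp only [iterate_contract H.aff H.mem H.fix hs hx]
    exact tendsto_contract hs _ _
  have h2 : Tendsto (fun n => h^[n] (g x)) atTop (𝓝 d') := by
    simp only [iterate_contract H.aff' H.mem' H.fix' hs' hx']
    exact tendsto_contract hs' _ _
  have h3 := (g.continuous.tendsto d).comp h1
  simp only [Function.comp_def, iterate_comm H.comm] at h3
  exact tendsto_nhds_unique h3 h2

/-- `y` lies on a side of `d` into which `[w₁, w₂]` extends beyond `d`. -/
def SameSide (w₁ w₂ d y : ℝ) : Prop := (w₁ < d ∨ d ≤ y) ∧ (d < w₂ ∨ y ≤ d)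

theorem eventually_mem {w₁ w₂ d y : ℝ} (hw : d ∈ Icc w₁ w₂) (hy : SameSide w₁ w₂ d y) {s : ℤ}
    (hs : s < 0) : ∀ᶠ n : ℕ in atTop, d + ((2 : ℝ) ^ s) ^ n * (y - d) ∈ Icc w₁ w₂ := by
  have ht := tendsto_contract hs d (y - d)
  have hp : ∀ n : ℕ, (0 : ℝ) < ((2 : ℝ) ^ s) ^ n := fun n => pow_pos (two_zpow_pos s) n
  have h1 : ∀ᶠ n : ℕ in atTop, w₁ ≤ d + ((2 : ℝ) ^ s) ^ n * (y - d) := by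
    rcases hy.1 with h | h
    · exact (ht.eventually (lt_mem_nhds h)).mono fun n hn => hn.le
    · refine Eventually.of_forall fun n => ?_
      have := mul_nonneg (hp n).le (sub_nonneg.2 h)
      linarith [hw.1]
  have h2 : ∀ᶠ n : ℕ in atTop, d + ((2 : ℝ) ^ s) ^ n * (y - d) ≤ w₂ := by
    rcases hy.2 with h | h
    · exact (ht.eventually (gt_mem_nhds h)).mono fun n hn => hn.le
    · refine Eventually.of_forall fun n => ?_
      have := mul_nonneg (hp n).le (sub_nonneg.2 h)
      linarith [hw.2]
  exact h1.and h2

/-- If the conjugacy is affine on the side of the fixed point where `x` lies, the iterates of `x`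
enter the part where it is affine. Comparing two consecutive iterates shows that the slopes of the
two maps agree, and then the value at `x` is that of the affine map. -/
theorem ConjZone.slope {f h g : ℝ ≃o ℝ} {u v d u' v' d' : ℝ} {s s' : ℤ}
    (H : ConjZone f h g u v d u' v' d' s s') {x : ℝ} (hx : x ∈ Icc u v) (hx' : g x ∈ Icc u' v')
    (hxd : x ≠ d) {w₁ w₂ : ℝ} {m : ℤ} (hg : AffOn g w₁ w₂ m) (hw : d ∈ Icc w₁ w₂)
    (hside : SameSide w₁ w₂ d x) : s = s' ∧ g x = d' + 2 ^ m * (x - d) := by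
  have hgd := H.map_fix hx hx'
  refine H.neg_or (P := fun s s' => s = s' ∧ g x = d' + 2 ^ m * (x - d))
    (fun _ _ h => ⟨by omega, h.2⟩) fun f h s s' H hs hs' => ?_
  have key : ∀ᶠ n : ℕ in atTop,
      2 ^ m * (((2 : ℝ) ^ s) ^ n * (x - d)) = ((2 : ℝ) ^ s') ^ n * (g x - d') := by
    filter_upwards [eventually_mem hw hside hs] with n hn
    have h1 := iterate_comm H.comm n x
    rw [iterate_contract H.aff H.mem H.fix hs hx,
      iterate_contract H.aff' H.mem' H.fix' hs' hx', hg d hw _ hn, hgd] at h1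
    linear_combination h1
  obtain ⟨N, hN⟩ := eventually_atTop.1 key
  have h1 := hN N le_rfl
  have h2 := hN (N + 1) (Nat.le_succ N)
  have hp : ((2 : ℝ) ^ s) ^ N ≠ 0 := (pow_pos (two_zpow_pos s) N).ne'
  have hm := (two_zpow_pos m).ne'
  have hxd' : x - d ≠ 0 := sub_ne_zero.2 hxd
  have hss : s = s' := by
    apply two_zpow_inj
    rw [pow_succ, pow_succ] at h2
    have h3 : 2 ^ m * (((2 : ℝ) ^ s) ^ N * (x - d)) * ((2 : ℝ) ^ s - 2 ^ s') = 0 := by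
      linear_combination h2 - 2 ^ s' * h1
    rcases mul_eq_zero.1 h3 with h4 | h4
    · exact absurd h4 (mul_ne_zero hm (mul_ne_zero hp hxd'))
    · linarith
  subst hss
  refine ⟨rfl, ?_⟩
  have h4 : ((2 : ℝ) ^ s) ^ N * (2 ^ m * (x - d) - (g x - d')) = 0 := by linear_combination h1
  rcases mul_eq_zero.1 h4 with h5 | h5
  · exact absurd h5 hp
  · linarith

/-- A conjugacy that is affine near the fixed point is affine as far as the two maps are. -/
theorem ConjZone.extend {f h g : ℝ ≃o ℝ} {u v d u' v' d' : ℝ} {s : ℤ}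
    (H : ConjZone f h g u v d u' v' d' s s) (hgd : g d = d') {w₁ w₂ : ℝ} {m : ℤ}
    (hg : AffOn g w₁ w₂ m) (hw : d ∈ Icc w₁ w₂) {y : ℝ} (hy : y ∈ Icc u v)
    (hside : SameSide w₁ w₂ d y) (hy' : d' + 2 ^ m * (y - d) ∈ Icc u' v') :
    g y = d' + 2 ^ m * (y - d) := by
  refine H.neg_or (P := fun s s' => s = s' → g y = d' + 2 ^ m * (y - d))
    (fun _ _ h h' => h (by omega)) (fun f h s s' H hs hs' hss => ?_) rfl
  subst hss
  obtain ⟨n, hn⟩ := (eventually_mem hw hside hs).exists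
  have h1 := iterate_comm H.comm n y
  rw [iterate_contract H.aff H.mem H.fix hs hy, hg d hw _ hn, hgd] at h1
  have h2 := iterate_contract H.aff' H.mem' H.fix' hs' hy' n
  apply h.injective.iterate n
  rw [← h1, h2]
  ring

end ThompsonPL

namespace ThompsonPL

open Set Filter Topology Relation

/-! ### Forced values of a conjugacy -/

/-- A nondegenerate dyadic interval over which `f` is affine and has a fixed point. -/
structure Zone (f : ℝ → ℝ) (u v : ℝ) (s : ℤ) : Prop where
  lt : u < v
  dyadic_left : IsDyadic u
  dyadic_right : IsDyadic v
  aff : AffOn f u v s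
  fix : HasFixIn f u v

section Defs

variable {ι : Type*} (a b : ι → ℝ → ℝ)

/-- If `P.1 ↦ P.2` under a conjugacy between two maps that are affine near a fixed point, the
conjugacy is affine there, and `Q.1 ↦ Q.2`. The last condition ensures that the fixed point is not
a breakpoint in the interior of the interval. -/
def ZoneStep (f h : ℝ → ℝ) (P Q : ℝ × ℝ) : Prop :=
  ∃ (u v : ℝ) (s m : ℤ), Zone f u v s ∧ s ≠ 0 ∧ (u ≤ P.1 ∧ P.1 ≤ v) ∧ (u ≤ Q.1 ∧ Q.1 ≤ v) ∧
    f P.1 ≠ P.1 ∧ 2 ^ m * (f P.1 - P.1) = h P.2 - P.2 ∧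
    AffOn h (P.2 + 2 ^ m * (u - P.1)) (P.2 + 2 ^ m * (v - P.1)) s ∧
    Q.2 = P.2 + 2 ^ m * (Q.1 - P.1) ∧
    (f u = u ∨ f v = v ∨ ¬ IsDyadic (P.1 + (f P.1 - P.1) / (1 - 2 ^ s)))

/-- One step of the deduction of values of a map that conjugates each `a i` to `b i`: if
`P.1 ↦ P.2`, then `Q.1 ↦ Q.2`. -/
def FStep (P Q : ℝ × ℝ) : Prop :=
  IsDyadic Q.1 ∧ IsDyadic Q.2 ∧ ∃ i, (a i P.1 = Q.1 ∧ b i P.2 = Q.2) ∨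
    (a i Q.1 = P.1 ∧ b i Q.2 = P.2) ∨ ZoneStep (a i) (b i) P Q

/-- `P.1 ↦ P.2` implies `Q.1 ↦ Q.2` for every map that conjugates each `a i` to `b i`. -/
def Forced (P Q : ℝ × ℝ) : Prop := ReflTransGen (FStep a b) P Q

/-- `P.1 ↦ P.2` is impossible for a conjugacy between `f` and `h`, because of the slopes at the
fixed points that the iterates converge to: they differ, or the slope of the conjugacy would not
be a power of `2`. -/
def ZoneClash (f h : ℝ → ℝ) (P : ℝ × ℝ) : Prop :=
  ∃ (u v u' v' : ℝ) (s s' : ℤ), Zone f u v s ∧ Zone h u' v' s' ∧ (u ≤ P.1 ∧ P.1 ≤ v) ∧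
    (u' ≤ P.2 ∧ P.2 ≤ v') ∧ 0 < s * s' ∧ f P.1 ≠ P.1 ∧
    (s ≠ s' ∨ ∃ m : ℤ, 2 ^ m * |f P.1 - P.1| < |h P.2 - P.2| ∧
      |h P.2 - P.2| < 2 ^ (m + 1) * |f P.1 - P.1|)

/-- `P.1 ↦ P.2` and `T.1 ↦ T.2` are contradictory. -/
def ChainContra (P T : ℝ × ℝ) : Prop :=
  ∃ X, Forced a b T X ∧ ((X.1 = P.1 ∧ X.2 ≠ P.2) ∨
    (∃ Y, Forced a b T Y ∧ ((X.1 < Y.1 ∧ Y.2 ≤ X.2) ∨ (X.1 = Y.1 ∧ X.2 ≠ Y.2))) ∨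
    ∃ i, ZoneClash (a i) (b i) X)

end Defs

/-- `g` conjugates each `A i` to `B i`, and is a piecewise linear map supported in `[L, R]`. -/
structure IsSol {ι : Type*} (A B : ι → ℝ ≃o ℝ) (L R : ℝ) (g : ℝ ≃o ℝ) : Prop where
  lpl : IsLPL g
  left : ∀ x ≤ L, g x = x
  right : ∀ x, R ≤ x → g x = x
  comm : ∀ i x, g (A i x) = B i (g x)

/-- The underlying functions of a family of order automorphisms. -/
abbrev fns {ι : Type*} (A : ι → ℝ ≃o ℝ) : ι → ℝ → ℝ := fun i => A i

/-- On either side of a fixed point, a locally piecewise linear map is affine. -/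
theorem IsLPL.exists_sameSide {g : ℝ → ℝ} (hg : IsLPL g) (d x : ℝ) :
    ∃ w₁ w₂ m, AffOn g w₁ w₂ m ∧ d ∈ Icc w₁ w₂ ∧ SameSide w₁ w₂ d x := by
  rcases le_total x d with h | h
  · obtain ⟨u, hu, e, he⟩ := hg.left d
    exact ⟨u, d, e, he, ⟨hu.le, le_rfl⟩, Or.inl hu, Or.inr h⟩
  · obtain ⟨u, hu, e, he⟩ := hg.right d
    exact ⟨d, u, e, he, ⟨le_rfl, hu.le⟩, Or.inr h, Or.inl hu⟩

section Sound

variable {ι : Type*} {A B : ι → ℝ ≃o ℝ} {L R : ℝ} {g : ℝ ≃o ℝ}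

/-- The slope of the conjugacy near the fixed point is determined by the displacements of `P.1` and
`P.2`, and by `ConjZone.extend` it persists over the whole zone. -/
theorem ZoneStep.sound {f h g : ℝ ≃o ℝ} (hg : IsLPL g) (hc : ∀ x, g (f x) = h (g x))
    {P Q : ℝ × ℝ} (H : ZoneStep f h P Q) (hP : g P.1 = P.2) : g Q.1 = Q.2 := by
  obtain ⟨u, v, s, m, hz, hs, hPm, hQm, hne, hm, haff, hQ, hend⟩ := H
  obtain ⟨d, hd, hfd⟩ := hz.fix.exists_fix hz.lt.le
  set φ : ℝ → ℝ := fun x => P.2 + 2 ^ m * (x - P.1) with hφ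
  have hφm : ∀ x y, x ≤ y → φ x ≤ φ y := fun x y hxy => by
    have := mul_nonneg (two_zpow_pos m).le (sub_nonneg.2 hxy)
    simp only [hφ]; linarith
  have hφI : ∀ x ∈ Icc u v, φ x ∈ Icc (φ u) (φ v) := fun x hx => ⟨hφm _ _ hx.1, hφm _ _ hx.2⟩
  have hPφ : φ P.1 = P.2 := by simp [hφ]
  have hPI := hφI _ hPm
  rw [hPφ] at hPI
  have hfix' : h (φ d) = φ d := by
    have h1 := haff P.2 hPI (φ d) (hφI d hd)
    have h2 := hz.aff d hd P.1 hPm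
    rw [hfd] at h2
    have h3 : φ d = P.2 + 2 ^ m * (d - P.1) := rfl
    linear_combination h1 + (2 ^ s - 1) * h3 - hm + 2 ^ m * h2
  have hPd : P.1 ≠ d := fun h0 => hne (by rw [h0, hfd])
  have H : ConjZone f h g u v d (φ u) (φ v) (φ d) s s :=
    ⟨hc, hz.aff, hd, hfd, haff, hφI d hd, hfix', mul_self_pos.2 hs⟩
  have hgP : g P.1 ∈ Icc (φ u) (φ v) := by rw [hP]; exact hPI
  have hgd := H.map_fix hPm hgP
  -- `g` is affine near `d`, on all of the sides of `d` that matter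
  obtain ⟨w₁, w₂, k, hk, hw, hside⟩ : ∃ w₁ w₂ k, AffOn g w₁ w₂ k ∧ d ∈ Icc w₁ w₂ ∧
      ∀ y ∈ Icc u v, SameSide w₁ w₂ d y := by
    have huniq : ∀ x ∈ Icc u v, f x = x → x = d := fun x hx hfx => by
      have h1 := hz.aff d hd x hx
      rw [hfx, hfd] at h1
      have h2 : (x - d) * (1 - 2 ^ s) = 0 := by linear_combination h1
      rcases mul_eq_zero.1 h2 with h3 | h3
      · linarith
      · exact absurd (two_zpow_eq_one (by linarith)) hs
    rcases hend with h1 | h1 | h1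
    · have := huniq u ⟨le_rfl, hz.lt.le⟩ h1
      obtain ⟨w, hw, e, he⟩ := hg.right d
      exact ⟨d, w, e, he, ⟨le_rfl, hw.le⟩, fun y hy => ⟨Or.inr (this ▸ hy.1), Or.inl hw⟩⟩
    · have := huniq v ⟨hz.lt.le, le_rfl⟩ h1
      obtain ⟨w, hw, e, he⟩ := hg.left d
      exact ⟨w, d, e, he, ⟨hw.le, le_rfl⟩, fun y hy => ⟨Or.inl hw, Or.inr (this ▸ hy.2)⟩⟩
    · rw [← fix_eq hz.aff hd hPm hfd hs] at h1
      obtain ⟨w, w', hw, hw', e, he⟩ := hg.two d h1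
      exact ⟨w, w', e, he, ⟨hw.le, hw'.le⟩, fun y _ => ⟨Or.inl hw, Or.inl hw'⟩⟩
  have hsl := (H.slope hPm hgP hPd hk hw (hside _ hPm)).2
  have hkm : k = m := by
    apply two_zpow_inj
    have h1 : 2 ^ k * (P.1 - d) = 2 ^ m * (P.1 - d) := by
      have h3 : φ d = P.2 + 2 ^ m * (d - P.1) := rfl
      rw [hP] at hsl
      linear_combination -hsl - h3
    exact mul_right_cancel₀ (sub_ne_zero.2 hPd) h1
  subst hkm
  have hline : φ d + 2 ^ k * (Q.1 - d) = φ Q.1 := by simp only [hφ]; ring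
  rw [H.extend hgd hk hw hQm (hside _ hQm) (by rw [hline]; exact hφI _ hQm), hline, hQ]

/-- The conjugacy has some slope `2 ^ m` at the fixed point, and then the displacement of `P.2` is
`2 ^ m` times that of `P.1`. -/
theorem ZoneClash.sound {f h g : ℝ ≃o ℝ} (hg : IsLPL g) (hc : ∀ x, g (f x) = h (g x))
    {P : ℝ × ℝ} (H : ZoneClash f h P) : g P.1 ≠ P.2 := by
  intro hP
  obtain ⟨u, v, u', v', s, s', hz, hz', hPm, hPm', hss, hne, hcl⟩ := H
  obtain ⟨d, hd, hfd⟩ := hz.fix.exists_fix hz.lt.le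
  obtain ⟨d', hd', hfd'⟩ := hz'.fix.exists_fix hz'.lt.le
  have hPd : P.1 ≠ d := fun h0 => hne (by rw [h0, hfd])
  have H : ConjZone f h g u v d u' v' d' s s' :=
    ⟨hc, hz.aff, hd, hfd, hz'.aff, hd', hfd', hss⟩
  obtain ⟨w₁, w₂, k, hk, hw, hside⟩ := hg.exists_sameSide d P.1
  obtain ⟨h1, h2⟩ := H.slope hPm (by rw [hP]; exact hPm') hPd hk hw hside
  rcases hcl with h3 | ⟨m, h3, h4⟩
  · exact h3 h1
  · subst h1
    have h5 := hz.aff d hd P.1 hPm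
    have h6 := hz'.aff d' hd' P.2 hPm'
    rw [hfd] at h5
    rw [hfd'] at h6
    rw [hP] at h2
    have h7 : h P.2 - P.2 = 2 ^ k * (f P.1 - P.1) := by
      linear_combination h6 + (2 ^ s - 1) * h2 - 2 ^ k * h5
    have h8 : 0 < |f P.1 - P.1| := abs_pos.2 (sub_ne_zero.2 hne)
    rw [h7, abs_mul, abs_of_pos (two_zpow_pos k)] at h3 h4
    have h9 := lt_of_mul_lt_mul_right h3 h8.le
    have h10 := lt_of_mul_lt_mul_right h4 h8.le
    rw [zpow_lt_zpow_iff_right₀ one_lt_two] at h9 h10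
    omega

theorem Forced.sound (hg : IsLPL g) (hc : ∀ i x, g (A i x) = B i (g x)) {P Q : ℝ × ℝ}
    (H : Forced (fns A) (fns B) P Q) (hP : g P.1 = P.2) : g Q.1 = Q.2 := by
  induction H with
  | refl => exact hP
  | @tail X Y _ h ih =>
    obtain ⟨-, -, i, h | h | h⟩ := h
    · rw [← h.1, ← h.2, ← ih]; exact hc i _
    · apply (B i).injective
      rw [← hc]
      exact (congrArg g h.1).trans (ih.trans h.2.symm)
    · exact h.sound hg (hc i) ih

theorem ChainContra.sound (hg : IsLPL g) (hc : ∀ i x, g (A i x) = B i (g x)) {P T : ℝ × ℝ}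
    (H : ChainContra (fns A) (fns B) P T) (hP : g P.1 = P.2) : g T.1 ≠ T.2 := by
  intro hT
  obtain ⟨X, hX, h | ⟨Y, hY, h | h⟩ | ⟨i, h⟩⟩ := H
  · exact h.2 (by rw [← hX.sound hg hc hT, h.1, hP])
  · have h1 := hX.sound hg hc hT
    have h2 := hY.sound hg hc hT
    have := g.strictMono h.1
    linarith [h.2]
  · have h1 := hX.sound hg hc hT
    have h2 := hY.sound hg hc hT
    exact h.2 (by rw [← h1, ← h2, h.1])
  · exact h.sound hg (hc i) (hX.sound hg hc hT)

end Sound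

end ThompsonPL

namespace ThompsonPL

open Set Filter Topology Relation

/-! ### Local forcing -/

section Seg

variable (Φ : ℝ → ℝ → Prop)

/-- The relation `Φ` contains the dyadic points over `[u, v]` of the line of slope `2 ^ e` through
`(x, x')`. -/
def Seg (u v x x' : ℝ) (e : ℤ) : Prop := ∀ y ∈ Icc u v, IsDyadic y → Φ y (x' + 2 ^ e * (y - x))

/-- `Φ` contains a line segment ending on the right at `(x, x')`. -/
def GoodLeft (x x' : ℝ) : Prop := ∃ u, u < x ∧ ∃ e, Seg Φ u x x x' e

/-- `Φ` contains a line segment starting at `(x, x')`. -/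
def GoodRight (x x' : ℝ) : Prop := ∃ v, x < v ∧ ∃ e, Seg Φ x v x x' e

/-- `Φ` contains a line segment around `(x, x')`. -/
def GoodTwo (x x' : ℝ) : Prop := ∃ u v, u < x ∧ x < v ∧ ∃ e, Seg Φ u v x x' e

/-- Near `x`, the relation `Φ` contains the graph of a piecewise linear map with value `x'` at
`x` and with dyadic breakpoints. -/
structure Good (x x' : ℝ) : Prop where
  left : GoodLeft Φ x x'
  right : GoodRight Φ x x'
  two : ¬ IsDyadic x → GoodTwo Φ x x'

variable {Φ}

theorem Seg.mono {u v u' v' x x' : ℝ} {e : ℤ} (h : Seg Φ u v x x' e) (hu : u ≤ u') (hv : v' ≤ v) :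
    Seg Φ u' v' x x' e := fun y hy => h y ⟨hu.trans hy.1, hy.2.trans hv⟩

theorem Seg.rebase {u v x x' : ℝ} {e : ℤ} (h : Seg Φ u v x x' e) (z : ℝ) :
    Seg Φ u v z (x' + 2 ^ e * (z - x)) e := fun y hy hd => by
  have : x' + 2 ^ e * (z - x) + 2 ^ e * (y - z) = x' + 2 ^ e * (y - x) := by ring
  rw [this]; exact h y hy hd

theorem Seg.good {u v x x' : ℝ} {e : ℤ} (h : Seg Φ u v x x' e) {z : ℝ} (hz : z ∈ Ioo u v) :
    Good Φ z (x' + 2 ^ e * (z - x)) :=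
  ⟨⟨u, hz.1, e, (h.rebase z).mono le_rfl hz.2.le⟩, ⟨v, hz.2, e, (h.rebase z).mono hz.1.le le_rfl⟩,
    fun _ => ⟨u, v, hz.1, hz.2, e, h.rebase z⟩⟩

/-- The image of a segment under a pair of maps that preserves `Φ`, after shrinking it to where
both maps are affine. -/
theorem Seg.push {f h : ℝ ≃o ℝ} (hf : IsLPL f) (hpush : ∀ x x', Φ x x' → Φ (f x) (h x'))
    {u v x x' : ℝ} {e : ℤ} (H : Seg Φ u v x x' e) (hx : x ∈ Icc u v)
    {w₁ w₂ : ℝ} {s : ℤ} (hfa : AffOn f w₁ w₂ s) (hw : x ∈ Icc w₁ w₂)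
    {z₁ z₂ : ℝ} {s' : ℤ} (hha : AffOn h z₁ z₂ s') (hz : x' ∈ Icc z₁ z₂) :
    ∃ u' v', u' ≤ f x ∧ f x ≤ v' ∧ (u < x → w₁ < x → z₁ < x' → u' < f x) ∧
      (x < v → x < w₂ → x' < z₂ → f x < v') ∧ Seg Φ u' v' (f x) (h x') (s' + e - s) := by
  have hpe := two_zpow_pos (-e)
  have hee : (2 : ℝ) ^ e * 2 ^ (-e) = 1 := by rw [← zpow_add₀ two_ne_zero]; simp
  set u₁ := max u (max w₁ (x + 2 ^ (-e) * (z₁ - x'))) with hu₁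
  set v₁ := min v (min w₂ (x + 2 ^ (-e) * (z₂ - x'))) with hv₁
  have hu₁x : u₁ ≤ x := by
    refine max_le hx.1 (max_le hw.1 ?_)
    have := mul_nonneg hpe.le (sub_nonneg.2 hz.1)
    linarith
  have hxv₁ : x ≤ v₁ := by
    refine le_min hx.2 (le_min hw.2 ?_)
    have := mul_nonneg hpe.le (sub_nonneg.2 hz.2)
    linarith
  refine ⟨f u₁, f v₁, f.monotone hu₁x, f.monotone hxv₁, fun h1 h2 h3 => ?_, fun h1 h2 h3 => ?_, ?_⟩
  · refine f.strictMono (max_lt h1 (max_lt h2 ?_))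
    have := mul_pos hpe (sub_pos.2 h3)
    linarith
  · refine f.strictMono (lt_min h1 (lt_min h2 ?_))
    have := mul_pos hpe (sub_pos.2 h3)
    linarith
  · intro y hy hyd
    obtain ⟨y, rfl⟩ := f.surjective y
    have hy1 : u₁ ≤ y := f.le_iff_le.1 hy.1
    have hy2 : y ≤ v₁ := f.le_iff_le.1 hy.2
    have hyw : y ∈ Icc w₁ w₂ := ⟨((le_max_left _ _).trans (le_max_right _ _)).trans hy1,
      hy2.trans ((min_le_right _ _).trans (min_le_left _ _))⟩
    have hy3 : x + 2 ^ (-e) * (z₁ - x') ≤ y :=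
      ((le_max_right _ _).trans (le_max_right _ _)).trans hy1
    have hy4 : y ≤ x + 2 ^ (-e) * (z₂ - x') :=
      hy2.trans ((min_le_right _ _).trans (min_le_right _ _))
    have hyz : x' + 2 ^ e * (y - x) ∈ Icc z₁ z₂ := by
      have hp := two_zpow_pos e
      constructor
      · have := mul_le_mul_of_nonneg_left hy3 hp.le
        have : z₁ - x' = 2 ^ e * (2 ^ (-e) * (z₁ - x')) := by rw [← mul_assoc, hee, one_mul]
        linarith
      · have := mul_le_mul_of_nonneg_left hy4 hp.le
        have : z₂ - x' = 2 ^ e * (2 ^ (-e) * (z₂ - x')) := by rw [← mul_assoc, hee, one_mul]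
        linarith
    have h1 := hpush _ _ (H y ⟨(le_max_left _ _).trans hy1, hy2.trans (min_le_left _ _)⟩
      ((hf.dyadic y).1 hyd))
    rw [hha x' hz _ hyz] at h1
    rw [hfa x hw y hyw]
    have h2 : (2 : ℝ) ^ (s' + e - s) * 2 ^ s = 2 ^ s' * 2 ^ e := by
      rw [← zpow_add₀ two_ne_zero, ← zpow_add₀ two_ne_zero]; congr 1; ring
    rw [← hfa x hw y hyw]
    convert h1 using 1
    rw [hfa x hw y hyw]
    linear_combination (y - x) * h2

/-- The image of a good point under a pair of maps that preserves `Φ` is good. -/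
theorem Good.push {f h : ℝ ≃o ℝ} (hf : IsLPL f) (hh : IsLPL h)
    (hpush : ∀ x x', Φ x x' → Φ (f x) (h x')) (hΦ : ∀ x x', Φ x x' → IsDyadic x ∧ IsDyadic x')
    {x x' : ℝ} (H : Good Φ x x') : Good Φ (f x) (h x') where
  left := by
    obtain ⟨u, hu, e, he⟩ := H.left
    obtain ⟨w, hw, s, hs⟩ := hf.left x
    obtain ⟨z, hz, s', hs'⟩ := hh.left x'
    obtain ⟨u', v', -, h2, h3, -, h5⟩ := he.push hf hpush ⟨hu.le, le_rfl⟩ hs ⟨hw.le, le_rfl⟩ hs'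
      ⟨hz.le, le_rfl⟩
    exact ⟨u', h3 hu hw hz, _, h5.mono le_rfl h2⟩
  right := by
    obtain ⟨u, hu, e, he⟩ := H.right
    obtain ⟨w, hw, s, hs⟩ := hf.right x
    obtain ⟨z, hz, s', hs'⟩ := hh.right x'
    obtain ⟨u', v', h1, -, -, h4, h5⟩ := he.push hf hpush ⟨le_rfl, hu.le⟩ hs ⟨le_rfl, hw.le⟩ hs'
      ⟨le_rfl, hz.le⟩
    exact ⟨v', h4 hu hw hz, _, h5.mono h1 le_rfl⟩
  two := by
    intro hx
    rw [hf.dyadic] at hx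
    obtain ⟨u, v, hu, hv, e, he⟩ := H.two hx
    obtain ⟨w₁, w₂, hw₁, hw₂, s, hs⟩ := hf.two x hx
    have hx' : ¬ IsDyadic x' := by
      obtain ⟨d, hd, h1, h2⟩ := exists_dyadic_between hu
      have := (hΦ _ _ (he d ⟨h1.le, (h2.trans hv).le⟩ hd)).2
      intro h3
      refine hx ?_
      have h4 := (isDyadic_affine_iff (z := 0) (y := d - x) IsDyadic.zero IsDyadic.zero e).1
        (by simpa using this.sub h3)
      simpa using hd.sub h4
    obtain ⟨z₁, z₂, hz₁, hz₂, s', hs'⟩ := hh.two x' hx'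
    obtain ⟨u', v', -, -, h3, h4, h5⟩ := he.push hf hpush ⟨hu.le, hv.le⟩ hs ⟨hw₁.le, hw₂.le⟩ hs'
      ⟨hz₁.le, hz₂.le⟩
    exact ⟨u', v', h3 hu hw₁ hz₁, h4 hv hw₂ hz₂, _, h5⟩

end Seg

/-- A relation closed under the deduction steps for a conjugacy from the `A i` to the `B i`, and
free of contradictions. -/
structure Forcing {ι : Type*} (A B : ι → ℝ ≃o ℝ) (Φ : ℝ → ℝ → Prop) (M : ℝ) : Prop where
  dyadic : ∀ x x', Φ x x' → IsDyadic x ∧ IsDyadic x'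
  push : ∀ i x x', Φ x x' → Φ (A i x) (B i x')
  pull : ∀ i x x', Φ (A i x) (B i x') → Φ x x'
  zone : ∀ i x x' y y', Φ x x' → IsDyadic y → IsDyadic y' →
    ZoneStep (A i) (B i) (x, x') (y, y') → Φ y y'
  mono : ∀ x x' y y', Φ x x' → Φ y y' → x < y → x' < y'
  uniq : ∀ x x' y', Φ x x' → Φ x y' → x' = y'
  bdd : ∀ x x', Φ x x' → |x'| ≤ M
  noClash : ∀ i x x', Φ x x' → ¬ ZoneClash (A i) (B i) (x, x')

section Forcing

variable {ι : Type*} {A B : ι → ℝ ≃o ℝ} {Φ : ℝ → ℝ → Prop} {M : ℝ}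

/-- An affine piece with dyadic end points that starts to the left of `x`. It ends at `x` if `x` is
dyadic, where a breakpoint is possible, and beyond `x` otherwise. -/
theorem IsLPL.exists_leftZone {f : ℝ → ℝ} (hf : IsLPL f) (x : ℝ) :
    ∃ u v s, IsDyadic u ∧ IsDyadic v ∧ u < x ∧ x ≤ v ∧ AffOn f u v s ∧ (IsDyadic x → v = x) ∧
      (¬ IsDyadic x → x < v) := by
  by_cases hx : IsDyadic x
  · obtain ⟨u, hu, e, he⟩ := hf.left x
    obtain ⟨d, hd, h1, h2⟩ := exists_dyadic_between hu
    exact ⟨d, x, e, hd, hx, h2, le_rfl, he.mono h1.le le_rfl, fun _ => rfl, fun h => absurd hx h⟩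
  · obtain ⟨u, v, hu, hv, e, he⟩ := hf.two x hx
    obtain ⟨d, hd, h1, h2⟩ := exists_dyadic_between hu
    obtain ⟨d', hd', h1', h2'⟩ := exists_dyadic_between hv
    exact ⟨d, d', e, hd, hd', h2, h1'.le, he.mono h1.le h2'.le, fun h => absurd h hx, fun _ => h1'⟩

theorem pos_of_zpow_mul_lt {s : ℤ} {t : ℝ} (ht : t ≤ 0) (h : 2 ^ s * t < t) : 0 < s := by
  by_contra hs
  have : (2 : ℝ) ^ s ≤ 1 := zpow_le_one_of_nonpos₀ one_le_two (not_lt.1 hs)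
  nlinarith

theorem neg_of_lt_zpow_mul {s : ℤ} {t : ℝ} (ht : t ≤ 0) (h : t < 2 ^ s * t) : s < 0 := by
  by_contra hs
  have : (1 : ℝ) ≤ 2 ^ s := one_le_zpow₀ one_le_two (not_lt.1 hs)
  nlinarith

/-- Values forced arbitrarily close to the left of a common fixed point force a line segment
ending there, and beyond it if the fixed point is not dyadic. -/
theorem Forcing.fixedPoint (F : Forcing A B Φ M) (hA : ∀ i, IsLPL (A i)) (hB : ∀ i, IsLPL (B i))
    {β : ℝ} (hβ : ∀ i, A i β = β) {i : ι} (hi : ∀ u < β, ∃ x, u < x ∧ x < β ∧ A i x ≠ x)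
    (hdense : ∀ u < β, ∃ x x', u < x ∧ x < β ∧ Φ x x') :
    ∃ l, GoodLeft Φ β l ∧ (¬ IsDyadic β → GoodTwo Φ β l) := by
  set S := {x' | ∃ x < β, Φ x x'} with hS
  have hSne : S.Nonempty := by
    obtain ⟨x, x', -, h1, h2⟩ := hdense (β - 1) (by linarith)
    exact ⟨x', x, h1, h2⟩
  have hSb : BddAbove S := ⟨M, by rintro x' ⟨x, -, h⟩; exact (le_abs_self _).trans (F.bdd _ _ h)⟩
  set l := sSup S with hl
  have hle : ∀ x x', x < β → Φ x x' → x' ≤ l := fun x x' hx h => le_csSup hSb ⟨x, hx, h⟩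
  have happ : ∀ u < β, ∀ w < l, ∃ x x', u < x ∧ x < β ∧ w < x' ∧ Φ x x' := by
    intro u hu w hw
    obtain ⟨y', ⟨y, hy, hyy⟩, hwy⟩ := exists_lt_of_lt_csSup hSne hw
    obtain ⟨x, x', h1, h2, h3⟩ := hdense (max u y) (max_lt hu hy)
    exact ⟨x, x', (le_max_left _ _).trans_lt h1, h2,
      hwy.trans (F.mono _ _ _ _ hyy h3 ((le_max_right _ _).trans_lt h1)), h3⟩
  have hBl : B i l = l := by
    apply le_antisymm
    · rw [← (B i).le_symm_apply]
      refine csSup_le hSne ?_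
      rintro x' ⟨x, hx, h⟩
      rw [(B i).le_symm_apply]
      exact hle (A i x) _ (by rw [← hβ i]; exact (A i).strictMono hx) (F.push i _ _ h)
    · refine csSup_le hSne ?_
      rintro x' ⟨x, hx, h⟩
      rw [← (B i).symm_apply_le]
      refine hle ((A i).symm x) _ ?_ (F.pull i _ _ ?_)
      · rw [(A i).symm_apply_lt, hβ]; exact hx
      · simpa using h
  obtain ⟨u, v, s, hud, hvd, hu, hv, ha, hv1, hv2⟩ := (hA i).exists_leftZone β
  obtain ⟨u', v', s', hud', hvd', hu', hv', hb, hv1', hv2'⟩ := (hB i).exists_leftZone l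
  have hs0 : s ≠ 0 := by
    rintro rfl
    obtain ⟨x, h1, h2, h3⟩ := hi u hu
    apply h3
    rw [ha β ⟨hu.le, hv⟩ x ⟨h1.le, h2.le.trans hv⟩, hβ]
    simp
  obtain ⟨x, x', hux, hxβ, hux', hxx⟩ := happ u hu u' hu'
  have hxl := hle x x' hxβ hxx
  have hxI : x ∈ Icc u v := ⟨hux.le, hxβ.le.trans hv⟩
  have hxI' : x' ∈ Icc u' v' := ⟨hux'.le, hxl.trans hv'⟩
  have hβI : β ∈ Icc u v := ⟨hu.le, hv⟩
  have hlI : l ∈ Icc u' v' := ⟨hu'.le, hv'⟩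
  have hax : A i x - β = 2 ^ s * (x - β) := by rw [ha β hβI x hxI, hβ]; ring
  have hbx : B i x' - l = 2 ^ s' * (x' - l) := by rw [hb l hlI x' hxI', hBl]; ring
  have hxd := F.dyadic _ _ hxx
  -- the two maps move the point in the same direction
  obtain ⟨hne, hsign, hdir⟩ : A i x ≠ x ∧ 0 < s * s' ∧ 0 < (A i x - x) * (B i x' - x') := by
    have hpush := F.push i _ _ hxx
    rcases lt_trichotomy (A i x) x with h | h | h
    · have h2 := F.mono _ _ _ _ hpush hxx h
      have h3 := pos_of_zpow_mul_lt (s := s) (sub_neg.2 hxβ).le (by rw [← hax]; linarith)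
      have h4 := pos_of_zpow_mul_lt (s := s') (sub_nonpos.2 hxl) (by rw [← hbx]; linarith)
      exact ⟨h.ne, mul_pos h3 h4, mul_pos_of_neg_of_neg (sub_neg.2 h) (sub_neg.2 h2)⟩
    · exfalso
      apply hs0
      rw [h] at hax
      have h2 : x - β ≠ 0 := (sub_neg.2 hxβ).ne
      apply two_zpow_eq_one
      exact mul_right_cancel₀ h2 (by linarith)
    · have h2 := F.mono _ _ _ _ hxx hpush h
      have h3 := neg_of_lt_zpow_mul (s := s) (sub_neg.2 hxβ).le (by rw [← hax]; linarith)
      have h4 := neg_of_lt_zpow_mul (s := s') (sub_nonpos.2 hxl) (by rw [← hbx]; linarith)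
      exact ⟨h.ne', mul_pos_of_neg_of_neg h3 h4, mul_pos (sub_pos.2 h) (sub_pos.2 h2)⟩
  have hzone : Zone (A i) u v s :=
    ⟨hu.trans_le hv, hud, hvd, ha, hasFixIn_of_fix ha hβI (hβ i)⟩
  have hzone' : Zone (B i) u' v' s' :=
    ⟨hu'.trans_le hv', hud', hvd', hb, hasFixIn_of_fix hb hlI hBl⟩
  have hcl := F.noClash i x x' hxx
  have hss : s = s' := by
    by_contra h
    exact hcl ⟨u, v, u', v', s, s', hzone, hzone', hxI, hxI', hsign, hne, Or.inl h⟩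
  subst hss
  have hpa : 0 < |A i x - x| := abs_pos.2 (sub_ne_zero.2 hne)
  have hpb : 0 < |B i x' - x'| := abs_pos.2 fun h => by rw [h] at hdir; simp at hdir
  obtain ⟨m, hm1, hm2⟩ := exists_mem_Ico_zpow (div_pos hpb hpa) (one_lt_two (α := ℝ))
  rw [le_div_iff₀ hpa] at hm1
  rw [div_lt_iff₀ hpa] at hm2
  have hm : 2 ^ m * (A i x - x) = B i x' - x' := by
    have h1 : 2 ^ m * |A i x - x| = |B i x' - x'| := by
      by_contra h
      exact hcl ⟨u, v, u', v', s, s, hzone, hzone', hxI, hxI', hsign, hne,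
        Or.inr ⟨m, lt_of_le_of_ne hm1 h, hm2⟩⟩
    rcases (mul_pos_iff.1 hdir) with ⟨h2, h3⟩ | ⟨h2, h3⟩
    · rwa [abs_of_pos h2, abs_of_pos h3] at h1
    · rw [abs_of_neg h2, abs_of_neg h3] at h1; linarith
  have hs1 : (2 : ℝ) ^ s - 1 ≠ 0 := fun h => hs0 (two_zpow_eq_one (by linarith))
  have hlx : l = x' + 2 ^ m * (β - x) := by
    have h1 : ((2 : ℝ) ^ s - 1) * (2 ^ m * (x - β) - (x' - l)) = 0 := by
      linear_combination hm - 2 ^ m * hax + hbx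
    rcases mul_eq_zero.1 h1 with h2 | h2
    · exact absurd h2 hs1
    · linarith
  have hmp := two_zpow_pos m
  -- the zone is cut down to one that starts at `x`
  obtain ⟨w, hwd, hwβ, hwv, hwl, hw⟩ : ∃ w, IsDyadic w ∧ β ≤ w ∧ w ≤ v ∧
      l + 2 ^ m * (w - β) ≤ v' ∧ (IsDyadic β ∧ w = β ∨ ¬ IsDyadic β ∧ β < w) := by
    by_cases hβd : IsDyadic β
    · exact ⟨β, hβd, le_rfl, hv, by simpa using hv', Or.inl ⟨hβd, rfl⟩⟩
    · have hld : ¬ IsDyadic l := by rw [hlx, isDyadic_affine_iff hxd.1 hxd.2]; exact hβd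
      obtain ⟨w, hw, h1, h2⟩ := exists_dyadic_between (lt_min (hv2 hβd)
        (show β < β + 2 ^ (-m) * (v' - l) by
          have := mul_pos (two_zpow_pos (-m)) (sub_pos.2 (hv2' hld)); linarith))
      refine ⟨w, hw, h1.le, (h2.trans_le (min_le_left _ _)).le, ?_, Or.inr ⟨hβd, h1⟩⟩
      have h3 := (h2.trans_le (min_le_right _ _)).le
      have h4 := mul_le_mul_of_nonneg_left h3 hmp.le
      have h5 : (2 : ℝ) ^ m * 2 ^ (-m) = 1 := by rw [← zpow_add₀ two_ne_zero]; simp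
      have h6 : v' - l = 2 ^ m * (2 ^ (-m) * (v' - l)) := by rw [← mul_assoc, h5, one_mul]
      linarith
  have hseg : Seg Φ x w β l m := by
    intro y hy hyd
    have hyy : l + 2 ^ m * (y - β) = x' + 2 ^ m * (y - x) := by rw [hlx]; ring
    refine F.zone i x x' y _ hxx hyd (by rw [hyy]; exact hxd.1.affine hyd hxd.2 m) ?_
    have haxw : AffOn (A i) x w s := ha.mono hux.le hwv
    refine ⟨x, w, s, m, ⟨hxβ.trans_le hwβ, hxd.1, hwd, haxw,
      hasFixIn_of_fix haxw ⟨hxβ.le, hwβ⟩ (hβ i)⟩, hs0, ⟨le_rfl, hxβ.le.trans hwβ⟩, hy, hne, hm,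
      hb.mono ?_ ?_, hyy, ?_⟩
    · simpa using hux'.le
    · have : x' + 2 ^ m * (w - x) = l + 2 ^ m * (w - β) := by rw [hlx]; ring
      exact this.trans_le hwl
    · rcases hw with ⟨-, rfl⟩ | ⟨h, -⟩
      · exact Or.inr (Or.inl (hβ i))
      · exact Or.inr (Or.inr (by rwa [← fix_eq ha hβI hxI (hβ i) hs0]))
  refine ⟨l, ⟨x, hxβ, m, hseg.mono le_rfl hwβ⟩, fun hβd => ?_⟩
  rcases hw with ⟨h, -⟩ | ⟨-, h⟩
  · exact absurd h hβd
  · exact ⟨x, w, hxβ, h, m, hseg⟩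

end Forcing

end ThompsonPL

namespace ThompsonPL

open Set Filter Topology Relation

/-! ### Spreading forced values over an interval -/

section Forcing

variable {ι : Type*} {A B : ι → ℝ ≃o ℝ} {Φ : ℝ → ℝ → Prop} {M : ℝ}

/-- If no dyadic point of `(d, β)` is fixed by all the maps, then one of the maps moves points
arbitrarily close to the left of `β`. -/
theorem exists_moves_left [Finite ι] {d β : ℝ} (hd : d < β)
    (hchain : ∀ x, IsDyadic x → d < x → x < β → ∃ i, A i x ≠ x) :
    ∃ i, ∀ u < β, ∃ x, u < x ∧ x < β ∧ A i x ≠ x := by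
  by_contra! h
  have h1 : ∀ i, ∀ᶠ x in 𝓝[<] β, A i x = x := by
    intro i
    obtain ⟨u, hu, hx⟩ := h i
    filter_upwards [Ioo_mem_nhdsLT hu] with x hxm using hx x hxm.1 hxm.2
  have h2 : ∀ᶠ x in 𝓝[<] β, ∀ i, A i x = x := eventually_all.2 h1
  obtain ⟨u, hu, hsub⟩ := (mem_nhdsLT_iff_exists_Ioo_subset' hd).1 h2
  obtain ⟨x, hx, hx1, hx2⟩ := exists_dyadic_between (max_lt hd hu)
  obtain ⟨i, hi⟩ := hchain x hx ((le_max_left _ _).trans_lt hx1) hx2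
  exact hi (hsub ⟨(le_max_right _ _).trans_lt hx1, hx2⟩ i)

theorem Forcing.good_push (F : Forcing A B Φ M) (hA : ∀ i, IsLPL (A i)) (hB : ∀ i, IsLPL (B i))
    (i : ι) {x x' : ℝ} (H : Good Φ x x') : Good Φ (A i x) (B i x') :=
  H.push (hA i) (hB i) (F.push i) F.dyadic

theorem Forcing.good_pull (F : Forcing A B Φ M) (hA : ∀ i, IsLPL (A i)) (hB : ∀ i, IsLPL (B i))
    (i : ι) {x x' : ℝ} (H : Good Φ x x') : Good Φ ((A i).symm x) ((B i).symm x') :=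
  H.push (hA i).symm (hB i).symm (fun x x' h => F.pull i _ _ (by simpa using h)) F.dyadic

/-- Good points spread to the right of a common fixed point `d`, up to the next dyadic common
fixed point `r`: a first point that is not good would be fixed, since otherwise one of the maps or
its inverse moves it into the good part, and then it is good by the behavior at fixed points. -/
theorem Forcing.sweep [Finite ι] (F : Forcing A B Φ M) (hA : ∀ i, IsLPL (A i))
    (hB : ∀ i, IsLPL (B i)) {d c r : ℝ} (hd : ∀ i, A i d = d) (hr : ∀ i, A i r = r) (hdc : d < c)
    (hcr : c ≤ r) (hgood : ∀ x ∈ Ioo d c, ∃ x', Good Φ x x')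
    (hchain : ∀ x, IsDyadic x → d < x → x < r → ∃ i, A i x ≠ x) :
    (∀ x ∈ Ioo d r, ∃ x', Good Φ x x') ∧ ∃ r', GoodLeft Φ r r' := by
  set S := {x | x ∈ Icc c r ∧ ∀ y ∈ Ioo d x, ∃ y', Good Φ y y'} with hS
  have hcS : c ∈ S := ⟨⟨le_rfl, hcr⟩, hgood⟩
  have hSb : BddAbove S := ⟨r, fun x hx => hx.1.2⟩
  set β := sSup S with hβ
  have hcβ : c ≤ β := le_csSup hSb hcS
  have hβr : β ≤ r := csSup_le ⟨c, hcS⟩ fun x hx => hx.1.2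
  have hdβ : d < β := hdc.trans_le hcβ
  have hgβ : ∀ y ∈ Ioo d β, ∃ y', Good Φ y y' := by
    intro y hy
    obtain ⟨x, hx, hyx⟩ := exists_lt_of_lt_csSup ⟨c, hcS⟩ hy.2
    exact hx.2 y ⟨hy.1, hyx⟩
  have hdense : ∀ u < β, ∃ x x', u < x ∧ x < β ∧ Φ x x' := by
    intro u hu
    obtain ⟨x, hx, hx1, hx2⟩ := exists_dyadic_between (max_lt hu hdβ)
    obtain ⟨x', hx'⟩ := hgβ x ⟨(le_max_right _ _).trans_lt hx1, hx2⟩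
    obtain ⟨u', hu', e, he⟩ := hx'.left
    exact ⟨x, _, (le_max_left _ _).trans_lt hx1, hx2, he x ⟨hu'.le, le_rfl⟩ hx⟩
  have hmove : ∃ i, ∀ u < β, ∃ x, u < x ∧ x < β ∧ A i x ≠ x :=
    exists_moves_left hdβ fun x hx h1 h2 => hchain x hx h1 (h2.trans_le hβr)
  obtain ⟨i, hi⟩ := hmove
  rcases hβr.eq_or_lt with h | h
  · refine ⟨h ▸ hgβ, ?_⟩
    obtain ⟨r', hr', -⟩ := F.fixedPoint hA hB (fun i => by rw [h]; exact hr i) hi hdense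
    exact ⟨r', h ▸ hr'⟩
  · exfalso
    obtain ⟨b', hb'⟩ : ∃ b', Good Φ β b' := by
      by_cases hfix : ∀ i, A i β = β
      · obtain ⟨l, hl1, hl2⟩ := F.fixedPoint hA hB hfix hi hdense
        have hnd : ¬ IsDyadic β := fun h0 => by
          obtain ⟨i, hi⟩ := hchain β h0 hdβ h
          exact hi (hfix i)
        obtain ⟨u, v, hu, hv, e, he⟩ := hl2 hnd
        exact ⟨l, hl1, ⟨v, hv, e, he.mono hu.le le_rfl⟩, hl2⟩
      · push Not at hfix
        obtain ⟨j, hj⟩ := hfix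
        rcases lt_or_gt_of_ne hj with h1 | h1
        · have h2 : d < A j β := by rw [← hd j]; exact (A j).strictMono hdβ
          obtain ⟨y, hy⟩ := hgβ _ ⟨h2, h1⟩
          have := F.good_pull hA hB j hy
          rw [OrderIso.symm_apply_apply] at this
          exact ⟨_, this⟩
        · have h2 : d < (A j).symm β := by rw [OrderIso.lt_symm_apply, hd j]; exact hdβ
          obtain ⟨y, hy⟩ := hgβ _ ⟨h2, (A j).symm_apply_lt.2 h1⟩
          have := F.good_push hA hB j hy
          rw [OrderIso.apply_symm_apply] at this
          exact ⟨_, this⟩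
    obtain ⟨v, hv, e, he⟩ := hb'.right
    have hmin : β < min v r := lt_min hv h
    have : min v r ∈ S := by
      refine ⟨⟨hcβ.trans hmin.le, min_le_right _ _⟩, fun y hy => ?_⟩
      rcases lt_trichotomy y β with h1 | h1 | h1
      · exact hgβ y ⟨hy.1, h1⟩
      · exact ⟨b', h1 ▸ hb'⟩
      · exact ⟨_, he.good ⟨h1, hy.2.trans_le (min_le_left _ _)⟩⟩
    exact absurd (le_csSup hSb this) (not_le.2 hmin)

/-! ### Reflection -/

/-- The conjugate of `f` by the reflection of the real line. -/
def reflIso (f : ℝ ≃o ℝ) : ℝ ≃o ℝ where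
  toFun x := -f (-x)
  invFun x := -f.symm (-x)
  left_inv x := by simp
  right_inv x := by simp
  map_rel_iff' := by simp

@[simp] theorem reflIso_apply (f : ℝ ≃o ℝ) (x : ℝ) : reflIso f x = -f (-x) := rfl

theorem neg_mem_Icc_neg {x u v : ℝ} : -x ∈ Icc (-v) (-u) ↔ x ∈ Icc u v := by
  simp only [mem_Icc, neg_le_neg_iff]; exact and_comm

theorem affOn_reflIso {f : ℝ ≃o ℝ} {u v : ℝ} {e : ℤ} :
    AffOn (reflIso f) u v e ↔ AffOn f (-v) (-u) e := by
  constructor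
  · intro h x hx y hy
    have := h (-x) (by rw [← neg_mem_Icc_neg]; simpa using hx) (-y)
      (by rw [← neg_mem_Icc_neg]; simpa using hy)
    simp only [reflIso_apply, neg_neg] at this
    linear_combination -this
  · intro h x hx y hy
    have := h (-x) (neg_mem_Icc_neg.2 hx) (-y) (neg_mem_Icc_neg.2 hy)
    simp only [reflIso_apply]
    linear_combination -this

theorem Zone.of_reflIso {f : ℝ ≃o ℝ} {u v : ℝ} {s : ℤ} (h : Zone (reflIso f) u v s) :
    Zone f (-v) (-u) s := by
  refine ⟨neg_lt_neg h.lt, h.dyadic_right.neg, h.dyadic_left.neg, affOn_reflIso.1 h.aff, ?_⟩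
  rcases h.fix with ⟨h1, h2⟩ | ⟨h1, h2⟩ <;> simp only [reflIso_apply] at h1 h2
  · left; constructor <;> linarith
  · right; constructor <;> linarith

theorem ZoneStep.of_reflIso {f h : ℝ ≃o ℝ} {x x' y y' : ℝ}
    (H : ZoneStep (reflIso f) (reflIso h) (x, x') (y, y')) :
    ZoneStep f h (-x, -x') (-y, -y') := by
  obtain ⟨u, v, s, m, hz, hs, h1, h2, h3, h4, h5, h6, h7⟩ := H
  simp only [reflIso_apply] at h1 h2 h3 h4 h6 h7
  refine ⟨-v, -u, s, m, hz.of_reflIso, hs, ⟨neg_le_neg h1.2, neg_le_neg h1.1⟩,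
    ⟨neg_le_neg h2.2, neg_le_neg h2.1⟩, fun h => h3 (by simp only at h; rw [h, neg_neg]),
    ?_, ?_, ?_, ?_⟩
  · simp only; linear_combination -h4
  · have := affOn_reflIso.1 h5
    convert this using 1 <;> simp only <;> ring
  · simp only; linear_combination -h6
  · rcases h7 with h | h | h
    · exact Or.inr (Or.inl (by linarith))
    · exact Or.inl (by linarith)
    · refine Or.inr (Or.inr ?_)
      rw [← isDyadic_neg] at h
      convert h using 2
      simp only
      ring

theorem ZoneClash.of_reflIso {f h : ℝ ≃o ℝ} {x x' : ℝ}
    (H : ZoneClash (reflIso f) (reflIso h) (x, x')) : ZoneClash f h (-x, -x') := by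
  obtain ⟨u, v, u', v', s, s', hz, hz', h1, h2, h3, h4, h5⟩ := H
  simp only [reflIso_apply] at h1 h2 h4 h5
  refine ⟨-v, -u, -v', -u', s, s', hz.of_reflIso, hz'.of_reflIso,
    ⟨neg_le_neg h1.2, neg_le_neg h1.1⟩, ⟨neg_le_neg h2.2, neg_le_neg h2.1⟩, h3,
    fun h => h4 (by simp only at h; rw [h, neg_neg]), h5.imp_right ?_⟩
  rintro ⟨m, h6, h7⟩
  have e1 : |f (-x) - -x| = |-f (-x) - x| := by rw [← abs_neg]; congr 1; ring
  have e2 : |h (-x') - -x'| = |-h (-x') - x'| := by rw [← abs_neg]; congr 1; ring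
  exact ⟨m, by simpa only [e1, e2] using h6, by simpa only [e1, e2] using h7⟩

theorem Forcing.refl (F : Forcing A B Φ M) :
    Forcing (fun i => reflIso (A i)) (fun i => reflIso (B i)) (fun x x' => Φ (-x) (-x')) M where
  dyadic x x' h := by
    have := F.dyadic _ _ h
    rwa [isDyadic_neg, isDyadic_neg] at this
  push i x x' h := by simpa using F.push i _ _ h
  pull i x x' h := F.pull i _ _ (by simpa using h)
  zone i x x' y y' h hy hy' H := F.zone i _ _ _ _ h hy.neg hy'.neg H.of_reflIso
  mono x x' y y' h h' hxy := neg_lt_neg_iff.1 (F.mono _ _ _ _ h' h (neg_lt_neg hxy))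
  uniq x x' y' h h' := neg_inj.1 (F.uniq _ _ _ h h')
  bdd x x' h := by simpa using F.bdd _ _ h
  noClash i x x' h H := F.noClash i _ _ h H.of_reflIso

theorem IsLPL.refl {f : ℝ ≃o ℝ} (hf : IsLPL f) : IsLPL (reflIso f) where
  right x := by
    obtain ⟨u, hu, e, he⟩ := hf.left (-x)
    exact ⟨-u, lt_neg.1 hu, e, affOn_reflIso.2 (by simpa using he)⟩
  left x := by
    obtain ⟨u, hu, e, he⟩ := hf.right (-x)
    exact ⟨-u, neg_lt.1 hu, e, affOn_reflIso.2 (by simpa using he)⟩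
  two x hx := by
    obtain ⟨u, v, hu, hv, e, he⟩ := hf.two (-x) (mt isDyadic_neg.1 hx)
    exact ⟨-v, -u, neg_lt.1 hv, lt_neg.1 hu, e, affOn_reflIso.2 (by simpa using he)⟩
  dyadic x := by rw [reflIso_apply, isDyadic_neg, hf.dyadic, isDyadic_neg]

theorem seg_neg {u v x x' : ℝ} {e : ℤ} :
    Seg (fun x x' => Φ (-x) (-x')) u v x x' e ↔ Seg Φ (-v) (-u) (-x) (-x') e := by
  constructor
  · intro h y hy hyd
    have := h (-y) (by rw [← neg_mem_Icc_neg]; simpa using hy) hyd.neg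
    convert this using 1 <;> ring
  · intro h y hy hyd
    have := h (-y) (neg_mem_Icc_neg.2 hy) hyd.neg
    convert this using 1; ring

theorem goodLeft_neg {x x' : ℝ} :
    GoodLeft (fun x x' => Φ (-x) (-x')) x x' ↔ GoodRight Φ (-x) (-x') := by
  constructor
  · rintro ⟨u, hu, e, he⟩; exact ⟨-u, neg_lt_neg hu, e, seg_neg.1 he⟩
  · rintro ⟨u, hu, e, he⟩; exact ⟨-u, neg_lt.1 hu, e, seg_neg.2 (by simpa using he)⟩

theorem goodRight_neg {x x' : ℝ} :
    GoodRight (fun x x' => Φ (-x) (-x')) x x' ↔ GoodLeft Φ (-x) (-x') := by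
  constructor
  · rintro ⟨u, hu, e, he⟩; exact ⟨-u, neg_lt_neg hu, e, seg_neg.1 he⟩
  · rintro ⟨u, hu, e, he⟩; exact ⟨-u, lt_neg.1 hu, e, seg_neg.2 (by simpa using he)⟩

theorem goodTwo_neg {x x' : ℝ} :
    GoodTwo (fun x x' => Φ (-x) (-x')) x x' ↔ GoodTwo Φ (-x) (-x') := by
  constructor
  · rintro ⟨u, v, hu, hv, e, he⟩; exact ⟨-v, -u, neg_lt_neg hv, neg_lt_neg hu, e, seg_neg.1 he⟩
  · rintro ⟨u, v, hu, hv, e, he⟩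
    exact ⟨-v, -u, neg_lt.1 hv, lt_neg.1 hu, e, seg_neg.2 (by simpa using he)⟩

theorem good_neg {x x' : ℝ} : Good (fun x x' => Φ (-x) (-x')) x x' ↔ Good Φ (-x) (-x') := by
  constructor
  · rintro ⟨h1, h2, h3⟩
    exact ⟨goodRight_neg.1 h2, goodLeft_neg.1 h1, fun h => goodTwo_neg.1 (h3 (mt IsDyadic.neg h))⟩
  · rintro ⟨h1, h2, h3⟩
    exact ⟨goodLeft_neg.2 h2, goodRight_neg.2 h1, fun h => goodTwo_neg.2 (h3 (mt isDyadic_neg.1 h))⟩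

/-- The mirror image of `Forcing.sweep`. -/
theorem Forcing.sweep_left [Finite ι] (F : Forcing A B Φ M) (hA : ∀ i, IsLPL (A i))
    (hB : ∀ i, IsLPL (B i)) {d c r : ℝ} (hd : ∀ i, A i d = d) (hr : ∀ i, A i r = r) (hcd : c < d)
    (hrc : r ≤ c) (hgood : ∀ x ∈ Ioo c d, ∃ x', Good Φ x x')
    (hchain : ∀ x, IsDyadic x → r < x → x < d → ∃ i, A i x ≠ x) :
    (∀ x ∈ Ioo r d, ∃ x', Good Φ x x') ∧ ∃ r', GoodRight Φ r r' := by
  have h := F.refl.sweep (fun i => (hA i).refl) (fun i => (hB i).refl) (d := -d) (c := -c)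
    (r := -r) (fun i => by simp [hd]) (fun i => by simp [hr]) (neg_lt_neg hcd) (neg_le_neg hrc)
    (fun x hx => ?_) (fun x hx h1 h2 => ?_)
  · refine ⟨fun x hx => ?_, ?_⟩
    · obtain ⟨x', hx'⟩ := h.1 (-x) ⟨neg_lt_neg hx.2, neg_lt_neg hx.1⟩
      exact ⟨-x', by simpa using good_neg.1 hx'⟩
    · obtain ⟨r', hr'⟩ := h.2
      exact ⟨-r', by simpa using goodLeft_neg.1 hr'⟩
  · obtain ⟨x', hx'⟩ := hgood (-x) ⟨lt_neg.1 hx.2, neg_lt.1 hx.1⟩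
    exact ⟨-x', good_neg.2 (by simpa using hx')⟩
  · obtain ⟨i, hi⟩ := hchain (-x) hx.neg (lt_neg.1 h2) (neg_lt.1 h1)
    exact ⟨i, fun h => hi (by rw [reflIso_apply] at h; linarith)⟩

/-- A consistent family of forced values that contains one point over the open interval `(p, r)`
between consecutive dyadic common fixed points is the graph of a conjugacy over `[p, r]`. -/
theorem Forcing.exists_conj [Finite ι] (F : Forcing A B Φ M) (hA : ∀ i, IsLPL (A i))
    (hB : ∀ i, IsLPL (B i)) {p r t t' : ℝ} (hp : ∀ i, A i p = p) (hr : ∀ i, A i r = r)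
    (hpd : IsDyadic p) (hrd : IsDyadic r) (ht : t ∈ Ioo p r) (htt : Φ t t')
    (hchain : ∀ x, IsDyadic x → p < x → x < r → ∃ i, A i x ≠ x) :
    ∃ h : ℝ ≃o ℝ, IsLPL h ∧ (∀ y ∈ Icc p r, IsDyadic y → Φ y (h y)) ∧
      ∀ i, ∀ y ∈ Icc p r, h (A i y) = B i (h y) := by
  -- `e` is the first common fixed point to the right of `t`
  set E := {x | t ≤ x ∧ ∀ i, A i x = x} with hE
  have hrE : r ∈ E := ⟨ht.2.le, hr⟩
  have hEb : BddBelow E := ⟨t, fun x hx => hx.1⟩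
  have hEc : IsClosed E := by
    have : E = Ici t ∩ ⋂ i, {x | A i x = x} := by ext x; simp [hE]
    rw [this]
    exact isClosed_Ici.inter (isClosed_iInter fun i =>
      isClosed_eq (A i).continuous continuous_id)
  set e := sInf E with he
  have heE : e ∈ E := hEc.csInf_mem ⟨r, hrE⟩ hEb
  have her : e ≤ r := csInf_le hEb hrE
  have htm := hchain t (F.dyadic _ _ htt).1 ht.1 ht.2
  have hte : t < e := by
    refine lt_of_le_of_ne heE.1 fun h => ?_
    obtain ⟨i, hi⟩ := htm
    exact hi (by rw [h]; exact heE.2 i)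
  have hpe : p < e := ht.1.trans hte
  -- the supremum of the forced points to the left of `e` is invariant
  set T := {x | x < e ∧ ∃ x', Φ x x'} with hT
  have htT : t ∈ T := ⟨hte, t', htt⟩
  have hTb : BddAbove T := ⟨e, fun x hx => hx.1.le⟩
  have hsup : sSup T = e := by
    apply le_antisymm (csSup_le ⟨t, htT⟩ fun x hx => hx.1.le)
    refine csInf_le hEb ⟨le_csSup hTb htT, fun i => le_antisymm ?_ ?_⟩
    · rw [← (A i).le_symm_apply]
      refine csSup_le ⟨t, htT⟩ fun x hx => ?_
      rw [(A i).le_symm_apply]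
      obtain ⟨hx, x', hxx⟩ := hx
      exact le_csSup hTb ⟨by rw [← heE.2 i]; exact (A i).strictMono hx, _, F.push i _ _ hxx⟩
    · refine csSup_le ⟨t, htT⟩ fun x hx => ?_
      rw [← (A i).symm_apply_le]
      obtain ⟨hx, x', hxx⟩ := hx
      refine le_csSup hTb ⟨?_, (B i).symm x', F.pull i _ _ (by simpa using hxx)⟩
      rw [(A i).symm_apply_lt, heE.2]; exact hx
  obtain ⟨i, hi⟩ := exists_moves_left hpe fun x hx h1 h2 => hchain x hx h1 (h2.trans_le her)
  obtain ⟨l, hl1, hl2⟩ := F.fixedPoint hA hB heE.2 hi fun u hu => by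
    rw [← hsup] at hu
    obtain ⟨x, ⟨hx, x', hxx⟩, hux⟩ := exists_lt_of_lt_csSup ⟨t, htT⟩ hu
    exact ⟨x, x', hux, hx, hxx⟩
  -- spread to the left and to the right of `e`
  obtain ⟨hgl, p', hgp⟩ : (∀ x ∈ Ioo p e, ∃ x', Good Φ x x') ∧ ∃ p', GoodRight Φ p p' := by
    obtain ⟨u, hu, k, hk⟩ := hl1
    refine F.sweep_left hA hB (c := max u p) heE.2 hp (max_lt hu hpe) (le_max_right _ _)
      (fun x hx => ⟨_, hk.good ⟨(le_max_left _ _).trans_lt hx.1, hx.2⟩⟩)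
      fun x hx h1 h2 => hchain x hx h1 (h2.trans_le her)
  obtain ⟨hg, r', hgr⟩ : (∀ x ∈ Ioo p r, ∃ x', Good Φ x x') ∧ ∃ r', GoodLeft Φ r r' := by
    rcases her.eq_or_lt with h | h
    · rw [← h]; exact ⟨hgl, l, hl1⟩
    · have hed : ¬ IsDyadic e := fun h0 => by
        obtain ⟨i, hi⟩ := hchain e h0 hpe h
        exact hi (heE.2 i)
      have hl2' := hl2 hed
      obtain ⟨u, v, hu, hv, k, hk⟩ := hl2'
      obtain ⟨h1, h2⟩ := F.sweep hA hB (c := min v r) heE.2 hr (lt_min hv h) (min_le_right _ _)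
        (fun x hx => ⟨_, hk.good ⟨hu.trans hx.1, hx.2.trans_le (min_le_left _ _)⟩⟩)
        fun x hx h1 h2 => hchain x hx (hpe.trans h1) h2
      refine ⟨fun x hx => ?_, h2⟩
      rcases lt_trichotomy x e with h3 | h3 | h3
      · exact hgl x ⟨hx.1, h3⟩
      · rw [h3]
        exact ⟨_, hk.good ⟨hu, hv⟩⟩
      · exact h1 x ⟨h3, hx.2⟩
  have hpr : p < r := ht.1.trans ht.2
  have hchn : ReflTransGen (fun u v => u < v ∧ IsDyadic u ∧ IsDyadic v ∧
      ∃ x x' k, Seg Φ u v x x' k) p r := by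
    refine exists_subdivision ?_ hpd hrd hpr.le (fun x hx => ?_) (fun x hx => ?_)
      fun x hx hxd => ?_
    · rintro u v u' v' ⟨x, x', k, hk⟩ h1 - h3
      exact ⟨x, x', k, hk.mono h1 h3⟩
    · rcases hx.1.eq_or_lt with h | h
      · obtain ⟨v, hv, k, hk⟩ := hgp
        exact ⟨v, h ▸ hv, p, p', k, h ▸ hk⟩
      · obtain ⟨x', hx'⟩ := hg x ⟨h, hx.2⟩
        obtain ⟨v, hv, k, hk⟩ := hx'.right
        exact ⟨v, hv, x, x', k, hk⟩
    · rcases hx.2.eq_or_lt with h | h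
      · obtain ⟨v, hv, k, hk⟩ := hgr
        exact ⟨v, h ▸ hv, r, r', k, h ▸ hk⟩
      · obtain ⟨x', hx'⟩ := hg x ⟨hx.1, h⟩
        obtain ⟨v, hv, k, hk⟩ := hx'.left
        exact ⟨v, hv, x, x', k, hk⟩
    · obtain ⟨x', hx'⟩ := hg x hx
      obtain ⟨u, v, hu, hv, k, hk⟩ := hx'.two hxd
      exact ⟨u, v, hu, hv, x, x', k, hk⟩
  -- glue the segments
  obtain ⟨h, hlpl, hΦ⟩ : ∃ h : ℝ ≃o ℝ, IsLPL h ∧ ∀ y ∈ Icc p r, IsDyadic y → Φ y (h y) := by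
    clear hgr hg hgl hl1 hl2
    have hpx : ∀ x, ReflTransGen (fun u v => u < v ∧ IsDyadic u ∧ IsDyadic v ∧
        ∃ x x' k, Seg Φ u v x x' k) p x → p ≤ x ∧ IsDyadic x ∧
          ∃ h : ℝ ≃o ℝ, IsLPL h ∧ ∀ y ∈ Icc p x, IsDyadic y → Φ y (h y) := by
      intro x hx
      induction hx with
      | refl =>
        obtain ⟨v, hv, k, hk⟩ := hgp
        have hpp := hk p ⟨le_rfl, hv.le⟩ hpd
        rw [sub_self, mul_zero, add_zero] at hpp
        refine ⟨le_rfl, hpd, affIso 0 p p', IsLPL.affIso 0 hpd (F.dyadic _ _ hpp).2, ?_⟩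
        intro y hy _
        obtain rfl : y = p := le_antisymm hy.2 hy.1
        simpa using hpp
      | @tail u v _ huv ih =>
        obtain ⟨hpu, hud, h, hh, hΦ⟩ := ih
        obtain ⟨huv, -, hvd, x, x', k, hk⟩ := huv
        have h1 := hΦ u ⟨hpu, le_rfl⟩ hud
        have h2 := hk u ⟨le_rfl, huv.le⟩ hud
        have h3 := F.uniq _ _ _ h1 h2
        have hj : h u = affIso k u (h u) u := by simp
        refine ⟨hpu.trans huv.le, hvd, splice u h (affIso k u (h u)) hj,
          IsLPL.splice hj hud hh (IsLPL.affIso k hud (F.dyadic _ _ h1).2), fun y hy hyd => ?_⟩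
        rcases le_total y u with hyu | hyu
        · rw [splice_of_le hyu]; exact hΦ y ⟨hy.1, hyu⟩ hyd
        · rw [splice_of_ge hyu, affIso_apply, h3]
          convert hk y ⟨hyu, hy.2⟩ hyd using 1
          ring
    obtain ⟨-, -, h⟩ := hpx r hchn
    exact h
  refine ⟨h, hlpl, hΦ, fun i => ?_⟩
  have hcl : ∀ y ∈ Ioo p r ∩ {y | IsDyadic y}, h (A i y) = B i (h y) := by
    rintro y ⟨hy, hyd⟩
    have h1 := F.push i _ _ (hΦ y ⟨hy.1.le, hy.2.le⟩ hyd)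
    refine F.uniq _ _ _ (hΦ (A i y) ⟨?_, ?_⟩ (((hA i).dyadic y).2 hyd)) h1
    · rw [← hp i]; exact (A i).monotone hy.1.le
    · rw [← hr i]; exact (A i).monotone hy.2.le
  have hclosed : IsClosed {y | h (A i y) = B i (h y)} :=
    isClosed_eq (h.continuous.comp (A i).continuous) ((B i).continuous.comp h.continuous)
  have hdn : Icc p r ⊆ closure (Ioo p r ∩ {y | IsDyadic y}) := by
    have hdense : Dense {y : ℝ | IsDyadic y} := by
      refine dense_of_exists_between fun {u v} huv => ?_
      obtain ⟨d, hd, h1, h2⟩ := exists_dyadic_between huv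
      exact ⟨d, hd, h1, h2⟩
    rw [← closure_Ioo hpr.ne]
    exact closure_minimal (hdense.open_subset_closure_inter isOpen_Ioo) isClosed_closure
  intro y hy
  exact closure_minimal hcl hclosed (hdn hy)

end Forcing

end ThompsonPL

namespace ThompsonPL

open Set Filter Topology Relation

/-! ### Frames: images of common fixed points -/

section Defs

/-- `f k = g k` on `[u, v]` for all `k`. -/
def EqFam {κ : Type*} (f g : κ → ℝ → ℝ) (u v : ℝ) : Prop :=
  u ≤ v ∧ ∀ k, ∀ x ∈ Icc u v, f k x = g k x

/-- `f` and `g` differ at points arbitrarily close to the right of `t`. -/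
def DiffAfter (f g : ℝ → ℝ) (t : ℝ) : Prop := ∀ v, t < v → ∃ x, t < x ∧ x < v ∧ f x ≠ g x

/-- `t` is the largest number such that `f k = g k` on `[p, t]` for all `k`. -/
def FirstDiff {κ : Type*} (f g : κ → ℝ → ℝ) (p t : ℝ) : Prop :=
  EqFam f g p t ∧ ∃ k, DiffAfter (f k) (g k) t

/-- The constant family of identity maps. -/
def idFam (ι : Type*) : ι → ℝ → ℝ := fun _ x => x

/-- The products of `a i` with the members of the family, in this order. -/
def mulLeftFam {ι : Type*} (a : ι → ℝ → ℝ) (i : ι) : ι → ℝ → ℝ := fun j x => a i (a j x)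

/-- The products of the members of the family with `a i`, in this order. -/
def mulRightFam {ι : Type*} (a : ι → ℝ → ℝ) (i : ι) : ι → ℝ → ℝ := fun j x => a j (a i x)

variable {ι : Type*} (a b : ι → ℝ → ℝ)

/-- `Φ` holds for a finite set of pairs `T`, one of which must satisfy `T.1 ↦ T.2` under some
conjugacy, if there is a conjugacy with `P.1 ↦ P.2` at all.

In the first case, `a i` commutes with the whole family on the interval from `P.1` to a common fixed
point `r`. Then a conjugacy may be composed with powers of `a i` on that interval, so that the
exponent of its slope at `P.1` can be reduced modulo the exponent `s` of the slope of `a i`. In the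
second case, a conjugacy maps the first point after which `a i` fails to commute with the family to
the corresponding point for `b i`. -/
def Seeds (P : ℝ × ℝ) (Φ : ℝ × ℝ → Prop) : Prop :=
  (∃ (i : ι) (s : ℤ) (v v' t r : ℝ), s ≠ 0 ∧ IsDyadic v ∧ IsDyadic v' ∧ IsDyadic t ∧ IsDyadic r ∧
    P.1 < v ∧ P.2 < v' ∧ P.1 < t ∧ t ≤ v ∧ P.2 + 2 ^ (s.natAbs : ℤ) * (t - P.1) ≤ v' ∧
    P.1 < r ∧ AffOn (a i) P.1 v s ∧ AffOn (b i) P.2 v' s ∧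
    (∀ j, a j P.1 = P.1) ∧ (∀ j, a j r = r) ∧
    EqFam (mulLeftFam a i) (mulRightFam a i) P.1 r ∧
    ∀ m < s.natAbs, Φ (t, P.2 + 2 ^ (m : ℤ) * (t - P.1))) ∨
  (∃ (i : ι) (t t' : ℝ), IsDyadic t ∧ IsDyadic t' ∧
    FirstDiff (mulLeftFam a i) (mulRightFam a i) P.1 t ∧
    FirstDiff (mulLeftFam b i) (mulRightFam b i) P.2 t' ∧ Φ (t, t'))

/-- One step of the deduction of images of common fixed points: if `P.1 ↦ P.2` under a
conjugacy, then `Q.1 ↦ Q.2`. Either `Q.1` is the end of an interval of common fixed points that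
starts at `P.1`, or `Q.1 ↦ Q.2` is forced for each choice of a seed between `P.1` and `Q.1`. -/
def FrameStep (P Q : ℝ × ℝ) : Prop :=
  IsDyadic Q.1 ∧ IsDyadic Q.2 ∧
    ((FirstDiff a (idFam ι) P.1 Q.1 ∧ FirstDiff b (idFam ι) P.2 Q.2) ∨
    ((∀ i, a i Q.1 = Q.1) ∧ Seeds a b P fun T => ChainContra a b P T ∨ Forced a b T Q))

/-- Reasons for which `P.1 ↦ P.2` is impossible for a conjugacy between families supported to the
left of `R`. -/
def FrameContra (R : ℝ) (P : ℝ × ℝ) : Prop :=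
  Seeds a b P (ChainContra a b P) ∨
  (∃ p' q', IsDyadic p' ∧ IsDyadic q' ∧ FirstDiff a (idFam ι) P.1 p' ∧
    FirstDiff b (idFam ι) P.2 q' ∧ ((p' = P.1 ∧ q' ≠ P.2) ∨ (p' ≠ P.1 ∧ q' = P.2))) ∨
  (EqFam a (idFam ι) P.1 R ∧ ∃ y, IsDyadic y ∧ P.2 ≤ y ∧ ∃ i, b i y ≠ y) ∨
  (EqFam b (idFam ι) P.2 R ∧ ∃ y, IsDyadic y ∧ P.1 ≤ y ∧ ∃ i, a i y ≠ y) ∨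
  (∃ (i : ι) (s s' : ℤ) (v v' : ℝ), IsDyadic v ∧ IsDyadic v' ∧ P.1 < v ∧ P.2 < v' ∧
    a i P.1 = P.1 ∧ AffOn (a i) P.1 v s ∧ AffOn (b i) P.2 v' s' ∧ s ≠ s') ∨
  (∃ i, EqFam (mulLeftFam b i) (mulRightFam b i) P.2 R ∧
    ∃ y, IsDyadic y ∧ P.1 ≤ y ∧ ∃ j, a i (a j y) ≠ a j (a i y)) ∨
  (P.1 < R ∧ R ≤ P.2) ∨ (R ≤ P.1 ∧ P.2 ≠ P.1)

/-- A contradiction can be deduced from the existence of a map that conjugates each `a i` to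
`b i` and is supported in `[L, R]`. -/
def Refuted (L R : ℝ) : Prop :=
  ∃ P : ℝ × ℝ, ReflTransGen (FrameStep a b) (L, L) P ∧ FrameContra a b R P

end Defs

/-- A family of locally piecewise linear maps supported in `[L, R]`. -/
structure IsFam {ι : Type*} (A : ι → ℝ ≃o ℝ) (L R : ℝ) : Prop where
  lpl : ∀ i, IsLPL (A i)
  left : ∀ i, ∀ x ≤ L, A i x = x
  right : ∀ i x, R ≤ x → A i x = x

section Sound

variable {ι : Type*} {A B : ι → ℝ ≃o ℝ} {L R : ℝ} {g : ℝ ≃o ℝ}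

/-- A conjugacy between two pairs of families maps the first difference of one pair to the first
difference of the other. -/
theorem FirstDiff.sound {κ : Type*} {f₁ f₂ h₁ h₂ : κ → ℝ → ℝ} (hg₁ : ∀ k x, g (f₁ k x) = h₁ k (g x))
    (hg₂ : ∀ k x, g (f₂ k x) = h₂ k (g x)) {p q t t' : ℝ} (hpq : g p = q)
    (H : FirstDiff f₁ f₂ p t) (H' : FirstDiff h₁ h₂ q t') : g t = t' := by
  obtain ⟨⟨hpt, heq⟩, k, hk⟩ := H
  obtain ⟨⟨hqt, heq'⟩, k', hk'⟩ := H'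
  rcases lt_trichotomy (g t) t' with h | h | h
  · obtain ⟨x, hx1, hx2, hx3⟩ := hk (g.symm t') (g.lt_symm_apply.2 h)
    refine absurd (g.injective ?_) hx3
    rw [hg₁, hg₂]
    refine heq' k _ ⟨?_, (g.lt_symm_apply.1 hx2).le⟩
    rw [← hpq]; exact g.monotone (hpt.trans hx1.le)
  · exact h
  · obtain ⟨y, hy1, hy2, hy3⟩ := hk' (g t) h
    refine absurd ?_ hy3
    have := heq k' (g.symm y) ⟨?_, (g.symm_apply_lt.2 hy2).le⟩
    · have h2 := congrArg g this
      rwa [hg₁, hg₂, g.apply_symm_apply] at h2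
    · rw [g.le_symm_apply, hpq]; exact hqt.trans hy1.le

/-- The exponents of the slopes of the powers of a map at a fixed point. -/
theorem affOn_zpow {c : ℝ ≃o ℝ} {p v : ℝ} {s : ℤ} (hpv : p < v) (h : AffOn c p v s) (hc : c p = p)
    (k : ℤ) : ∃ w, p < w ∧ AffOn (c ^ k : ℝ ≃o ℝ) p w (s * k) := by
  have hfix : ∀ n : ℕ, (c ^ n : ℝ ≃o ℝ) p = p := by
    intro n
    induction n with
    | zero => simp
    | succ n ih => rw [pow_succ, RelIso.mul_apply, hc, ih]
  have hp : ∀ n : ℕ, ∃ w, p < w ∧ AffOn (c ^ n : ℝ ≃o ℝ) p w (s * n) := by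
    intro n
    induction n with
    | zero => exact ⟨v, hpv, AffOn.of_base p p fun x _ => by simp⟩
    | succ n ih =>
      obtain ⟨w, hw, ha⟩ := ih
      refine ⟨min v (c.symm w), lt_min hpv (c.lt_symm_apply.2 (by rwa [hc])), ?_⟩
      have h1 := (h.mono le_rfl (min_le_left v (c.symm w))).comp (g := (c ^ n : ℝ ≃o ℝ))
        (e' := s * n) (ha.mono hc.ge ?_)
      · have h2 : ((c ^ (n + 1) : ℝ ≃o ℝ) : ℝ → ℝ) = (c ^ n : ℝ ≃o ℝ) ∘ c := by
          rw [pow_succ]; rfl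
        rw [h2]
        convert h1 using 1
        push_cast
        ring
      · rw [← c.le_symm_apply]
        exact min_le_right _ _
  obtain ⟨n, rfl | rfl⟩ := k.eq_nat_or_neg
  · simpa using hp n
  · obtain ⟨w, hw, ha⟩ := hp n
    have h1 := ha.symm
    rw [hfix] at h1
    refine ⟨(c ^ n : ℝ ≃o ℝ) w, ?_, ?_⟩
    · have := (c ^ n : ℝ ≃o ℝ).strictMono hw
      rwa [hfix] at this
    · rw [zpow_neg, zpow_natCast, mul_neg]
      exact h1

/-- A given conjugacy may have to be modified between `P.1` and the next common fixed point, by a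
power of the map that commutes with the family there, in order to satisfy one of the seeds. Its
values at common fixed points do not change. -/
theorem Seeds.sound (hA : IsFam A L R) (hg : IsSol A B L R g) {P : ℝ × ℝ}
    (hPd : IsDyadic P.1) {Φ : ℝ × ℝ → Prop} (H : Seeds (fns A) (fns B) P Φ) (hP : g P.1 = P.2) :
    ∃ g', IsSol A B L R g' ∧ g' P.1 = P.2 ∧ (∀ x, (∀ j, A j x = x) → g' x = g x) ∧
      ∃ T, Φ T ∧ g' T.1 = T.2 := by
  rcases H with ⟨i, s, v, v', t, r, hs, -, -, -, hrd, hv, hv', ht, htv, htv', hr, ha, hb, hfp, hfr,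
    hcomm, hΦ⟩ | ⟨i, t, t', -, -, H, H', hΦ⟩
  swap
  · refine ⟨g, hg, hP, fun _ _ => rfl, (t, t'), hΦ, H.sound (g := g) (fun j x => ?_) (fun j x => ?_)
      hP H'⟩
    · simp only [mulLeftFam, hg.comm]
    · simp only [mulRightFam, hg.comm]
  replace hfp : ∀ j, A j P.1 = P.1 := hfp
  replace hfr : ∀ j, A j r = r := hfr
  -- `c` is `A i` on `[P.1, r]` and the identity elsewhere
  have hj1 : A i r = (1 : ℝ ≃o ℝ) r := by simpa using hfr i
  have hj2 : (1 : ℝ ≃o ℝ) P.1 = splice r (A i) 1 hj1 P.1 := by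
    rw [splice_of_le hr.le]; simpa using (hfp i).symm
  set c := splice P.1 1 (splice r (A i) 1 hj1) hj2 with hc
  have hc1 : ∀ x ≤ P.1, c x = x := fun x hx => by rw [hc, splice_of_le hx]; rfl
  have hc2 : ∀ x ∈ Icc P.1 r, c x = A i x := fun x hx => by
    rw [hc, splice_of_ge hx.1, splice_of_le hx.2]
  have hc3 : ∀ x, r ≤ x → c x = x := fun x hx => by
    rw [hc, splice_of_ge (hr.le.trans hx), splice_of_ge hx]; rfl
  have hclpl : IsLPL c := IsLPL.splice hj2 hPd IsLPL.one
    (IsLPL.splice hj1 hrd (hA.lpl i) IsLPL.one)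
  have hcfix : ∀ x, A i x = x → c x = x := by
    intro x hx
    rcases le_total x P.1 with h | h
    · exact hc1 x h
    rcases le_total x r with h' | h'
    · rw [hc2 x ⟨h, h'⟩, hx]
    · exact hc3 x h'
  have hckfix : ∀ (k : ℤ) x, A i x = x → (c ^ k : ℝ ≃o ℝ) x = x := by
    intro k x hx
    have h1 : c ∈ MulAction.stabilizer (ℝ ≃o ℝ) x := hcfix x hx
    exact Subgroup.zpow_mem _ h1 k
  have hcc : ∀ j, Commute (A j) c := by
    intro j
    refine RelIso.ext fun x => ?_
    change A j (c x) = c (A j x)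
    rcases le_total x P.1 with h | h
    · rw [hc1 x h, hc1]
      rw [← hfp j]; exact (A j).monotone h
    rcases le_total x r with h' | h'
    · rw [hc2 x ⟨h, h'⟩, hc2]
      · exact (hcomm.2 j x ⟨h, h'⟩).symm
      · constructor
        · rw [← hfp j]; exact (A j).monotone h
        · rw [← hfr j]; exact (A j).monotone h'
    · rw [hc3 x h', hc3]
      rw [← hfr j]; exact (A j).monotone h'
  obtain ⟨w, hw, M, hM⟩ := hg.lpl.right P.1
  -- reduce the exponent `M` of the slope of `g` modulo `s`
  set k : ℤ := -(M / s) with hk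
  have hMk : M + s * k = M % s := by rw [hk, Int.emod_def]; ring
  have hcp : c P.1 = P.1 := hc1 _ le_rfl
  obtain ⟨z, hz, hck⟩ := affOn_zpow (c := c) (lt_min hv hr)
    ((ha.mono le_rfl (min_le_left v r)).congr fun x hx =>
      (hc2 x ⟨hx.1, hx.2.trans (min_le_right _ _)⟩).symm) hcp k
  set C : ℝ ≃o ℝ := c ^ k with hC
  have hCp : C P.1 = P.1 := hckfix k _ (hfp i)
  have hg' : IsSol A B L R (g * C) := by
    refine ⟨hg.lpl.comp (hclpl.zpow k), fun x hx => ?_, fun x hx => ?_, fun j x => ?_⟩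
    · rw [RelIso.mul_apply, hckfix k x (hA.left i x hx), hg.left x hx]
    · rw [RelIso.mul_apply, hckfix k x (hA.right i x hx), hg.right x hx]
    · have h1 : A j (C x) = C (A j x) := RelIso.ext_iff.1 ((hcc j).zpow_right k) x
      rw [RelIso.mul_apply, RelIso.mul_apply, ← h1, hg.comm]
  have hgP : (g * C) P.1 = P.2 := by rw [RelIso.mul_apply, hCp, hP]
  obtain ⟨m, hm⟩ : ∃ m : ℕ, (m : ℤ) = M % s := ⟨(M % s).toNat, Int.toNat_of_nonneg
    (Int.emod_nonneg _ hs)⟩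
  have hms : m < s.natAbs := by
    have := Int.emod_lt_abs M hs
    rw [Int.abs_eq_natAbs] at this
    omega
  refine ⟨g * C, hg', hgP, fun x hx => by rw [RelIso.mul_apply, hckfix k x (hx i)], _, hΦ m hms, ?_⟩
  have hgerm : ∃ w', P.1 < w' ∧ AffOn (g * C : ℝ ≃o ℝ) P.1 w' m := by
    refine ⟨min z (C.symm w), lt_min hz (C.lt_symm_apply.2 (by rwa [hCp])), ?_⟩
    have h1 := (hck.mono le_rfl (min_le_left z (C.symm w))).comp (g := g) (e' := M)
      (hM.mono hCp.ge ?_)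
    · rw [hMk, ← hm] at h1
      exact h1
    · rw [← C.le_symm_apply]; exact min_le_right _ _
  obtain ⟨w', hw', hgw⟩ := hgerm
  have hBq : B i P.2 = P.2 := by rw [← hgP, ← hg'.comm, hfp]
  have H : ConjZone (A i) (B i) (g * C) P.1 v P.1 P.2 v' P.2 s s :=
    ⟨hg'.comm i, ha, ⟨le_rfl, hv.le⟩, hfp i, hb, ⟨le_rfl, hv'.le⟩, hBq, mul_self_pos.2 hs⟩
  have ht0 := sub_pos.2 ht
  refine H.extend hgP hgw ⟨le_rfl, hw'.le⟩ ⟨ht.le, htv⟩ ⟨Or.inr ht.le, Or.inl hw'⟩ ⟨?_, ?_⟩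
  · have := mul_pos (two_zpow_pos m) ht0
    simp only
    linarith
  · refine le_trans ?_ htv'
    have : (2 : ℝ) ^ (m : ℤ) ≤ 2 ^ (s.natAbs : ℤ) := zpow_le_zpow_right₀ one_le_two (by omega)
    have := mul_le_mul_of_nonneg_right this ht0.le
    simp only
    linarith

theorem FrameStep.sound (hA : IsFam A L R) (hg : IsSol A B L R g) {P Q : ℝ × ℝ}
    (hPd : IsDyadic P.1) (H : FrameStep (fns A) (fns B) P Q) (hP : g P.1 = P.2) : g Q.1 = Q.2 := by
  obtain ⟨-, -, ⟨h1, h2⟩ | ⟨h1, h2⟩⟩ := H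
  · exact h1.sound (f₂ := idFam ι) (h₂ := idFam ι) (g := g) hg.comm (fun _ _ => rfl) hP h2
  · obtain ⟨g', hg', hgP, hfix, T, hT | hT, hgT⟩ := h2.sound hA hg hPd hP
    · exact absurd hgT (hT.sound hg'.lpl hg'.comm hgP)
    · rw [← hfix Q.1 h1]
      exact hT.sound hg'.lpl hg'.comm hgT

theorem FrameContra.sound (hA : IsFam A L R) (hB : IsFam B L R) (hg : IsSol A B L R g) {P : ℝ × ℝ}
    (hPd : IsDyadic P.1) (H : FrameContra (fns A) (fns B) R P) : g P.1 ≠ P.2 := by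
  intro hP
  rcases H with h | ⟨p', q', -, -, h1, h2, h3⟩ | ⟨h1, y, -, hy, i, hi⟩ | ⟨h1, y, -, hy, i, hi⟩ |
    ⟨i, s, s', v, v', -, -, hv, hv', hfix, ha, hb, hss⟩ | ⟨i, h1, y, -, hy, j, hj⟩ | ⟨h1, h2⟩ |
    ⟨h1, h2⟩
  · obtain ⟨g', hg', hgP, -, T, hT, hgT⟩ := h.sound hA hg hPd hP
    exact hT.sound hg'.lpl hg'.comm hgP hgT
  · have h4 := h1.sound (f₂ := idFam ι) (h₂ := idFam ι) (g := g) hg.comm (fun _ _ => rfl) hP h2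
    rcases h3 with ⟨rfl, h3⟩ | ⟨h3, rfl⟩
    · exact h3 (h4.symm.trans hP)
    · exact h3 (g.injective (h4.trans hP.symm))
  · apply hi
    have hfix : A i (g.symm y) = g.symm y := by
      rcases le_total (g.symm y) R with h | h
      · exact h1.2 i _ ⟨by rw [g.le_symm_apply, hP]; exact hy, h⟩
      · exact hA.right i _ h
    have := hg.comm i (g.symm y)
    rwa [hfix, g.apply_symm_apply, eq_comm] at this
  · apply hi
    apply g.injective
    rw [hg.comm]
    have hgy : P.2 ≤ g y := by rw [← hP]; exact g.monotone hy
    rcases le_total (g y) R with h | h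
    · exact h1.2 i _ ⟨hgy, h⟩
    · exact hB.right i _ h
  · obtain ⟨w, hw, M, hM⟩ := hg.lpl.right P.1
    replace hfix : A i P.1 = P.1 := hfix
    apply hss
    have h1 : AffOn (g ∘ A i) P.1 (min v ((A i).symm w)) (M + s) :=
      (ha.mono le_rfl (min_le_left _ _)).comp (hM.mono hfix.ge
        (by rw [← (A i).le_symm_apply]; exact min_le_right _ _))
    have h2 : AffOn (B i ∘ g) P.1 (min w (g.symm v')) (s' + M) :=
      (hM.mono le_rfl (min_le_left _ _)).comp (hb.mono hP.ge
        (by rw [← g.le_symm_apply]; exact min_le_right _ _))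
    have h3 : (g ∘ A i : ℝ → ℝ) = B i ∘ g := funext (hg.comm i)
    rw [h3] at h1
    have h4 : P.1 < min (min v ((A i).symm w)) (min w (g.symm v')) := by
      refine lt_min (lt_min hv ?_) (lt_min hw ?_)
      · rw [(A i).lt_symm_apply, hfix]; exact hw
      · rw [g.lt_symm_apply, hP]; exact hv'
    have := (h1.mono le_rfl (min_le_left _ _)).unique (h2.mono le_rfl (min_le_right _ _)) h4
    omega
  · apply hj
    apply g.injective
    simp only [hg.comm]
    have hgy : P.2 ≤ g y := by rw [← hP]; exact g.monotone hy
    rcases le_total (g y) R with h | h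
    · exact h1.2 j _ ⟨hgy, h⟩
    · simp only [hB.right _ _ h]
  · have := g.strictMono h1
    rw [hP, hg.right R le_rfl] at this
    linarith
  · rw [hg.right _ h1] at hP
    exact h2 hP.symm

/-- No conjugacy exists if a contradiction can be deduced. -/
theorem Refuted.sound (hA : IsFam A L R) (hB : IsFam B L R) (hL : IsDyadic L)
    (hg : IsSol A B L R g) : ¬ Refuted (fns A) (fns B) L R := by
  rintro ⟨P, hP, hcontra⟩
  have key : IsDyadic P.1 ∧ g P.1 = P.2 := by
    clear hcontra
    induction hP with
    | refl => exact ⟨hL, hg.left L le_rfl⟩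
    | tail _ h ih => exact ⟨h.1, h.sound hA hg ih.1 ih.2⟩
  exact hcontra.sound hA hB hg key.1 key.2

end Sound

end ThompsonPL

namespace ThompsonPL

open Set Filter Topology Relation

/-! ### Existence of a conjugacy in the absence of contradictions -/

/-- Two different maps differ at a dyadic point. -/
theorem exists_dyadic_ne {f g : ℝ ≃o ℝ} {y : ℝ} (h : f y ≠ g y) :
    ∃ z, IsDyadic z ∧ y ≤ z ∧ f z ≠ g z := by
  have ho : IsOpen {z | f z ≠ g z} := isOpen_ne_fun f.continuous g.continuous
  obtain ⟨u, hu, hsub⟩ := (mem_nhdsGE_iff_exists_Ico_subset' (lt_add_one y)).1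
    (mem_nhdsWithin_of_mem_nhds (ho.mem_nhds h))
  obtain ⟨z, hz, h1, h2⟩ := exists_dyadic_between (show y < u from hu)
  exact ⟨z, hz, h1.le, hsub ⟨h1.le, h2⟩⟩

/-- The first difference exists and is dyadic, since piecewise linear maps part only at
breakpoints. -/
theorem exists_firstDiff {κ : Type*} [Finite κ] {f g : κ → ℝ ≃o ℝ} (hf : ∀ k, IsLPL (f k))
    (hg : ∀ k, IsLPL (g k)) {p : ℝ} (hpd : IsDyadic p) (hp : ∀ k, f k p = g k p) {k : κ} {x : ℝ}
    (hpx : p ≤ x) (hx : f k x ≠ g k x) :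
    ∃ t, IsDyadic t ∧ FirstDiff (fns f) (fns g) p t ∧ t < x := by
  set D := {y | p ≤ y ∧ ∃ k, f k y ≠ g k y} with hD
  have hxD : x ∈ D := ⟨hpx, k, hx⟩
  have hDb : BddBelow D := ⟨p, fun y hy => hy.1⟩
  set t := sInf D with ht
  have hpt : p ≤ t := le_csInf ⟨x, hxD⟩ fun y hy => hy.1
  have hlt : ∀ k, ∀ y, p ≤ y → y < t → f k y = g k y := by
    intro k y hy hyt
    by_contra h
    exact absurd (csInf_le hDb (show y ∈ D from ⟨hy, k, h⟩)) (not_le.2 hyt)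
  have heq : ∀ k, ∀ y ∈ Icc p t, f k y = g k y := by
    intro k y hy
    rcases hpt.eq_or_lt with h | h
    · obtain rfl : y = p := le_antisymm (hy.2.trans_eq h.symm) hy.1
      exact hp k
    · have hc : IsClosed {y | f k y = g k y} := isClosed_eq (f k).continuous (g k).continuous
      have : Icc p t ⊆ closure (Ico p t) := (closure_Ico h.ne).ge
      exact closure_minimal (fun y hy => hlt k y hy.1 hy.2) hc (this hy)
  have hdiff : ∃ k, DiffAfter (f k) (g k) t := by
    by_contra! h
    have h1 : ∀ k, ∀ᶠ y in 𝓝[>] t, f k y = g k y := by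
      intro k
      have := h k
      simp only [DiffAfter, not_forall, not_exists, not_and, not_not] at this
      obtain ⟨v, hv, hy⟩ := this
      filter_upwards [Ioo_mem_nhdsGT hv] with y hym using hy y hym.1 hym.2
    have h2 : ∀ᶠ y in 𝓝[>] t, ∀ k, f k y = g k y := eventually_all.2 h1
    obtain ⟨u, hu, hsub⟩ := (mem_nhdsGT_iff_exists_Ioo_subset' (lt_add_one t)).1 h2
    obtain ⟨y, hy, hyu⟩ := exists_lt_of_csInf_lt ⟨x, hxD⟩ (show sInf D < u from hu)
    obtain ⟨hpy, j, hj⟩ := hy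
    rcases (csInf_le hDb (show y ∈ D from ⟨hpy, j, hj⟩)).eq_or_lt with h3 | h3
    · exact hj (heq j y ⟨hpy, h3.symm.le⟩)
    · exact hj (hsub ⟨h3, hyu⟩ j)
  have htx : t < x := by
    refine lt_of_le_of_ne (csInf_le hDb hxD) fun h => hx (heq k x ⟨hpx, h.symm.le⟩)
  refine ⟨t, ?_, ⟨⟨hpt, heq⟩, hdiff⟩, htx⟩
  -- at a point that is not dyadic, both maps are affine, and agreement continues
  by_contra htd
  have hpt' : p < t := lt_of_le_of_ne hpt fun h => htd (h ▸ hpd)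
  obtain ⟨j, hj⟩ := hdiff
  obtain ⟨u, v, hu, hv, e, he⟩ := (hf j).two t htd
  obtain ⟨u', v', hu', hv', e', he'⟩ := (hg j).two t htd
  have h1 : e = e' := by
    have h2 : AffOn (f j) (max p (max u u')) t e' :=
      (he'.mono ((le_max_right _ _).trans (le_max_right _ _)) hv'.le).congr fun y hy =>
        (heq j y ⟨(le_max_left _ _).trans hy.1, hy.2⟩).symm
    exact (he.mono ((le_max_left _ _).trans (le_max_right _ _)) hv.le).unique h2
      (max_lt hpt' (max_lt hu hu'))
  subst h1
  obtain ⟨y, hy1, hy2, hy3⟩ := hj (min v v') (lt_min hv hv')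
  apply hy3
  rw [he t ⟨hu.le, hv.le⟩ y ⟨(hu.trans hy1).le, (hy2.trans_le (min_le_left _ _)).le⟩,
    he' t ⟨hu'.le, hv'.le⟩ y ⟨(hu'.trans hy1).le, (hy2.trans_le (min_le_right _ _)).le⟩,
    heq j t ⟨hpt, le_rfl⟩]

section Complete

variable {ι : Type*} {A B : ι → ℝ ≃o ℝ} {L R : ℝ}

/-- If one of the maps moves points right after the common fixed point `p`, then there is a next
dyadic common fixed point. -/
theorem exists_next_fix [Finite ι] (hA : ∀ i, IsLPL (A i)) {p R : ℝ} (hp : ∀ i, A i p = p)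
    (hR : ∀ i, A i R = R) (hRd : IsDyadic R) (hpR : p < R) {i : ι} {s : ℤ} {v : ℝ} (hs : s ≠ 0)
    (hv : p < v) (ha : AffOn (A i) p v s) :
    ∃ r, IsDyadic r ∧ p < r ∧ r ≤ R ∧ (∀ j, A j r = r) ∧
      ∀ x, IsDyadic x → p < x → x < r → ∃ j, A j x ≠ x := by
  set D := {x | IsDyadic x ∧ p < x ∧ ∀ j, A j x = x} with hD
  have hRD : R ∈ D := ⟨hRd, hpR, hR⟩
  have hDv : ∀ x ∈ D, v ≤ x := by
    rintro x ⟨-, hpx, hx⟩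
    by_contra h
    apply hs
    have h1 := ha p ⟨le_rfl, hv.le⟩ x ⟨hpx.le, (not_le.1 h).le⟩
    rw [hx, hp] at h1
    apply two_zpow_eq_one
    have h2 : x - p ≠ 0 := (sub_pos.2 hpx).ne'
    exact mul_right_cancel₀ h2 (by linarith)
  have hDb : BddBelow D := ⟨v, hDv⟩
  set r := sInf D with hr
  have hpr : p < r := hv.trans_le (le_csInf ⟨R, hRD⟩ hDv)
  have hrR : r ≤ R := csInf_le hDb hRD
  have hrfix : ∀ j, A j r = r := by
    have hc : IsClosed (⋂ j, {x | A j x = x}) := isClosed_iInter fun j =>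
      isClosed_eq (A j).continuous continuous_id
    have h1 : D ⊆ ⋂ j, {x | A j x = x} := fun x hx => mem_iInter.2 hx.2.2
    have h2 := closure_minimal h1 hc (csInf_mem_closure ⟨R, hRD⟩ hDb)
    exact fun j => mem_iInter.1 h2 j
  have hchain : ∀ x, IsDyadic x → p < x → x < r → ∃ j, A j x ≠ x := by
    intro x hx hpx hxr
    by_contra! h
    exact absurd (csInf_le hDb (show x ∈ D from ⟨hx, hpx, h⟩)) (not_le.2 hxr)
  refine ⟨r, ?_, hpr, hrR, hrfix, hchain⟩
  by_contra hrd
  obtain ⟨j, hj⟩ := exists_moves_left hpr hchain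
  obtain ⟨u, w, hu, hw, e, he⟩ := (hA j).two r hrd
  -- a second fixed point near `r` shows that `A j` is the identity there
  obtain ⟨x, hx, hxw⟩ := exists_lt_of_csInf_lt ⟨R, hRD⟩ (show sInf D < w from hw)
  have hrx : r < x := lt_of_le_of_ne (csInf_le hDb hx) fun h => hrd (h ▸ hx.1)
  have h1 := he r ⟨hu.le, hw.le⟩ x ⟨(hu.trans hrx).le, hxw.le⟩
  rw [hx.2.2, hrfix] at h1
  have he0 : (2 : ℝ) ^ e = 1 := mul_right_cancel₀ (sub_pos.2 hrx).ne' (by linarith)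
  obtain ⟨y, hy1, hy2, hy3⟩ := hj u hu
  apply hy3
  rw [he r ⟨hu.le, hw.le⟩ y ⟨hy1.le, (hy2.trans hw).le⟩, hrfix, he0]
  ring

/-- Forced values stay in the support: a zone reaching beyond it would contain two fixed points. -/
theorem FStep.snd_mem_Icc (hB : IsFam B L R) {P Q : ℝ × ℝ}
    (H : FStep (fns A) (fns B) P Q) (hP : P.2 ∈ Icc L R) : Q.2 ∈ Icc L R := by
  have hmem : ∀ i x, B i x ∈ Icc L R ↔ x ∈ Icc L R := by
    intro i x
    have h1 : B i L = L := hB.left i L le_rfl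
    have h2 : B i R = R := hB.right i R le_rfl
    constructor
    · intro h
      exact ⟨(B i).le_iff_le.1 (h1.trans_le h.1), (B i).le_iff_le.1 (h.2.trans_eq h2.symm)⟩
    · intro h
      exact ⟨h1.symm.trans_le ((B i).monotone h.1), ((B i).monotone h.2).trans_eq h2⟩
  obtain ⟨-, -, i, ⟨-, h⟩ | ⟨-, h⟩ | ⟨u, v, s, m, hz, hs, h1, h2, -, -, h3, h4, -⟩⟩ := H
  · rw [← h]; exact (hmem i _).2 hP
  · rw [← h] at hP; exact (hmem i _).1 hP
  · set φ : ℝ → ℝ := fun x => P.2 + 2 ^ m * (x - P.1) with hφ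
    have hφm : ∀ x y, x ≤ y → φ x ≤ φ y := fun x y hxy => by
      have := mul_nonneg (two_zpow_pos m).le (sub_nonneg.2 hxy)
      simp only [hφ]; linarith
    have hPφ : φ P.1 = P.2 := by simp [hφ]
    have hQφ : φ Q.1 = Q.2 := h4.symm
    have hP' : P.2 ∈ Icc (φ u) (φ v) := hPφ ▸ ⟨hφm _ _ h1.1, hφm _ _ h1.2⟩
    have hQ' : Q.2 ∈ Icc (φ u) (φ v) := hQφ ▸ ⟨hφm _ _ h2.1, hφm _ _ h2.2⟩
    -- two fixed points in the zone contradict `s ≠ 0`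
    have key : ∀ x y, x ∈ Icc (φ u) (φ v) → y ∈ Icc (φ u) (φ v) → x < y → B i x = x →
        B i y = y → False := by
      intro x y hx hy hxy hbx hby
      have h5 := h3 x hx y hy
      change B i y = B i x + _ at h5
      rw [hbx, hby] at h5
      exact hs (two_zpow_eq_one (mul_right_cancel₀ (sub_pos.2 hxy).ne' (by linarith)))
    constructor
    · by_contra h
      have h := not_le.1 h
      exact key Q.2 L hQ' ⟨hQ'.1.trans h.le, hP.1.trans hP'.2⟩ h (hB.left i _ h.le)
        (hB.left i _ le_rfl)
    · by_contra h
      have h := not_le.1 h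
      exact key R Q.2 ⟨hP'.1.trans hP.2, h.le.trans hQ'.2⟩ hQ' h (hB.right i _ le_rfl)
        (hB.right i _ h.le)

theorem Forced.dyadic_mem (hB : IsFam B L R) {T Q : ℝ × ℝ}
    (H : Forced (fns A) (fns B) T Q) (hT : IsDyadic T.1 ∧ IsDyadic T.2 ∧ T.2 ∈ Icc L R) :
    IsDyadic Q.1 ∧ IsDyadic Q.2 ∧ Q.2 ∈ Icc L R := by
  induction H with
  | refl => exact hT
  | tail _ h ih => exact ⟨h.1, h.2.1, h.snd_mem_Icc hB ih.2.2⟩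

/-- The values forced by a seed without contradiction. -/
theorem forcing_of_not_chainContra (hA : IsFam A L R) (hB : IsFam B L R)
    {P T : ℝ × ℝ} (hT : IsDyadic T.1 ∧ IsDyadic T.2 ∧ T.2 ∈ Icc L R)
    (H : ¬ ChainContra (fns A) (fns B) P T) :
    Forcing A B (fun x x' => Forced (fns A) (fns B) T (x, x')) (max |L| |R|) where
  dyadic x x' h := ⟨(h.dyadic_mem hB hT).1, (h.dyadic_mem hB hT).2.1⟩
  push i x x' h := by
    have hd := h.dyadic_mem hB hT
    exact ReflTransGen.tail h ⟨((hA.lpl i).dyadic x).2 hd.1, ((hB.lpl i).dyadic x').2 hd.2.1, i,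
      Or.inl ⟨rfl, rfl⟩⟩
  pull i x x' h := by
    have hd := h.dyadic_mem hB hT
    exact ReflTransGen.tail h ⟨((hA.lpl i).dyadic x).1 hd.1, ((hB.lpl i).dyadic x').1 hd.2.1, i,
      Or.inr (Or.inl ⟨rfl, rfl⟩)⟩
  zone i x x' y y' h hy hy' hz := ReflTransGen.tail h ⟨hy, hy', i, Or.inr (Or.inr hz)⟩
  mono x x' y y' h h' hxy := by
    by_contra hc
    exact H ⟨_, h, Or.inr (Or.inl ⟨_, h', Or.inl ⟨hxy, not_lt.1 hc⟩⟩)⟩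
  uniq x x' y' h h' := by
    by_contra hc
    exact H ⟨_, h, Or.inr (Or.inl ⟨_, h', Or.inr ⟨rfl, hc⟩⟩)⟩
  bdd x x' h := abs_le_max_abs_abs (h.dyadic_mem hB hT).2.2.1 (h.dyadic_mem hB hT).2.2.2
  noClash i x x' h hz := H ⟨_, h, Or.inr (Or.inr ⟨i, hz⟩)⟩

/-- `P.1 ↦ P.2` has been deduced, and there is a conjugacy to the left of `P.1` that extends it. -/
structure PartialSol (A B : ι → ℝ ≃o ℝ) (L R : ℝ) (P : ℝ × ℝ) : Prop where
  derived : ReflTransGen (FrameStep (fns A) (fns B)) (L, L) P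
  dyadic₁ : IsDyadic P.1
  dyadic₂ : IsDyadic P.2
  mem₁ : P.1 ∈ Icc L R
  mem₂ : P.2 ∈ Icc L R
  fix₁ : ∀ i, A i P.1 = P.1
  fix₂ : ∀ i, B i P.2 = P.2
  sol : ∃ h : ℝ ≃o ℝ, IsLPL h ∧ (∀ x ≤ L, h x = x) ∧ h P.1 = P.2 ∧
    ∀ i, ∀ x ≤ P.1, h (A i x) = B i (h x)

/-- Two conjugacies over an interval between consecutive dyadic common fixed points agree at its
right end, since they map it to the next dyadic common fixed point of the second family. -/
theorem not_lt_of_conj {p r : ℝ} {h₁ h₂ : ℝ ≃o ℝ} (hA : ∀ i, A i r = r) (hpr : p < r)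
    (hrd : IsDyadic r) (hchain : ∀ x, IsDyadic x → p < x → x < r → ∃ j, A j x ≠ x)
    (hl₁ : IsLPL h₁) (hl₂ : IsLPL h₂) (hp : h₁ p = h₂ p)
    (hc₁ : ∀ i, ∀ y ∈ Icc p r, h₁ (A i y) = B i (h₁ y))
    (hc₂ : ∀ i, ∀ y ∈ Icc p r, h₂ (A i y) = B i (h₂ y)) : ¬ h₁ r < h₂ r := by
  intro hlt
  have h1 : p < h₂.symm (h₁ r) := by
    rw [h₂.lt_symm_apply, ← hp]; exact h₁.strictMono hpr
  have h2 : h₂.symm (h₁ r) < r := h₂.symm_apply_lt.2 hlt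
  obtain ⟨j, hj⟩ := hchain _ ((hl₂.symm.dyadic _).2 ((hl₁.dyadic r).2 hrd)) h1 h2
  apply hj
  apply h₂.injective
  rw [hc₂ j _ ⟨h1.le, h2.le⟩, h₂.apply_symm_apply, ← hc₁ j r ⟨hpr.le, le_rfl⟩, hA]

theorem DiffAfter.lt_right (hB : IsFam B L R) {i : ι} {f : ℝ → ℝ} {t : ℝ}
    (h : DiffAfter (B i) f t) (hf : ∀ x, R ≤ x → f x = x) : t < R := by
  by_contra hc
  obtain ⟨x, hx, -, hne⟩ := h (t + 1) (by linarith)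
  have hRx := (not_lt.1 hc).trans hx.le
  exact hne (by rw [hB.right i x hRx, hf x hRx])

/-- Seeds exist in the interval to the right of a common fixed point, if no contradiction comes
from the comparison of the two families there. -/
theorem exists_seeds [Finite ι] (hA : IsFam A L R) (hB : IsFam B L R) {P : ℝ × ℝ}
    (H : PartialSol A B L R P) (hno : ¬ FrameContra (fns A) (fns B) R P) {i : ι} {s : ℤ}
    {v v' r : ℝ} (hs : s ≠ 0) (hv : P.1 < v) (ha : AffOn (A i) P.1 v s) (hv' : P.2 < v')
    (hb : AffOn (B i) P.2 v' s) (hrd : IsDyadic r) (hpr : P.1 < r) (hr : ∀ j, A j r = r) :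
    ∃ K : Set (ℝ × ℝ), (∀ T ∈ K, IsDyadic T.1 ∧ IsDyadic T.2 ∧ T.2 ∈ Icc L R) ∧
      (∀ T ∈ K, T.1 ∈ Ioo P.1 r) ∧
      ∀ Φ : ℝ × ℝ → Prop, (∀ T ∈ K, Φ T) → Seeds (fns A) (fns B) P Φ := by
  have hcont : ∀ {C : ι → ℝ ≃o ℝ} {p : ℝ}, (∀ j, C j p = p) → ∀ j,
      (fun j => C i * C j) j p = (fun j => C j * C i) j p := fun h j => by
    simp only [RelIso.mul_apply, h]
  have hlpl : ∀ {C : ι → ℝ ≃o ℝ}, (∀ j, IsLPL (C j)) → ∀ i j, IsLPL (C i * C j : ℝ ≃o ℝ) :=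
    fun h i j => (h i).comp (h j)
  by_cases hcomm : ∀ j, ∀ x ∈ Icc P.1 r, A i (A j x) = A j (A i x)
  · -- `P.2 < R`, as `B i` moves points to the right of `P.2`
    have hqR : P.2 < R := by
      by_contra hc
      have h1 := hb P.2 ⟨le_rfl, hv'.le⟩ v' ⟨hv'.le, le_rfl⟩
      rw [hB.right i _ (not_lt.1 hc), hB.right i _ ((not_lt.1 hc).trans hv'.le)] at h1
      exact hs (two_zpow_eq_one (mul_right_cancel₀ (sub_pos.2 hv').ne' (by linarith)))
    obtain ⟨w, hwd, hw1, hw2⟩ := exists_dyadic_between hv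
    obtain ⟨w', hwd', hw1', hw2'⟩ := exists_dyadic_between (lt_min hv' hqR)
    set N : ℤ := (s.natAbs : ℤ) with hN
    -- `t` is so close to `P.1` that all candidates for its image stay below `w'`
    have hNp := two_zpow_pos (-N)
    obtain ⟨t, htd, ht1, ht2⟩ := exists_dyadic_between (show P.1 < min (min w r)
        (P.1 + 2 ^ (-N) * (w' - P.2)) from lt_min (lt_min hw1 hpr) (by
          have := mul_pos hNp (sub_pos.2 hw1'); linarith))
    have ht3 : t < w := ht2.trans_le ((min_le_left _ _).trans (min_le_left _ _))
    have ht4 : t < r := ht2.trans_le ((min_le_left _ _).trans (min_le_right _ _))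
    have ht5 : P.2 + 2 ^ N * (t - P.1) ≤ w' := by
      have h1 := (ht2.trans_le (min_le_right _ _)).le
      have h2 := mul_le_mul_of_nonneg_left (sub_le_iff_le_add'.2 h1) (two_zpow_pos N).le
      rw [← mul_assoc, ← zpow_add₀ two_ne_zero] at h2
      simp at h2
      linarith
    refine ⟨{T | ∃ m < s.natAbs, T = (t, P.2 + 2 ^ (m : ℤ) * (t - P.1))}, ?_, ?_, ?_⟩
    · rintro T ⟨m, hm, rfl⟩
      refine ⟨htd, H.dyadic₁.affine htd H.dyadic₂ _, ?_, ?_⟩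
      · have := mul_pos (two_zpow_pos m) (sub_pos.2 ht1)
        have := H.mem₂.1
        simp only
        linarith
      · refine le_trans ?_ (ht5.trans (hw2'.le.trans (min_le_right _ _)))
        have : (2 : ℝ) ^ (m : ℤ) ≤ 2 ^ N := zpow_le_zpow_right₀ one_le_two (by omega)
        have := mul_le_mul_of_nonneg_right this (sub_pos.2 ht1).le
        simp only
        linarith
    · rintro T ⟨m, hm, rfl⟩
      exact ⟨ht1, ht4⟩
    · intro Φ hΦ
      exact Or.inl ⟨i, s, w, w', t, r, hs, hwd, hwd', htd, hrd, hw1, hw1', ht1, ht3.le, ht5, hpr,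
        ha.mono le_rfl hw2.le, hb.mono le_rfl (hw2'.le.trans (min_le_left _ _)), H.fix₁, hr,
        ⟨hpr.le, hcomm⟩, fun m hm => hΦ _ ⟨m, hm, rfl⟩⟩
  · -- the first point after which `A i` fails to commute with the family is a seed
    push Not at hcomm
    obtain ⟨j, x, hx, hne⟩ := hcomm
    obtain ⟨t, htd, ht, htx⟩ := exists_firstDiff (f := fun j => A i * A j) (g := fun j => A j * A i)
      (fun j => hlpl hA.lpl i j) (fun j => hlpl hA.lpl j i) H.dyadic₁ (hcont H.fix₁) (k := j) hx.1
      hne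
    obtain ⟨t', htd', ht'⟩ : ∃ t', IsDyadic t' ∧
        FirstDiff (mulLeftFam (fns B) i) (mulRightFam (fns B) i) P.2 t' := by
      by_cases hBc : EqFam (mulLeftFam (fns B) i) (mulRightFam (fns B) i) P.2 R
      · exfalso
        obtain ⟨y, hyd, hxy, hy⟩ := exists_dyadic_ne (f := A i * A j) (g := A j * A i) hne
        exact hno (Or.inr (Or.inr (Or.inr (Or.inr (Or.inr (Or.inl
          ⟨i, hBc, y, hyd, hx.1.trans hxy, j, hy⟩))))))
      · have : ∃ k, ∃ y ∈ Icc P.2 R, B i (B k y) ≠ B k (B i y) := by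
          by_contra! h
          exact hBc ⟨H.mem₂.2, fun k y hy => h k y hy⟩
        obtain ⟨k, y, hy, hne'⟩ := this
        obtain ⟨t', h1, h2, -⟩ := exists_firstDiff (f := fun j => B i * B j)
          (g := fun j => B j * B i) (fun j => hlpl hB.lpl i j) (fun j => hlpl hB.lpl j i)
          H.dyadic₂ (hcont H.fix₂) (k := k) hy.1 hne'
        exact ⟨t', h1, h2⟩
    refine ⟨{(t, t')}, ?_, ?_, fun Φ hΦ => Or.inr ⟨i, t, t', htd, htd', ht, ht', hΦ _ rfl⟩⟩
    · rintro T rfl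
      obtain ⟨k, hk⟩ := ht'.2
      refine ⟨htd, htd', H.mem₂.1.trans ht'.1.1, ?_⟩
      by_contra hc
      obtain ⟨y, hy, -, hne'⟩ := hk (t' + 1) (by linarith)
      have hRy : R ≤ y := (not_le.1 hc).le.trans hy.le
      apply hne'
      simp only [mulLeftFam, mulRightFam, hB.right _ _ hRy]
    · rintro T rfl
      refine ⟨lt_of_le_of_ne ht.1.1 fun h => ?_, htx.trans_le hx.2⟩
      -- affine germs at a common fixed point commute
      obtain ⟨k, hk⟩ := ht.2
      simp only at h
      rw [← h] at hk
      obtain ⟨w, hw, e, he⟩ := (hA.lpl k).right P.1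
      have e1 := (he.mono le_rfl (min_le_left w ((A k).symm v))).comp (g := A i) (e' := s)
        (ha.mono (H.fix₁ k).ge (by rw [← (A k).le_symm_apply]; exact min_le_right _ _))
      have e2 := (ha.mono le_rfl (min_le_left v ((A i).symm w))).comp (g := A k) (e' := e)
        (he.mono (H.fix₁ i).ge (by rw [← (A i).le_symm_apply]; exact min_le_right _ _))
      have h1 : P.1 < min w ((A k).symm v) := lt_min hw (by
        rw [(A k).lt_symm_apply, H.fix₁]; exact hv)
      have h2 : P.1 < min v ((A i).symm w) := lt_min hv (by
        rw [(A i).lt_symm_apply, H.fix₁]; exact hw)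
      obtain ⟨y, hy1, hy2, hy3⟩ := hk _ (lt_min h1 h2)
      apply hy3
      have h3 := e1 P.1 ⟨le_rfl, h1.le⟩ y ⟨hy1.le, (hy2.trans_le (min_le_left _ _)).le⟩
      have h4 := e2 P.1 ⟨le_rfl, h2.le⟩ y ⟨hy1.le, (hy2.trans_le (min_le_right _ _)).le⟩
      simp only [Function.comp, H.fix₁] at h3 h4
      change A i (A k y) = A k (A i y)
      rw [h3, h4, add_comm s e]

/-- If some map moves points right after `P.1`, a partial conjugacy extends to the next dyadic
common fixed point. -/
theorem PartialSol.chain_step [Finite ι] (hA : IsFam A L R) (hB : IsFam B L R)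
    (hRd : IsDyadic R) {P : ℝ × ℝ} (H : PartialSol A B L R P)
    (hno : ¬ FrameContra (fns A) (fns B) R P) {i : ι} (hi : DiffAfter (A i) id P.1) :
    ∃ Q, PartialSol A B L R Q ∧ P.1 < Q.1 := by
  obtain ⟨v, hv, s, ha⟩ := (hA.lpl i).right P.1
  obtain ⟨v', hv', s', hb⟩ := (hB.lpl i).right P.2
  have hpR : P.1 < R := hi.lt_right hA fun _ _ => rfl
  have hs : s ≠ 0 := by
    rintro rfl
    obtain ⟨x, hx1, hx2, hx3⟩ := hi v hv
    apply hx3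
    rw [ha P.1 ⟨le_rfl, hv.le⟩ x ⟨hx1.le, hx2.le⟩, H.fix₁]
    simp
  have hss : s = s' := by
    by_contra hne
    obtain ⟨w, hwd, hw1, hw2⟩ := exists_dyadic_between hv
    obtain ⟨w', hwd', hw1', hw2'⟩ := exists_dyadic_between hv'
    exact hno (Or.inr (Or.inr (Or.inr (Or.inr (Or.inl ⟨i, s, s', w, w', hwd, hwd', hw1, hw1',
      H.fix₁ i, ha.mono le_rfl hw2.le, hb.mono le_rfl hw2'.le, hne⟩)))))
  subst hss
  obtain ⟨r, hrd, hpr, hrR, hr, hchain⟩ := exists_next_fix hA.lpl H.fix₁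
    (fun i => hA.right i R le_rfl) hRd hpR hs hv ha
  obtain ⟨K, hK1, hK2, hK3⟩ := exists_seeds hA hB H hno hs hv ha hv' hb hrd hpr hr
  -- a seed without contradiction extends to the whole interval
  have hext : ∀ T ∈ K, ¬ ChainContra (fns A) (fns B) P T → ∃ h : ℝ ≃o ℝ, IsLPL h ∧ h P.1 = P.2 ∧
      Forced (fns A) (fns B) T (r, h r) ∧ ∀ i, ∀ y ∈ Icc P.1 r, h (A i y) = B i (h y) := by
    intro T hT hTc
    obtain ⟨h, hl, hΦ, hc⟩ := (forcing_of_not_chainContra hA hB (hK1 T hT) hTc).exists_conj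
      hA.lpl hB.lpl H.fix₁ hr H.dyadic₁ hrd (hK2 T hT) (t' := T.2) .refl hchain
    refine ⟨h, hl, ?_, hΦ r ⟨hpr.le, le_rfl⟩ hrd, hc⟩
    by_contra hne
    exact hTc ⟨_, hΦ P.1 ⟨le_rfl, hpr.le⟩ H.dyadic₁, Or.inl ⟨rfl, hne⟩⟩
  -- not all seeds lead to contradictions, since this would be one for `P`
  obtain ⟨T, hT, hTc⟩ : ∃ T ∈ K, ¬ ChainContra (fns A) (fns B) P T := by
    by_contra! h
    exact hno (Or.inl (hK3 _ h))
  obtain ⟨h, hl, hp, hf, hc⟩ := hext T hT hTc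
  have hqd := hf.dyadic_mem hB (hK1 T hT)
  obtain ⟨h₀, hl₀, hL₀, hp₀, hc₀⟩ := H.sol
  have hj : h₀ P.1 = h P.1 := hp₀.trans hp.symm
  refine ⟨(r, h r), ⟨H.derived.tail ⟨hrd, hqd.2.1, Or.inr ⟨hr, hK3 _ fun T' hT' => ?_⟩⟩, hrd,
    hqd.2.1, ⟨H.mem₁.1.trans hpr.le, hrR⟩, hqd.2.2, hr, fun i => ?_,
    splice P.1 h₀ h hj, IsLPL.splice hj H.dyadic₁ hl₀ hl, fun x hx => ?_, splice_of_ge hpr.le,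
    fun i x hx => ?_⟩, hpr⟩
  · by_cases hc' : ChainContra (fns A) (fns B) P T'
    · exact Or.inl hc'
    · right
      obtain ⟨h', hl', hp', hf', hc'⟩ := hext T' hT' hc'
      have : h' r = h r := le_antisymm
        (not_lt.1 (not_lt_of_conj hr hpr hrd hchain hl hl' (hp.trans hp'.symm) hc hc'))
        (not_lt.1 (not_lt_of_conj hr hpr hrd hchain hl' hl (hp'.trans hp.symm) hc' hc))
      rwa [this] at hf'
  · have := hc i r ⟨hpr.le, le_rfl⟩
    rw [hr] at this
    exact this.symm
  · rw [splice_of_le (hx.trans H.mem₁.1), hL₀ x hx]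
  · have hx : x ≤ r := hx
    rcases le_total x P.1 with hxp | hxp
    · rw [splice_of_le hxp, splice_of_le, hc₀ i x hxp]
      rw [← H.fix₁ i]; exact (A i).monotone hxp
    · rw [splice_of_ge hxp, splice_of_ge, hc i x ⟨hxp, hx⟩]
      rw [← H.fix₁ i]; exact (A i).monotone hxp

/-- A partial conjugacy that cannot be completed extends beyond the interval of common fixed points
that starts at `P.1`. The last clause excludes an accumulation of partial conjugacies at a point
to the left of which all maps are the identity. -/
theorem PartialSol.step [Finite ι] (hA : IsFam A L R) (hB : IsFam B L R)
    (hRd : IsDyadic R) (hno : ¬ Refuted (fns A) (fns B) L R) {P : ℝ × ℝ}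
    (H : PartialSol A B L R P) :
    (∃ g, IsSol A B L R g) ∨ ∃ Q, PartialSol A B L R Q ∧ P.1 < Q.1 ∧
      ∀ x, P.1 ≤ x → (∀ i, ∀ y ∈ Icc P.1 x, A i y = y) → x ≤ Q.1 := by
  have hno' : ∀ P, ReflTransGen (FrameStep (fns A) (fns B)) (L, L) P →
      ¬ FrameContra (fns A) (fns B) R P := fun P hP hc => hno ⟨P, hP, hc⟩
  have hnoP := hno' P H.derived
  obtain ⟨h₀, hl₀, hL₀, hp₀, hc₀⟩ := H.sol
  by_cases hmA : ∃ i x, P.1 ≤ x ∧ A i x ≠ x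
  · right
    obtain ⟨i, x, hpx, hx⟩ := hmA
    obtain ⟨j, y, hqy, hy⟩ : ∃ i y, P.2 ≤ y ∧ B i y ≠ y := by
      by_contra! h
      obtain ⟨z, hzd, hxz, hz⟩ := exists_dyadic_ne (f := A i) (g := 1) hx
      exact hnoP (Or.inr (Or.inr (Or.inr (Or.inl ⟨⟨H.mem₂.2, fun j y hy => h j y hy.1⟩, z, hzd,
        hpx.trans hxz, i, hz⟩))))
    obtain ⟨p', hpd', hp', -⟩ := exists_firstDiff (g := fun _ : ι => 1) hA.lpl
      (fun _ => IsLPL.one) H.dyadic₁ H.fix₁ (k := i) hpx hx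
    obtain ⟨q', hqd', hq', -⟩ := exists_firstDiff (g := fun _ : ι => 1) hB.lpl
      (fun _ => IsLPL.one) H.dyadic₂ H.fix₂ (k := j) hqy hy
    have hder : ReflTransGen (FrameStep (fns A) (fns B)) (L, L) (p', q') :=
      H.derived.tail ⟨hpd', hqd', Or.inl ⟨hp', hq'⟩⟩
    obtain ⟨k, hk⟩ := hp'.2
    obtain ⟨k', hk'⟩ := hq'.2
    have hpp := hp'.1.1
    have hqq := hq'.1.1
    -- both families are trivial from `P` to `(p', q')`, where any map is a conjugacy
    obtain ⟨h, hl, hL, hp, hc⟩ : ∃ h : ℝ ≃o ℝ, IsLPL h ∧ (∀ x ≤ L, h x = x) ∧ h p' = q' ∧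
        ∀ i, ∀ x ≤ p', h (A i x) = B i (h x) := by
      have hiff : p' = P.1 ↔ q' = P.2 := by
        by_contra hc
        refine hnoP (Or.inr (Or.inl ⟨p', q', hpd', hqd', hp', hq', ?_⟩))
        tauto
      rcases hpp.eq_or_lt with h1 | h1
      · have h2 := hiff.1 h1.symm
        rw [h2, ← h1]
        exact ⟨h₀, hl₀, hL₀, hp₀, hc₀⟩
      · have h2 : P.2 < q' := lt_of_le_of_ne hqq fun h => h1.ne' (hiff.2 h.symm)
        obtain ⟨f, hf, hfp, hfp'⟩ := exists_fill H.dyadic₁ hpd' H.dyadic₂ hqd' h1 h2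
        have hj : h₀ P.1 = f P.1 := hp₀.trans hfp.symm
        refine ⟨splice P.1 h₀ f hj, IsLPL.splice hj H.dyadic₁ hl₀ hf, fun x hx => ?_,
          by rw [splice_of_ge hpp, hfp'], fun i x hx => ?_⟩
        · rw [splice_of_le (hx.trans H.mem₁.1), hL₀ x hx]
        · rcases le_total x P.1 with hxp | hxp
          · rw [splice_of_le hxp, splice_of_le, hc₀ i x hxp]
            rw [← H.fix₁ i]; exact (A i).monotone hxp
          · have h3 : A i x = x := hp'.1.2 i x ⟨hxp, hx⟩
            rw [h3, splice_of_ge hxp]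
            refine (hq'.1.2 i (f x) ⟨?_, ?_⟩).symm
            · rw [← hfp]; exact f.monotone hxp
            · rw [← hfp']; exact f.monotone hx
    have hP' : PartialSol A B L R (p', q') :=
      ⟨hder, hpd', hqd', ⟨H.mem₁.1.trans hpp, (hk.lt_right hA fun _ _ => rfl).le⟩,
        ⟨H.mem₂.1.trans hqq, (hk'.lt_right hB fun _ _ => rfl).le⟩,
        fun i => hp'.1.2 i p' ⟨hpp, le_rfl⟩, fun i => hq'.1.2 i q' ⟨hqq, le_rfl⟩, h, hl, hL, hp, hc⟩
    obtain ⟨Q, hQ, hlt⟩ := hP'.chain_step hA hB hRd (hno' _ hder) (i := k) hk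
    refine ⟨Q, hQ, hpp.trans_lt hlt, fun x hx hfix => ?_⟩
    refine le_trans ?_ hlt.le
    by_contra hc
    obtain ⟨y, hy1, hy2, hy3⟩ := hk x (not_le.1 hc)
    exact hy3 (hfix k y ⟨hpp.trans hy1.le, hy2.le⟩)
  · -- beyond `P`, both families are trivial, and any map with the right end points will do
    left
    push Not at hmA
    have hmB : ∀ i y, P.2 ≤ y → B i y = y := by
      by_contra! h
      obtain ⟨i, y, hy, hne⟩ := h
      obtain ⟨z, hzd, hyz, hz⟩ := exists_dyadic_ne (f := B i) (g := 1) hne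
      exact hnoP (Or.inr (Or.inr (Or.inl ⟨⟨H.mem₁.2, fun j y hy => hmA j y hy.1⟩, z, hzd,
        hy.trans hyz, i, hz⟩)))
    obtain ⟨f, hf, hfp, hfR⟩ : ∃ f : ℝ ≃o ℝ, IsLPL f ∧ f P.1 = P.2 ∧ f R = R := by
      rcases H.mem₁.2.eq_or_lt with h | h
      · refine ⟨1, IsLPL.one, ?_, rfl⟩
        by_contra hne
        exact hnoP (Or.inr (Or.inr (Or.inr (Or.inr (Or.inr (Or.inr (Or.inr ⟨h.ge, fun h1 =>
          hne h1.symm⟩)))))))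
      · have h2 : P.2 < R := by
          by_contra hc
          exact hnoP (Or.inr (Or.inr (Or.inr (Or.inr (Or.inr (Or.inr (Or.inl ⟨h, not_lt.1 hc⟩)))))))
        exact exists_fill H.dyadic₁ hRd H.dyadic₂ hRd h h2
    have hj1 : f R = (1 : ℝ ≃o ℝ) R := by simpa using hfR
    have hj2 : h₀ P.1 = splice R f 1 hj1 P.1 := by rw [splice_of_le H.mem₁.2, hfp, hp₀]
    refine ⟨splice P.1 h₀ (splice R f 1 hj1) hj2, IsLPL.splice hj2 H.dyadic₁ hl₀
      (IsLPL.splice hj1 hRd hf IsLPL.one), fun x hx => ?_, fun x hx => ?_, fun i x => ?_⟩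
    · rw [splice_of_le (hx.trans H.mem₁.1), hL₀ x hx]
    · rw [splice_of_ge (H.mem₁.2.trans hx), splice_of_ge hx]; rfl
    · rcases le_total x P.1 with hxp | hxp
      · rw [splice_of_le hxp, splice_of_le, hc₀ i x hxp]
        rw [← H.fix₁ i]; exact (A i).monotone hxp
      · rw [hmA i x hxp, hmB]
        refine le_trans ?_ ((splice P.1 h₀ (splice R f 1 hj1) hj2).monotone hxp)
        rw [splice_of_le le_rfl, hp₀]

/-- A conjugacy exists if no contradiction can be deduced. -/
theorem exists_isSol [Finite ι] (hA : IsFam A L R) (hB : IsFam B L R) (hLR : L < R)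
    (hLd : IsDyadic L) (hRd : IsDyadic R) (hno : ¬ Refuted (fns A) (fns B) L R) :
    ∃ g, IsSol A B L R g := by
  by_contra hsol
  have hstep : ∀ P, PartialSol A B L R P → ∃ Q, PartialSol A B L R Q ∧ P.1 < Q.1 ∧
      ∀ x, P.1 ≤ x → (∀ i, ∀ y ∈ Icc P.1 x, A i y = y) → x ≤ Q.1 := fun P hP =>
    (hP.step hA hB hRd hno).resolve_left hsol
  have hinit : PartialSol A B L R (L, L) :=
    ⟨.refl, hLd, hLd, ⟨le_rfl, hLR.le⟩, ⟨le_rfl, hLR.le⟩, fun i => hA.left i L le_rfl,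
      fun i => hB.left i L le_rfl, 1, IsLPL.one, fun _ _ => rfl, rfl, fun i x hx => by
        simp [hA.left i x hx, hB.left i x hx]⟩
  -- the supremum `σ` of the points reached by partial conjugacies leads to a contradiction
  set S := {p | ∃ q, PartialSol A B L R (p, q)} with hS
  have hLS : L ∈ S := ⟨L, hinit⟩
  have hSb : BddAbove S := ⟨R, fun p ⟨q, h⟩ => h.mem₁.2⟩
  set σ := sSup S with hσ
  have hle : ∀ {P}, PartialSol A B L R P → P.1 ≤ σ := fun {P} h => le_csSup hSb ⟨P.2, h⟩
  have hlt : ∀ {P}, PartialSol A B L R P → P.1 < σ := fun {P} h => by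
    obtain ⟨Q, hQ, h1, -⟩ := hstep P h
    exact h1.trans_le (hle hQ)
  have hfixσ : ∀ i, A i σ = σ := by
    intro i
    have hc : IsClosed {x | A i x = x} := isClosed_eq (A i).continuous continuous_id
    have h1 : S ⊆ {x | A i x = x} := fun p ⟨q, h⟩ => h.fix₁ i
    exact closure_minimal h1 hc (csSup_mem_closure ⟨L, hLS⟩ hSb)
  -- near `σ`, all maps are the identity on the left
  have hev : ∀ i, ∃ u < σ, ∀ y ∈ Icc u σ, A i y = y := by
    intro i
    obtain ⟨u, hu, e, he⟩ := (hA.lpl i).left σ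
    obtain ⟨p, ⟨q, hp⟩, hup⟩ := exists_lt_of_lt_csSup ⟨L, hLS⟩ hu
    have hpσ : p < σ := hlt hp
    have h1 := he σ ⟨hu.le, le_rfl⟩ p ⟨hup.le, hpσ.le⟩
    have h2 : A i p = p := hp.fix₁ i
    rw [h2, hfixσ] at h1
    have he0 : (2 : ℝ) ^ e = 1 := mul_right_cancel₀ (sub_neg.2 hpσ).ne (by linarith)
    refine ⟨u, hu, fun y hy => ?_⟩
    rw [he σ ⟨hu.le, le_rfl⟩ y hy, he0, hfixσ]
    ring
  choose u hu hfix using hev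
  have hall : ∀ᶠ y in 𝓝[<] σ, ∀ i, u i < y :=
    eventually_all.2 fun i => Filter.mem_of_superset (Ioo_mem_nhdsLT (hu i)) fun y hy => hy.1
  obtain ⟨w, hw, hsub⟩ := (mem_nhdsLT_iff_exists_Ioo_subset' (sub_one_lt σ)).1 hall
  -- a partial conjugacy up to a point close to `σ` extends past the interval of common fixed points
  obtain ⟨p, ⟨q, hp⟩, hwp⟩ := exists_lt_of_lt_csSup ⟨L, hLS⟩ (show w < sSup S from hw)
  obtain ⟨Q, hQ, -, h2⟩ := hstep _ hp
  have hpσ : p < σ := hlt hp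
  exact absurd (h2 σ hpσ.le fun i y hy =>
    hfix i y ⟨(hsub ⟨hwp, hpσ⟩ i).le.trans hy.1, hy.2⟩) (not_le.2 (hlt hQ))

end Complete

end ThompsonPL

namespace ThompsonPL

open Set Filter Topology Relation Encodable Denumerable

/-! ### Primitive recursive arithmetic of integers -/

section Primrec

variable {α β γ δ : Type} [Primcodable α] [Primcodable β] [Primcodable γ] [Primcodable δ]

attribute [fun_prop] Primrec
attribute [fun_prop] Primrec.id Primrec.const Primrec.comp Primrec.pair

@[fun_prop]
theorem primrec_fst {f : α → β × γ} (h : Primrec f) : Primrec fun a => (f a).1 :=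
  Primrec.fst.comp h

@[fun_prop]
theorem primrec_snd {f : α → β × γ} (h : Primrec f) : Primrec fun a => (f a).2 :=
  Primrec.snd.comp h

@[fun_prop]
theorem primrec_nat_add {f g : α → ℕ} (hf : Primrec f) (hg : Primrec g) :
    Primrec fun a => f a + g a := Primrec.nat_add.comp hf hg

@[fun_prop]
theorem primrec_nat_sub {f g : α → ℕ} (hf : Primrec f) (hg : Primrec g) :
    Primrec fun a => f a - g a := Primrec.nat_sub.comp hf hg

@[fun_prop]
theorem primrec_nat_mul {f g : α → ℕ} (hf : Primrec f) (hg : Primrec g) :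
    Primrec fun a => f a * g a := Primrec.nat_mul.comp hf hg

@[fun_prop]
theorem primrec_nat_mod {f g : α → ℕ} (hf : Primrec f) (hg : Primrec g) :
    Primrec fun a => f a % g a := Primrec.nat_mod.comp hf hg

@[fun_prop]
theorem primrec_nat_div {f g : α → ℕ} (hf : Primrec f) (hg : Primrec g) :
    Primrec fun a => f a / g a := Primrec.nat_div.comp hf hg

@[fun_prop]
theorem primrec_nat_pow {f g : α → ℕ} (hf : Primrec f) (hg : Primrec g) :
    Primrec fun a => f a ^ g a :=
  (Primrec₂.unpaired'.1 Nat.Primrec.pow).comp hf hg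

theorem primrecPred_eq {f g : α → β} (hf : Primrec f) (hg : Primrec g) :
    PrimrecPred fun a => f a = g a := Primrec.eq.comp hf hg

theorem primrecPred_nat_le {f g : α → ℕ} (hf : Primrec f) (hg : Primrec g) :
    PrimrecPred fun a => f a ≤ g a := Primrec.nat_le.comp hf hg

/-- The integers with the codes `0, 1, 2, 3, 4, …` are `0, -1, 1, -2, 2, …`. -/
theorem encode_int (z : ℤ) :
    encode z = if 0 ≤ z then 2 * z.toNat else 2 * ((-z).toNat - 1) + 1 := by
  obtain n | n := z
  · rfl
  · rfl

theorem primrec_toNat : Primrec Int.toNat := by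
  have h : Primrec fun z : ℤ => if encode z % 2 = 0 then encode z / 2 else 0 :=
    Primrec.ite (primrecPred_eq ((by fun_prop : Primrec fun n : ℕ => n % 2).comp Primrec.encode)
      (.const 0)) ((by fun_prop : Primrec fun n : ℕ => n / 2).comp Primrec.encode) (.const 0)
  refine h.of_eq fun z => ?_
  rw [encode_int]
  split_ifs <;> omega

theorem primrec_neg_toNat : Primrec fun z : ℤ => (-z).toNat := by
  have h : Primrec fun z : ℤ => if encode z % 2 = 0 then 0 else encode z / 2 + 1 :=
    Primrec.ite (primrecPred_eq ((by fun_prop : Primrec fun n : ℕ => n % 2).comp Primrec.encode)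
      (.const 0)) (.const 0) ((by fun_prop : Primrec fun n : ℕ => n / 2 + 1).comp Primrec.encode)
  refine h.of_eq fun z => ?_
  rw [encode_int]
  split_ifs <;> omega

theorem primrec_intSub : Primrec fun p : ℕ × ℕ => (p.1 : ℤ) - p.2 := by
  have h : Primrec fun p : ℕ × ℕ =>
      if p.2 ≤ p.1 then 2 * (p.1 - p.2) else 2 * (p.2 - p.1 - 1) + 1 :=
    Primrec.ite (primrecPred_nat_le (by fun_prop) (by fun_prop)) (by fun_prop) (by fun_prop)
  refine (Primrec.encode_iff.1 (h.of_eq fun p => ?_))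
  rw [encode_int]
  split_ifs <;> omega

/-- An integer function is primitive recursive if it is a difference of two primitive recursive
functions with values in the natural numbers. -/
theorem primrec_of_parts {p q : α → ℕ} {f : α → ℤ} (hp : Primrec p) (hq : Primrec q)
    (h : ∀ a, f a = p a - q a) : Primrec f :=
  (primrec_intSub.comp (hp.pair hq)).of_eq fun a => (h a).symm

@[fun_prop]
theorem primrec_int_toNat {f : α → ℤ} (hf : Primrec f) : Primrec fun a => (f a).toNat :=
  primrec_toNat.comp hf

@[fun_prop]
theorem primrec_int_neg {f : α → ℤ} (hf : Primrec f) : Primrec fun a => -f a :=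
  primrec_of_parts (primrec_neg_toNat.comp hf) (primrec_toNat.comp hf) fun a => by omega

@[fun_prop]
theorem primrec_intCast {f : α → ℕ} (hf : Primrec f) : Primrec fun a => (f a : ℤ) :=
  primrec_of_parts hf (.const 0) fun a => by simp

@[fun_prop]
theorem primrec_int_add {f g : α → ℤ} (hf : Primrec f) (hg : Primrec g) :
    Primrec fun a => f a + g a :=
  primrec_of_parts (p := fun a => (f a).toNat + (g a).toNat)
    (q := fun a => (-f a).toNat + (-g a).toNat) (by fun_prop) (by fun_prop) fun a => by
      push_cast; omega

@[fun_prop]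
theorem primrec_int_sub {f g : α → ℤ} (hf : Primrec f) (hg : Primrec g) :
    Primrec fun a => f a - g a := by
  simp only [sub_eq_add_neg]
  fun_prop

@[fun_prop]
theorem primrec_int_mul {f g : α → ℤ} (hf : Primrec f) (hg : Primrec g) :
    Primrec fun a => f a * g a :=
  primrec_of_parts (p := fun a => (f a).toNat * (g a).toNat + (-f a).toNat * (-g a).toNat)
    (q := fun a => (f a).toNat * (-g a).toNat + (-f a).toNat * (g a).toNat)
    (by fun_prop) (by fun_prop) fun a => by
      have h1 : f a = (f a).toNat - (-f a).toNat := by omega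
      have h2 : g a = (g a).toNat - (-g a).toNat := by omega
      conv_lhs => rw [h1, h2]
      push_cast
      ring

@[fun_prop]
theorem primrec_int_natAbs {f : α → ℤ} (hf : Primrec f) : Primrec fun a => (f a).natAbs := by
  have : Primrec fun a => (f a).toNat + (-f a).toNat := by fun_prop
  exact this.of_eq fun a => by omega

theorem primrecPred_int_le {f g : α → ℤ} (hf : Primrec f) (hg : Primrec g) :
    PrimrecPred fun a => f a ≤ g a := by
  have : PrimrecPred fun a => (f a - g a).toNat = 0 := primrecPred_eq (by fun_prop) (by fun_prop)
  exact this.of_eq fun a => by omega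

theorem primrecPred_int_lt {f g : α → ℤ} (hf : Primrec f) (hg : Primrec g) :
    PrimrecPred fun a => f a < g a := (primrecPred_int_le hg hf).not.of_eq fun _ => not_le

end Primrec

/-! ### Semidecidable predicates -/

section Sig

variable {α β γ δ : Type} [Primcodable α] [Primcodable β] [Primcodable γ] [Primcodable δ]

/-- `P` is defined by an existential quantifier over the natural numbers, followed by a primitive
recursive condition. -/
def Sig1 (P : α → Prop) : Prop :=
  ∃ D : α × ℕ → Prop, PrimrecPred D ∧ ∀ a, P a ↔ ∃ n, D (a, n)

theorem Sig1.of_primrec {P : α → Prop} (h : PrimrecPred P) : Sig1 P :=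
  ⟨fun p => P p.1, h.comp Primrec.fst, fun a => by simp⟩

theorem Sig1.of_iff {P Q : α → Prop} (h : Sig1 P) (H : ∀ a, Q a ↔ P a) : Sig1 Q := by
  obtain ⟨D, hD, h⟩ := h
  exact ⟨D, hD, fun a => (H a).trans (h a)⟩

theorem Sig1.comp {P : α → Prop} (h : Sig1 P) {f : β → α} (hf : Primrec f) :
    Sig1 fun b => P (f b) := by
  obtain ⟨D, hD, h⟩ := h
  exact ⟨fun p => D (f p.1, p.2), hD.comp (by fun_prop), fun b => h _⟩

theorem Sig1.and {P Q : α → Prop} (hP : Sig1 P) (hQ : Sig1 Q) : Sig1 fun a => P a ∧ Q a := by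
  obtain ⟨D, hD, h⟩ := hP
  obtain ⟨D', hD', h'⟩ := hQ
  refine ⟨fun p => D (p.1, p.2.unpair.1) ∧ D' (p.1, p.2.unpair.2), (hD.comp ?_).and (hD'.comp ?_),
    fun a => ?_⟩
  · exact Primrec.fst.pair (Primrec.fst.comp (Primrec.unpair.comp Primrec.snd))
  · exact Primrec.fst.pair (Primrec.snd.comp (Primrec.unpair.comp Primrec.snd))
  · simp only [h, h']
    constructor
    · rintro ⟨⟨n, hn⟩, m, hm⟩
      exact ⟨Nat.pair n m, by simpa using ⟨hn, hm⟩⟩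
    · rintro ⟨n, h1, h2⟩
      exact ⟨⟨_, h1⟩, _, h2⟩

theorem Sig1.or {P Q : α → Prop} (hP : Sig1 P) (hQ : Sig1 Q) : Sig1 fun a => P a ∨ Q a := by
  obtain ⟨D, hD, h⟩ := hP
  obtain ⟨D', hD', h'⟩ := hQ
  exact ⟨fun p => D p ∨ D' p, hD.or hD', fun a => by simp only [h, h', exists_or]⟩

/-- Two existential quantifiers are contracted into one by pairing. -/
theorem Sig1.exists {P : α → β → Prop} (hP : Sig1 fun p : α × β => P p.1 p.2) :
    Sig1 fun a => ∃ b, P a b := by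
  obtain ⟨D, hD, h⟩ := hP
  obtain ⟨hdec, hD⟩ := hD
  refine ⟨fun p => ((decode p.2.unpair.1 : Option β).elim false
    fun b => decide (D ((p.1, b), p.2.unpair.2))) = true, ?_, fun a => ?_⟩
  · refine primrecPred_eq ?_ (.const true)
    have h1 : Primrec fun p : α × ℕ => (decode p.2.unpair.1 : Option β) :=
      Primrec.decode.comp (Primrec.fst.comp (Primrec.unpair.comp Primrec.snd))
    have h2 : Primrec fun p : (α × ℕ) × β => decide (D ((p.1.1, p.2), p.1.2.unpair.2)) :=
      hD.comp (((Primrec.fst.comp Primrec.fst).pair Primrec.snd).pair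
        (Primrec.snd.comp (Primrec.unpair.comp (Primrec.snd.comp Primrec.fst))))
    refine (Primrec.option_casesOn h1 (.const false) h2.to₂).of_eq fun p => ?_
    cases (decode p.2.unpair.1 : Option β) <;> rfl
  · constructor
    · rintro ⟨b, hb⟩
      obtain ⟨n, hn⟩ := (h (a, b)).1 hb
      exact ⟨Nat.pair (encode b) n, by simpa using hn⟩
    · rintro ⟨n, hn⟩
      dsimp only at hn
      cases hb : (decode n.unpair.1 : Option β) with
      | none => rw [hb] at hn; cases hn
      | some b =>
        rw [hb] at hn
        exact ⟨b, (h (a, b)).2 ⟨_, of_decide_eq_true hn⟩⟩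

/-- The witnesses for the members of a finite list have a common bound. -/
theorem Sig1.forall_mem {P : α → β → Prop} (hP : Sig1 fun p : α × β => P p.1 p.2)
    {l : α → List β} (hl : Primrec l) : Sig1 fun a => ∀ b ∈ l a, P a b := by
  obtain ⟨D, hD, h⟩ := hP
  have h1 : PrimrecRel fun (n : List ℕ) (p : α × β) => ∃ m ∈ n, D (p, m) :=
    PrimrecRel.exists_mem_list (R := fun m p => D (p, m)) (hD.comp (Primrec.snd.pair Primrec.fst))
  have h2 : PrimrecRel fun (b : β) (p : α × ℕ) => ∃ m < p.2, D ((p.1, b), m) :=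
    (h1.comp (f := fun q : β × (α × ℕ) => List.range q.2.2) (g := fun q => (q.2.1, q.1))
      (Primrec.list_range.comp (by fun_prop)) (by fun_prop)).of_eq fun q => by simp
  refine ⟨fun p => ∀ b ∈ l p.1, ∃ m < p.2, D ((p.1, b), m),
    h2.forall_mem_list.comp (hl.comp Primrec.fst) Primrec.id, fun a => ?_⟩
  constructor
  · intro H
    choose! f hf using fun b hb => (h (a, b)).1 (H b hb)
    refine ⟨((l a).map f).sum + 1, fun b hb => ⟨f b, ?_, hf b hb⟩⟩
    exact Nat.lt_succ_of_le (List.le_sum_of_mem (List.mem_map_of_mem hb))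
  · rintro ⟨n, H⟩ b hb
    obtain ⟨m, -, hm⟩ := H b hb
    exact (h (a, b)).2 ⟨m, hm⟩

theorem primrecPred_mem {f : α → β} {l : α → List β} (hf : Primrec f) (hl : Primrec l) :
    PrimrecPred fun a => f a ∈ l a :=
  ((Primrec.eq (α := β)).exists_mem_list.comp hl hf).of_eq fun a => by simp

theorem Sig1.exists_mem {P : α → β → Prop} (hP : Sig1 fun p : α × β => P p.1 p.2)
    {l : α → List β} (hl : Primrec l) : Sig1 fun a => ∃ b ∈ l a, P a b :=
  ((Sig1.of_primrec (primrecPred_mem (f := Prod.snd) (l := fun p : α × β => l p.1)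
    Primrec.snd (hl.comp Primrec.fst))).and hP).exists

theorem Sig1.forall_lt {P : α → ℕ → Prop} (hP : Sig1 fun p : α × ℕ => P p.1 p.2)
    {n : α → ℕ} (hn : Primrec n) : Sig1 fun a => ∀ m < n a, P a m :=
  (hP.forall_mem (Primrec.list_range.comp hn)).of_iff fun a => by simp

theorem Sig1.rePred {P : α → Prop} (hP : Sig1 P) : REPred P := by
  obtain ⟨D, ⟨_, hD⟩, h⟩ := hP
  have h1 : Partrec fun a => Nat.rfind fun n => Part.some (decide (D (a, n))) :=
    Partrec.rfind (hD.to_comp.partrec.to₂)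
  refine h1.dom_re.of_eq fun a => ?_
  refine Nat.rfind_dom.trans (Iff.trans ?_ (h a).symm)
  constructor
  · rintro ⟨n, hn, -⟩
    exact ⟨n, by simpa using hn⟩
  · rintro ⟨n, hn⟩
    exact ⟨n, by simpa using hn, fun _ => trivial⟩

/-- Reachability for a semidecidable relation is semidecidable: the points of a path, and the
witnesses for its steps, form a list. -/
theorem Sig1.reflTransGen {R : α → β → β → Prop}
    (hR : Sig1 fun p : α × β × β => R p.1 p.2.1 p.2.2) {f g : α → β} (hf : Primrec f)
    (hg : Primrec g) : Sig1 fun a => ReflTransGen (R a) (f a) (g a) := by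
  obtain ⟨D, ⟨_, hD⟩, h⟩ := hR
  set step : α → Option β × (β × ℕ) → Option β := fun a s => s.1.bind fun b =>
    bif decide (D ((a, b, s.2.1), s.2.2)) then some s.2.1 else none with hstep
  have hs : Primrec₂ step := by
    refine Primrec.option_bind (by fun_prop : Primrec fun p : α × Option β × (β × ℕ) => p.2.1)
      (Primrec.cond ?_ ?_ (.const none))
    · exact hD.comp (g := fun q : (α × Option β × (β × ℕ)) × β =>
        (((q.1.1, q.2, q.1.2.2.1), q.1.2.2.2) : (α × β × β) × ℕ)) (by fun_prop)
    · exact Primrec.option_some.comp (by fun_prop)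
  set run : α → Option β → List (β × ℕ) → Option β := fun a s l =>
    l.foldl (fun s e => step a (s, e)) s with hrun
  have hrunp : Primrec fun p : α × List (β × ℕ) => run p.1 (some (f p.1)) p.2 :=
    Primrec.list_foldl Primrec.snd (Primrec.option_some.comp (hf.comp Primrec.fst))
      (hs.comp (by fun_prop : Primrec fun q : (α × List (β × ℕ)) × Option β × (β × ℕ) => q.1.1)
        (by fun_prop))
  have key : Sig1 fun a => ∃ l : List (β × ℕ), run a (some (f a)) l = some (g a) :=
    (Sig1.of_primrec
      (primrecPred_eq hrunp (Primrec.option_some.comp (hg.comp Primrec.fst)))).exists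
  have hnone : ∀ a l, run a none l = none := by
    intro a l
    induction l with
    | nil => rfl
    | cons e l ih => exact ih
  refine key.of_iff fun a => ?_
  constructor
  · generalize f a = b
    intro H
    induction H using ReflTransGen.head_induction_on with
    | refl => exact ⟨[], rfl⟩
    | @head b c hbc _ ih =>
      obtain ⟨l, hl⟩ := ih
      obtain ⟨n, hn⟩ := (h (a, b, c)).1 hbc
      refine ⟨(c, n) :: l, ?_⟩
      rw [← hl]
      change run a (step a (some b, c, n)) l = _
      congr 1
      simp [hstep, hn]
  · rintro ⟨l, hl⟩
    generalize f a = b at hl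
    induction l generalizing b with
    | nil =>
      have : b = g a := by simpa [hrun] using hl
      rw [this]
    | cons e l ih =>
      change run a (step a (some b, e)) l = _ at hl
      by_cases hD : D ((a, b, e.1), e.2)
      · have h1 : step a (some b, e) = some e.1 := by simp [hstep, hD]
        rw [h1] at hl
        exact .head ((h (a, b, e.1)).2 ⟨e.2, hD⟩) (ih _ hl)
      · have h1 : step a (some b, e) = none := by simp [hstep, hD]
        rw [h1, hnone] at hl
        cases hl

end Sig

end ThompsonPL

namespace ThompsonPL

open Set Filter Topology Relation Encodable Denumerable

/-! ### Computable dyadic numbers -/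

theorem isDyadic_val (d : DyadicCode) : IsDyadic d.val := ⟨d.1, d.2, rfl⟩

theorem isDyadic_iff_exists_val {x : ℝ} : IsDyadic x ↔ ∃ d : DyadicCode, d.val = x :=
  ⟨fun ⟨m, n, h⟩ => ⟨(m, n), h.symm⟩, fun ⟨d, h⟩ => h ▸ isDyadic_val d⟩

theorem isDyadic_zpow_mul_iff {e : ℤ} {x : ℝ} : IsDyadic (2 ^ e * x) ↔ IsDyadic x := by
  simpa using isDyadic_affine_iff (y := x) IsDyadic.zero IsDyadic.zero e

theorem isDyadic_intCast_div_iff {m : ℤ} {q : ℕ} (hq : Odd q) :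
    IsDyadic ((m : ℝ) / q) ↔ (q : ℤ) ∣ m := by
  have hq0 : (q : ℝ) ≠ 0 := Nat.cast_ne_zero.2 (by rintro rfl; simp at hq)
  constructor
  · rintro ⟨k, n, h⟩
    have h1 : (m * 2 ^ n : ℤ) = k * q := by
      rw [div_eq_div_iff hq0 (by positivity)] at h
      exact_mod_cast h
    have h2 : IsCoprime (q : ℤ) (2 ^ n) := by
      refine IsCoprime.pow_right ?_
      exact_mod_cast Nat.isCoprime_iff_coprime.2 (Nat.coprime_two_right.2 hq)
    exact h2.dvd_of_dvd_mul_right (h1 ▸ dvd_mul_left _ _)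
  · rintro ⟨k, rfl⟩
    have : ((q * k : ℤ) : ℝ) / q = k := by push_cast; field_simp
    rw [this]
    exact .intCast k

/-- The fixed point of an affine map of slope `2 ^ s` that moves some dyadic number by
`d.val` is dyadic exactly when the numerator of `d.val` is divisible by `2 ^ |s| - 1`. For `s = 0`,
the left side is `IsDyadic 0`. -/
theorem isDyadic_val_div_iff (d : DyadicCode) (s : ℤ) :
    IsDyadic (d.val / (1 - 2 ^ s)) ↔ s = 0 ∨ d.1.natAbs % (2 ^ s.natAbs - 1) = 0 := by
  have hodd : ∀ k : ℕ, k ≠ 0 → Odd (2 ^ k - 1) := fun k hk =>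
    Nat.Even.sub_odd Nat.one_le_two_pow (by simpa [Nat.even_pow] using hk) odd_one
  have hcast : ∀ k : ℕ, ((2 ^ k - 1 : ℕ) : ℝ) = 2 ^ k - 1 := fun k => by
    rw [Nat.cast_sub Nat.one_le_two_pow]; simp
  have hne : ∀ k : ℕ, k ≠ 0 → (2 : ℝ) ^ k - 1 ≠ 0 := fun k hk => by
    have : (1 : ℝ) < 2 ^ k := one_lt_pow₀ (by norm_num) hk
    linarith
  have hdvd : ∀ k : ℕ, k ≠ 0 → (IsDyadic ((d.1 : ℝ) / (2 ^ k - 1)) ↔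
      d.1.natAbs % (2 ^ k - 1) = 0) := fun k hk => by
    rw [← hcast, isDyadic_intCast_div_iff (hodd k hk), ← Nat.dvd_iff_mod_eq_zero, Int.natCast_dvd]
  have hval : d.val = 2 ^ (-d.2 : ℤ) * d.1 := by
    rw [DyadicCode.val, zpow_neg, zpow_natCast]; field_simp
  obtain ⟨k, rfl | rfl⟩ := s.eq_nat_or_neg
  · rcases eq_or_ne k 0 with rfl | hk
    · simpa using IsDyadic.zero
    · have h1 : d.val / (1 - 2 ^ (k : ℤ)) = -(2 ^ (-d.2 : ℤ) * ((d.1 : ℝ) / (2 ^ k - 1))) := by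
        have := hne k hk
        have h3 : (1 : ℝ) - 2 ^ k ≠ 0 := fun h => this (by linarith)
        rw [hval, zpow_natCast]; field_simp; ring
      rw [h1, isDyadic_neg, isDyadic_zpow_mul_iff, hdvd k hk]
      simp [hk]
  · rcases eq_or_ne k 0 with rfl | hk
    · simpa using IsDyadic.zero
    · have h1 : d.val / (1 - 2 ^ (-k : ℤ)) = 2 ^ (k - d.2 : ℤ) * ((d.1 : ℝ) / (2 ^ k - 1)) := by
        have h2 : (1 : ℝ) - 2 ^ (-k : ℤ) = (2 ^ k - 1) / 2 ^ k := by
          rw [zpow_neg, zpow_natCast]; field_simp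
        rw [h2, hval, zpow_sub₀ two_ne_zero, zpow_neg, zpow_natCast, zpow_natCast]
        field_simp
      rw [h1, isDyadic_zpow_mul_iff, hdvd k hk]
      simp [hk]

section PrimDyadic

variable {α β : Type} [Primcodable α] [Primcodable β]

/-- A dyadic number that depends on a parameter has a code that is primitive recursive in the
parameter. -/
@[fun_prop]
def PrimDyadic (f : α → ℝ) : Prop :=
  ∃ c : α → DyadicCode, Primrec c ∧ ∀ a, f a = (c a).val

@[fun_prop]
theorem PrimDyadic.val {c : α → DyadicCode} (hc : Primrec c) : PrimDyadic fun a => (c a).val :=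
  ⟨c, hc, fun _ => rfl⟩

@[fun_prop]
theorem PrimDyadic.comp {f : α → ℝ} (hf : PrimDyadic f) {g : β → α} (hg : Primrec g) :
    PrimDyadic fun b => f (g b) := by
  obtain ⟨c, hc, h⟩ := hf
  exact ⟨fun b => c (g b), hc.comp hg, fun b => h _⟩

@[fun_prop]
theorem PrimDyadic.zpow_mul {e : α → ℤ} {f : α → ℝ} (he : Primrec e) (hf : PrimDyadic f) :
    PrimDyadic fun a => 2 ^ e a * f a := by
  obtain ⟨c, hc, h⟩ := hf
  refine ⟨fun a => ((c a).1 * ((2 ^ (e a).toNat : ℕ) : ℤ), (c a).2 + (-e a).toNat), by fun_prop,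
    fun a => ?_⟩
  have h1 : e a = (e a).toNat - (-e a).toNat := by omega
  simp only [h, DyadicCode.val]
  conv_lhs => rw [h1]
  rw [sub_eq_add_neg, zpow_add₀ two_ne_zero, zpow_neg, zpow_natCast, zpow_natCast, pow_add]
  push_cast
  field_simp

@[fun_prop]
theorem PrimDyadic.add {f g : α → ℝ} (hf : PrimDyadic f) (hg : PrimDyadic g) :
    PrimDyadic fun a => f a + g a := by
  obtain ⟨c, hc, h⟩ := hf
  obtain ⟨c', hc', h'⟩ := hg
  refine ⟨fun a => ((c a).1 * ((2 ^ (c' a).2 : ℕ) : ℤ) + (c' a).1 * ((2 ^ (c a).2 : ℕ) : ℤ),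
    (c a).2 + (c' a).2), by fun_prop, fun a => ?_⟩
  simp only [h, h', DyadicCode.val, pow_add]
  push_cast
  field_simp

@[fun_prop]
theorem PrimDyadic.neg {f : α → ℝ} (hf : PrimDyadic f) : PrimDyadic fun a => -f a := by
  obtain ⟨c, hc, h⟩ := hf
  refine ⟨fun a => (-(c a).1, (c a).2), by fun_prop, fun a => ?_⟩
  simp only [h, DyadicCode.val]
  push_cast
  ring

@[fun_prop]
theorem PrimDyadic.sub {f g : α → ℝ} (hf : PrimDyadic f) (hg : PrimDyadic g) :
    PrimDyadic fun a => f a - g a := by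
  simp only [sub_eq_add_neg]
  exact hf.add hg.neg

@[fun_prop]
theorem PrimDyadic.zero : PrimDyadic fun _ : α => 0 :=
  ⟨fun _ => (0, 0), .const _, fun a => by simp [DyadicCode.val]⟩

theorem PrimDyadic.le {f g : α → ℝ} (hf : PrimDyadic f) (hg : PrimDyadic g) :
    PrimrecPred fun a => f a ≤ g a := by
  obtain ⟨c, hc, h⟩ := hf.sub hg
  refine (primrecPred_int_le (f := fun a => (c a).1) (by fun_prop) (.const 0)).of_eq fun a => ?_
  have h1 : f a - g a = (c a).val := h a
  rw [← sub_nonpos (b := g a), h1, DyadicCode.val, div_le_iff₀ (by positivity)]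
  simp

theorem PrimDyadic.lt {f g : α → ℝ} (hf : PrimDyadic f) (hg : PrimDyadic g) :
    PrimrecPred fun a => f a < g a := (hg.le hf).not.of_eq fun _ => not_le

theorem PrimDyadic.eq {f g : α → ℝ} (hf : PrimDyadic f) (hg : PrimDyadic g) :
    PrimrecPred fun a => f a = g a :=
  ((hf.le hg).and (hg.le hf)).of_eq fun _ => le_antisymm_iff.symm

theorem PrimDyadic.ne {f g : α → ℝ} (hf : PrimDyadic f) (hg : PrimDyadic g) :
    PrimrecPred fun a => f a ≠ g a := (hf.eq hg).not

theorem PrimDyadic.ite {p : α → Prop} [DecidablePred p] {f g : α → ℝ} (hp : PrimrecPred p)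
    (hf : PrimDyadic f) (hg : PrimDyadic g) : PrimDyadic fun a => if p a then f a else g a := by
  obtain ⟨c, hc, h⟩ := hf
  obtain ⟨c', hc', h'⟩ := hg
  refine ⟨fun a => if p a then c a else c' a, Primrec.ite hp hc hc', fun a => ?_⟩
  dsimp only
  split_ifs
  · exact h a
  · exact h' a

@[fun_prop]
theorem PrimDyadic.abs {f : α → ℝ} (hf : PrimDyadic f) : PrimDyadic fun a => |f a| := by
  classical
  have := PrimDyadic.ite (hf.le .zero) hf.neg hf
  convert this using 2 with a
  split_ifs with h
  · exact abs_of_nonpos h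
  · exact abs_of_pos (not_le.1 h)

/-- It is decidable whether the fixed point of an affine map is dyadic. For `s a = 0`, the division
is by zero, and the sum is the dyadic number `f a`. -/
theorem PrimDyadic.isDyadic_fix {f g : α → ℝ} {s : α → ℤ} (hf : PrimDyadic f) (hg : PrimDyadic g)
    (hs : Primrec s) : PrimrecPred fun a => IsDyadic (f a + g a / (1 - 2 ^ s a)) := by
  obtain ⟨c, hc, h⟩ := hf
  obtain ⟨c', hc', h'⟩ := hg
  refine ((primrecPred_eq hs (.const 0)).or (primrecPred_eq
    (f := fun a => (c' a).1.natAbs % (2 ^ (s a).natAbs - 1)) (by fun_prop) (.const 0))).of_eq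
    fun a => ?_
  rw [← isDyadic_val_div_iff, ← h', h]
  have hd := isDyadic_val (c a)
  refine ⟨fun h => hd.add h, fun h => ?_⟩
  simpa using h.sub hd

theorem Sig1.exists_dyadic {P : α → ℝ → Prop} (h : Sig1 fun p : α × DyadicCode => P p.1 p.2.val) :
    Sig1 fun a => ∃ x, IsDyadic x ∧ P a x :=
  h.exists.of_iff fun a => by
    simp only [isDyadic_iff_exists_val]
    constructor
    · rintro ⟨_, ⟨d, rfl⟩, hd⟩
      exact ⟨d, hd⟩
    · rintro ⟨d, hd⟩
      exact ⟨_, ⟨d, rfl⟩, hd⟩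

/-- Reachability among coded points, for a relation that does not depend on the choice of
codes. -/
theorem Sig1.reflTransGen_of_coded {C X : Type} [Primcodable C] {v : C → X} {R : α → X → X → Prop}
    (hv : PrimrecPred fun p : C × C => v p.1 = v p.2)
    (hR : Sig1 fun p : α × C × C => R p.1 (v p.2.1) (v p.2.2))
    (hd : ∀ a x y, R a x y → ∃ c, v c = y) {f g : α → C} (hf : Primrec f) (hg : Primrec g) :
    Sig1 fun a => ReflTransGen (R a) (v (f a)) (v (g a)) := by
  have h2 : Sig1 fun a => ∃ c, ReflTransGen (fun c c' => R a (v c) (v c')) (f a) c ∧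
      v c = v (g a) := by
    refine Sig1.exists (P := fun a c => ReflTransGen (fun c c' => R a (v c) (v c')) (f a) c ∧
      v c = v (g a)) (.and ?_ (.of_primrec (hv.comp (f := fun p : α × C =>
        (p.2, g p.1)) (by fun_prop))))
    exact Sig1.reflTransGen (R := fun (p : α × C) c c' => R p.1 (v c) (v c'))
      (hR.comp (by fun_prop : Primrec fun q : (α × C) × C × C => (q.1.1, q.2)))
      (by fun_prop) (by fun_prop)
  refine h2.of_iff fun a => ?_
  constructor
  · generalize v (g a) = y
    intro H
    induction H with
    | refl => exact ⟨_, .refl, rfl⟩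
    | tail _ h ih =>
      obtain ⟨c, hc, rfl⟩ := ih
      obtain ⟨c', rfl⟩ := hd _ _ _ h
      exact ⟨c', hc.tail h, rfl⟩
  · rintro ⟨c, hc, h⟩
    rw [← h]
    exact hc.lift v fun _ _ => id

theorem Sig1.reflTransGen_dyadic {R : α → ℝ → ℝ → Prop}
    (hR : Sig1 fun p : α × DyadicCode × DyadicCode => R p.1 p.2.1.val p.2.2.val)
    (hd : ∀ a x y, R a x y → IsDyadic y) {f g : α → ℝ} (hf : PrimDyadic f) (hg : PrimDyadic g) :
    Sig1 fun a => ReflTransGen (R a) (f a) (g a) := by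
  obtain ⟨c, hc, h⟩ := hf
  obtain ⟨c', hc', h'⟩ := hg
  simp only [h, h']
  exact Sig1.reflTransGen_of_coded (v := DyadicCode.val)
    (PrimDyadic.eq (by fun_prop) (by fun_prop)) hR
    (fun a x y hxy => isDyadic_iff_exists_val.1 (hd a x y hxy)) hc hc'

theorem Sig1.reflTransGen_dyadic_prod {R : α → ℝ × ℝ → ℝ × ℝ → Prop}
    (hR : Sig1 fun p : α × (DyadicCode × DyadicCode) × (DyadicCode × DyadicCode) =>
      R p.1 (p.2.1.1.val, p.2.1.2.val) (p.2.2.1.val, p.2.2.2.val))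
    (hd : ∀ a x y, R a x y → IsDyadic y.1 ∧ IsDyadic y.2) {f g : α → ℝ × ℝ}
    (hf₁ : PrimDyadic fun a => (f a).1) (hf₂ : PrimDyadic fun a => (f a).2)
    (hg₁ : PrimDyadic fun a => (g a).1) (hg₂ : PrimDyadic fun a => (g a).2) :
    Sig1 fun a => ReflTransGen (R a) (f a) (g a) := by
  obtain ⟨c₁, hc₁, h₁⟩ := hf₁
  obtain ⟨c₂, hc₂, h₂⟩ := hf₂
  obtain ⟨d₁, hd₁, k₁⟩ := hg₁
  obtain ⟨d₂, hd₂, k₂⟩ := hg₂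
  have hf : ∀ a, f a = ((c₁ a).val, (c₂ a).val) := fun a => Prod.ext (h₁ a) (h₂ a)
  have hg : ∀ a, g a = ((d₁ a).val, (d₂ a).val) := fun a => Prod.ext (k₁ a) (k₂ a)
  simp only [hf, hg]
  refine Sig1.reflTransGen_of_coded (v := fun p : DyadicCode × DyadicCode => (p.1.val, p.2.val))
    ?_ hR (fun a x y hxy => ?_) (hc₁.pair hc₂) (hd₁.pair hd₂)
  · simp only [Prod.mk.injEq]
    exact (PrimDyadic.eq (by fun_prop) (by fun_prop)).and
      (PrimDyadic.eq (by fun_prop) (by fun_prop))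
  · obtain ⟨h1, h2⟩ := hd a x y hxy
    obtain ⟨c, hc⟩ := isDyadic_iff_exists_val.1 h1
    obtain ⟨c', hc'⟩ := isDyadic_iff_exists_val.1 h2
    exact ⟨(c, c'), Prod.ext hc hc'⟩

end PrimDyadic

end ThompsonPL

namespace ThompsonPL

open Set Filter Topology Relation Encodable Denumerable

/-! ### Maps given by codes -/

/-- The order automorphism of `ℝ` with slope `1` to the left of `u`, the pieces listed in the code
to the right of `u`, slope `1` after the last of them, and the value `w` at `u`. Entries of the
code with no room to the right of the preceding ones are skipped. -/
noncomputable def plIso : PLCode → (u w : ℝ) → {f : ℝ ≃o ℝ // ∀ x ≤ u, f x = w + (x - u)}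
  | [], u, w => ⟨affIso 0 u w, fun x _ => by simp⟩
  | (d, e) :: c, u, w =>
    if h : d.val ≤ u then plIso c u w else
      ⟨splice u (affIso 0 u w) (splice d.val (affIso e u w)
          (plIso c d.val (w + 2 ^ e * (d.val - u))).1
          (by rw [(plIso c d.val _).2 _ le_rfl]; simp))
        (by rw [splice_of_le (not_le.1 h).le]; simp),
      fun x hx => by rw [splice_of_le hx]; simp⟩

theorem plIso_congr (c : PLCode) {u u' w w' : ℝ} (hu : u = u') (hw : w = w') (x : ℝ) :
    (plIso c u w).1 x = (plIso c u' w').1 x := by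
  subst hu hw
  rfl

theorem plIso_skip {d : DyadicCode} {e : ℤ} {c : PLCode} {u w : ℝ} (h : d.val ≤ u) :
    plIso ((d, e) :: c) u w = plIso c u w := by
  rw [plIso, dif_pos h]

theorem plIso_cons_of_le {d : DyadicCode} {e : ℤ} {c : PLCode} {u w x : ℝ} (h : u < d.val)
    (hx : u ≤ x) (hxd : x ≤ d.val) : (plIso ((d, e) :: c) u w).1 x = w + 2 ^ e * (x - u) := by
  rw [plIso, dif_neg (not_le.2 h), splice_of_ge hx, splice_of_le hxd, affIso_apply]

theorem plIso_cons_of_ge {d : DyadicCode} {e : ℤ} {c : PLCode} {u w x : ℝ} (h : u < d.val)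
    (hxd : d.val ≤ x) :
    (plIso ((d, e) :: c) u w).1 x = (plIso c d.val (w + 2 ^ e * (d.val - u))).1 x := by
  rw [plIso, dif_neg (not_le.2 h), splice_of_ge (h.le.trans hxd), splice_of_ge hxd]

theorem plIso_lpl (c : PLCode) {u w : ℝ} (hu : IsDyadic u) (hw : IsDyadic w) :
    IsLPL (plIso c u w).1 := by
  induction c generalizing u w with
  | nil => exact IsLPL.affIso 0 hu hw
  | cons p c ih =>
    obtain ⟨d, e⟩ := p
    have hd := isDyadic_val d
    rcases le_or_gt d.val u with h | h
    · rw [plIso_skip h]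
      exact ih hu hw
    · rw [plIso, dif_neg (not_le.2 h)]
      refine IsLPL.splice ?_ hu (IsLPL.affIso 0 hu hw) (IsLPL.splice ?_ hd (IsLPL.affIso e hu hw)
        (ih hd (hu.affine hd hw e)))
      · rw [splice_of_le h.le]; simp
      · rw [(plIso c d.val _).2 _ le_rfl]; simp

/-- The map that is the identity to the left of `L`, and has the pieces listed in `c` to the right
of `L`. -/
noncomputable def plMap (L : ℝ) (c : PLCode) : ℝ ≃o ℝ := (plIso c L L).1

theorem plMap_of_le {L : ℝ} (c : PLCode) {x : ℝ} (hx : x ≤ L) : plMap L c x = x := by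
  rw [plMap, (plIso c L L).2 x hx]; ring

theorem plMap_nil (L x : ℝ) : plMap L [] x = x := by simp [plMap, plIso]

theorem plMap_lpl {L : ℝ} (c : PLCode) (hL : IsDyadic L) : IsLPL (plMap L c) := plIso_lpl c hL hL

/-- The evaluation of a map at `x` may be stopped at `x`. -/
theorem plIso_cons (d : DyadicCode) (e : ℤ) (c : PLCode) (u w x : ℝ) :
    (plIso ((d, e) :: c) u w).1 x = if min x d.val ≤ u then (plIso c u w).1 x
      else (plIso c (min x d.val) (w + 2 ^ e * (min x d.val - u))).1 x := by
  rcases le_or_gt d.val u with h | h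
  · rw [plIso_skip h, if_pos ((min_le_right _ _).trans h)]
  rcases le_total x d.val with hx | hx
  · rw [min_eq_left hx]
    split_ifs with hxu
    · rw [(plIso _ u w).2 x hxu, (plIso _ u w).2 x hxu]
    · rw [plIso_cons_of_le h (not_le.1 hxu).le hx, (plIso _ x _).2 x le_rfl]
      ring
  · rw [min_eq_right hx, if_neg (not_le.2 h), plIso_cons_of_ge h hx]

/-- The condition for the map `plIso c u₀ w` to have slope `2 ^ e` on the part of `[u, v]` to the
right of `u₀`. -/
def PiecesAff (u v : ℝ) (e : ℤ) : PLCode → ℝ → Prop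
  | [], u₀ => u₀ < v → e = 0
  | (d, e₀) :: c, u₀ => (d.val ≤ u₀ ∧ PiecesAff u v e c u₀) ∨
      (u₀ < d.val ∧ (d.val ≤ u ∨ v ≤ u₀ ∨ e = e₀) ∧ PiecesAff u v e c d.val)

theorem piecesAff_iff {u v : ℝ} {e : ℤ} (huv : u < v) (c : PLCode) (u₀ w : ℝ) :
    PiecesAff u v e c u₀ ↔ (u₀ < v → AffOn (plIso c u₀ w).1 (max u u₀) v e) := by
  induction c generalizing u₀ w with
  | nil =>
    refine forall_congr' fun h => ?_
    have h1 : AffOn (plIso [] u₀ w).1 (max u u₀) v 0 :=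
      AffOn.of_base u₀ w fun x _ => by simp [plIso]
    constructor
    · rintro rfl
      exact h1
    · exact fun h2 => h2.unique h1 (max_lt huv h)
  | cons p c ih =>
    obtain ⟨d, e₀⟩ := p
    rcases le_or_gt d.val u₀ with hd | hd
    · rw [plIso_skip hd, ← ih]
      simp [PiecesAff, hd, not_lt.2 hd]
    · have hP : PiecesAff u v e ((d, e₀) :: c) u₀ ↔
          ((d.val ≤ u ∨ v ≤ u₀ ∨ e = e₀) ∧ PiecesAff u v e c d.val) := by
        simp [PiecesAff, hd, not_le.2 hd]
      rw [hP, ih d.val (w + 2 ^ e₀ * (d.val - u₀))]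
      rcases le_or_gt v u₀ with hv | hv
      · simp [hv, not_lt.2 hv, not_lt.2 (hv.trans hd.le)]
      have hge : ∀ x, d.val ≤ x → (plIso ((d, e₀) :: c) u₀ w).1 x =
        (plIso c d.val (w + 2 ^ e₀ * (d.val - u₀))).1 x := fun x hx => plIso_cons_of_ge hd hx
      rcases le_or_gt d.val u with hdu | hdu
      · rw [max_eq_left hdu, max_eq_left (hd.le.trans hdu)]
        simp only [hdu, hv, true_or, true_and, true_imp_iff]
        rw [iff_true_intro (hdu.trans_lt huv), true_imp_iff]
        exact ⟨fun h => h.congr fun x hx => (hge x (hdu.trans hx.1)).symm,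
          fun h => h.congr fun x hx => hge x (hdu.trans hx.1)⟩
      · rw [max_eq_right hdu.le]
        simp only [not_le.2 hdu, not_le.2 hv, hv, false_or, true_imp_iff]
        have hm : max u u₀ < d.val := max_lt hdu hd
        have h1 : AffOn (plIso ((d, e₀) :: c) u₀ w).1 (max u u₀) d.val e₀ :=
          AffOn.of_base u₀ w fun x hx => plIso_cons_of_le hd ((le_max_right _ _).trans hx.1) hx.2
        constructor
        · rintro ⟨rfl, h2⟩
          rcases le_or_gt v d.val with hvd | hvd
          · exact h1.mono le_rfl hvd
          · exact h1.union ((h2 hvd).congr fun x hx => (hge x hx.1).symm) hm.le hvd.le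
        · intro h2
          refine ⟨(h2.mono le_rfl (min_le_left v d.val)).unique
            (h1.mono le_rfl (min_le_right v d.val)) (lt_min (max_lt huv hv) hm), fun _ => ?_⟩
          exact (h2.mono hm.le le_rfl).congr fun x hx => hge x hx.1

/-- An additional piece of slope `1` allows the first point to be moved to the left. -/
theorem plMap_eq_plIso (L : DyadicCode) (c : PLCode) (u : ℝ) :
    plMap L.val c = (plIso ((L, 0) :: c) (min u L.val) (min u L.val)).1 := by
  rcases le_or_gt L.val u with h | h
  · rw [min_eq_right h, plIso_skip le_rfl]
    rfl
  · rw [min_eq_left h.le]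
    refine RelIso.ext fun x => ?_
    rcases le_total x L.val with hx | hx
    · rw [plMap_of_le c hx]
      rcases le_total x u with hxu | hxu
      · rw [(plIso _ u u).2 x hxu]; ring
      · rw [plIso_cons_of_le h hxu hx]; simp
    · rw [plIso_cons_of_ge h hx, plMap]
      exact plIso_congr c rfl (by simp) x

theorem affOn_plMap_iff (L : DyadicCode) (c : PLCode) {u v : ℝ} (e : ℤ) :
    AffOn (plMap L.val c) u v e ↔ v ≤ u ∨ PiecesAff u v e ((L, 0) :: c) (min u L.val) := by
  rcases le_or_gt v u with h | h
  · simp only [h, true_or, iff_true]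
    intro x hx y hy
    have h1 : x = y := by linarith [hx.1, hx.2, hy.1, hy.2]
    rw [h1]
    ring
  · rw [piecesAff_iff h _ _ (min u L.val), ← plMap_eq_plIso, max_eq_left (min_le_left _ _)]
    simp [h, not_le.2 h]

section PrimDyadic

variable {α : Type} [Primcodable α]

theorem PrimDyadic.min {f g : α → ℝ} (hf : PrimDyadic f) (hg : PrimDyadic g) :
    PrimDyadic fun a => min (f a) (g a) := by
  classical
  have := PrimDyadic.ite (hf.le hg) hf hg
  convert this using 2 with a
  exact min_def _ _

@[fun_prop]
theorem PrimDyadic.plMap {L : α → DyadicCode} {c : α → PLCode} {x : α → ℝ} (hL : Primrec L)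
    (hc : Primrec c) (hx : PrimDyadic x) : PrimDyadic fun a => plMap (L a).val (c a) (x a) := by
  classical
  obtain ⟨x, hx, h⟩ := hx
  simp only [h]
  have hm : PrimDyadic fun p : DyadicCode × (DyadicCode × DyadicCode) × (DyadicCode × ℤ) =>
      Min.min p.1.val p.2.2.1.val := PrimDyadic.min (by fun_prop) (by fun_prop)
  have hle := hm.le (.val (by fun_prop : Primrec fun p :
    DyadicCode × (DyadicCode × DyadicCode) × (DyadicCode × ℤ) => p.2.1.1))
  obtain ⟨u', hu', hu⟩ := PrimDyadic.ite hle (.val (by fun_prop : Primrec fun p :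
    DyadicCode × (DyadicCode × DyadicCode) × (DyadicCode × ℤ) => p.2.1.1)) hm
  obtain ⟨w', hw', hw⟩ := PrimDyadic.ite hle (.val (by fun_prop : Primrec fun p :
    DyadicCode × (DyadicCode × DyadicCode) × (DyadicCode × ℤ) => p.2.1.2))
    (.add (.val (by fun_prop : Primrec fun p :
      DyadicCode × (DyadicCode × DyadicCode) × (DyadicCode × ℤ) => p.2.1.2))
      (.zpow_mul (by fun_prop : Primrec fun p :
        DyadicCode × (DyadicCode × DyadicCode) × (DyadicCode × ℤ) => p.2.2.2)
        (hm.sub (.val (by fun_prop : Primrec fun p :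
          DyadicCode × (DyadicCode × DyadicCode) × (DyadicCode × ℤ) => p.2.1.1)))))
  have key : ∀ (x : DyadicCode) (c : PLCode) (s : DyadicCode × DyadicCode),
      (plIso c s.1.val s.2.val).1 x.val =
        (c.foldl (fun s p => (u' (x, s, p), w' (x, s, p))) s).2.val +
          (x.val - (c.foldl (fun s p => (u' (x, s, p), w' (x, s, p))) s).1.val) := by
    intro x c
    induction c with
    | nil => intro s; simp [plIso]
    | cons p c ih =>
      intro s
      rw [List.foldl_cons, ← ih, plIso_cons, ← hu, ← hw]
      dsimp only
      split_ifs with h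
      · exact plIso_congr c (if_pos h).symm (if_pos h).symm _
      · exact plIso_congr c (if_neg h).symm (if_neg h).symm _
  have hfold : Primrec fun a => (c a).foldl (fun s p => (u' (x a, s, p), w' (x a, s, p)))
      (L a, L a) :=
    Primrec.list_foldl hc (hL.pair hL) (h := fun a q => (u' (x a, q.1, q.2), w' (x a, q.1, q.2)))
      ((hu'.comp (by fun_prop)).pair (hw'.comp (by fun_prop)))
  have : PrimDyadic fun a => ((c a).foldl (fun s p => (u' (x a, s, p), w' (x a, s, p)))
      (L a, L a)).2.val + ((x a).val - ((c a).foldl (fun s p => (u' (x a, s, p), w' (x a, s, p)))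
      (L a, L a)).1.val) :=
    (PrimDyadic.val (Primrec.snd.comp hfold)).add
      ((PrimDyadic.val hx).sub (PrimDyadic.val (Primrec.fst.comp hfold)))
  convert this using 2 with a
  exact key _ _ (L a, L a)

theorem PrimDyadic.piecesAff {u v u₀ : α → ℝ} {e : α → ℤ} {c : α → PLCode} (hu : PrimDyadic u)
    (hv : PrimDyadic v) (he : Primrec e) (hc : Primrec c) (hu₀ : PrimDyadic u₀) :
    PrimrecPred fun a => PiecesAff (u a) (v a) (e a) (c a) (u₀ a) := by
  classical
  obtain ⟨k, hk, h⟩ := hu₀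
  simp only [h]
  have h1 : PrimrecPred fun q : α × (DyadicCode × Bool) × (DyadicCode × ℤ) =>
      q.2.2.1.val ≤ q.2.1.1.val := PrimDyadic.le (by fun_prop) (by fun_prop)
  have h2 : PrimrecPred fun q : α × (DyadicCode × Bool) × (DyadicCode × ℤ) =>
      q.2.2.1.val ≤ u q.1 ∨ v q.1 ≤ q.2.1.1.val ∨ e q.1 = q.2.2.2 :=
    .or (PrimDyadic.le (.val (by fun_prop)) (hu.comp (by fun_prop)))
      (.or (PrimDyadic.le (hv.comp (by fun_prop)) (.val (by fun_prop)))
        (primrecPred_eq (by fun_prop) (by fun_prop)))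
  set step : α → (DyadicCode × Bool) × (DyadicCode × ℤ) → DyadicCode × Bool := fun a q =>
    if q.2.1.val ≤ q.1.1.val then q.1 else (q.2.1, q.1.2 &&
      decide (q.2.1.val ≤ u a ∨ v a ≤ q.1.1.val ∨ e a = q.2.2)) with hstep
  have hs : Primrec₂ step := Primrec.ite h1 (by fun_prop)
    (.pair (by fun_prop) (Primrec.and.comp (by fun_prop) h2.decide))
  have key : ∀ (a : α) (c : PLCode) (s : DyadicCode × Bool),
      ((s.2 = true ∧ PiecesAff (u a) (v a) (e a) c s.1.val) ↔
        ((c.foldl (fun s p => step a (s, p)) s).2 = true ∧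
          (v a ≤ (c.foldl (fun s p => step a (s, p)) s).1.val ∨ e a = 0))) := by
    intro a c
    induction c with
    | nil =>
      intro s
      simp only [PiecesAff, List.foldl_nil, ← not_lt, imp_iff_not_or]
    | cons p c ih =>
      intro s
      rw [List.foldl_cons, ← ih]
      rcases le_or_gt p.1.val s.1.val with h | h
      · simp [hstep, h, PiecesAff, not_lt.2 h]
      · simp [hstep, not_le.2 h, h, PiecesAff, and_assoc]
  have hfold : Primrec fun a => (c a).foldl (fun s p => step a (s, p)) (k a, true) :=
    Primrec.list_foldl hc (hk.pair (.const true)) hs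
  refine ((primrecPred_eq (Primrec.snd.comp hfold) (.const true)).and
    (.or (hv.le (.val (Primrec.fst.comp hfold))) (primrecPred_eq he (.const 0)))).of_eq fun a => ?_
  rw [← key]
  simp

theorem PrimDyadic.affOn {L : α → DyadicCode} {c : α → PLCode} {u v : α → ℝ} {e : α → ℤ}
    (hL : Primrec L) (hc : Primrec c) (hu : PrimDyadic u) (hv : PrimDyadic v) (he : Primrec e) :
    PrimrecPred fun a => AffOn (ThompsonPL.plMap (L a).val (c a)) (u a) (v a) (e a) := by
  simp only [affOn_plMap_iff]
  exact (hv.le hu).or (PrimDyadic.piecesAff hu hv he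
    (Primrec.list_cons.comp (hL.pair (.const 0)) hc)
    (.min hu (.val hL)))

end PrimDyadic

end ThompsonPL

namespace ThompsonPL

open Set Filter Topology Relation

/-! ### Finite certificates for equalities of piecewise linear maps -/

/-- Both maps in the composition `f₁ ∘ f₂` are affine where it is evaluated on `[u, v]`. -/
def CompAff (f₁ f₂ : ℝ → ℝ) (u v : ℝ) : Prop :=
  (∃ e, AffOn f₂ u v e) ∧ ∃ e, AffOn f₁ (f₂ u) (f₂ v) e

theorem CompAff.affOn {f₁ f₂ : ℝ → ℝ} {u v : ℝ} (h : CompAff f₁ f₂ u v) :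
    ∃ e, AffOn (f₁ ∘ f₂) u v e := by
  obtain ⟨⟨e, he⟩, e', he'⟩ := h
  exact ⟨_, he.comp he'⟩

theorem CompAff.mono {f₁ : ℝ → ℝ} {f₂ : ℝ ≃o ℝ} {u v u' v' : ℝ} (h : CompAff f₁ f₂ u v)
    (hu : u ≤ u') (hv : v' ≤ v) : CompAff f₁ f₂ u' v' := by
  obtain ⟨⟨e, he⟩, e', he'⟩ := h
  exact ⟨⟨e, he.mono hu hv⟩, e', he'.mono (f₂.monotone hu) (f₂.monotone hv)⟩

theorem IsLPL.compAff_right {f₁ : ℝ → ℝ} {f₂ : ℝ ≃o ℝ} (h₁ : IsLPL f₁) (h₂ : IsLPL f₂) (x : ℝ) :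
    ∃ v, x < v ∧ CompAff f₁ f₂ x v := by
  obtain ⟨v, hv, e, he⟩ := h₂.right x
  obtain ⟨w, hw, e', he'⟩ := h₁.right (f₂ x)
  refine ⟨min v (f₂.symm w), lt_min hv (f₂.lt_symm_apply.2 hw),
    ⟨e, he.mono le_rfl (min_le_left _ _)⟩, e', he'.mono le_rfl ?_⟩
  exact (f₂.monotone (min_le_right _ _)).trans_eq (f₂.apply_symm_apply w)

theorem IsLPL.compAff_left {f₁ : ℝ → ℝ} {f₂ : ℝ ≃o ℝ} (h₁ : IsLPL f₁) (h₂ : IsLPL f₂) (x : ℝ) :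
    ∃ u, u < x ∧ CompAff f₁ f₂ u x := by
  obtain ⟨v, hv, e, he⟩ := h₂.left x
  obtain ⟨w, hw, e', he'⟩ := h₁.left (f₂ x)
  refine ⟨max v (f₂.symm w), max_lt hv (f₂.symm_apply_lt.2 hw),
    ⟨e, he.mono (le_max_left _ _) le_rfl⟩, e', he'.mono ?_ le_rfl⟩
  exact (f₂.apply_symm_apply w).symm.trans_le (f₂.monotone (le_max_right _ _))

theorem IsLPL.compAff_two {f₁ : ℝ → ℝ} {f₂ : ℝ ≃o ℝ} (h₁ : IsLPL f₁) (h₂ : IsLPL f₂) {x : ℝ}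
    (hx : ¬ IsDyadic x) : ∃ u v, u < x ∧ x < v ∧ CompAff f₁ f₂ u v := by
  obtain ⟨u, v, hu, hv, e, he⟩ := h₂.two x hx
  obtain ⟨w, w', hw, hw', e', he'⟩ := h₁.two (f₂ x) (mt (h₂.dyadic x).1 hx)
  refine ⟨max u (f₂.symm w), min v (f₂.symm w'), max_lt hu (f₂.symm_apply_lt.2 hw),
    lt_min hv (f₂.lt_symm_apply.2 hw'), ⟨e, he.mono (le_max_left _ _) (min_le_left _ _)⟩,
    e', he'.mono ?_ ?_⟩
  · exact (f₂.apply_symm_apply w).symm.trans_le (f₂.monotone (le_max_right _ _))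
  · exact (f₂.monotone (min_le_right _ _)).trans_eq (f₂.apply_symm_apply w')

theorem AffOn.eqOn {f g : ℝ → ℝ} {u v : ℝ} {e e' : ℤ} (hf : AffOn f u v e) (hg : AffOn g u v e')
    {y : ℝ} (hu : f u = g u) (hy : y ∈ Ioc u v) (h : f y = g y) : ∀ x ∈ Icc u v, f x = g x := by
  have huv : u ∈ Icc u v := ⟨le_rfl, hy.1.le.trans hy.2⟩
  have h1 := hf u huv y ⟨hy.1.le, hy.2⟩
  have h2 := hg u huv y ⟨hy.1.le, hy.2⟩
  have h3 : (2 : ℝ) ^ e * (y - u) = 2 ^ e' * (y - u) := by linarith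
  have h4 := mul_right_cancel₀ (sub_pos.2 hy.1).ne' h3
  intro x hx
  rw [hf u huv x hx, hg u huv x hx, h4, hu]

/-- One step of a certificate for the equality of two compositions: affine pieces that agree at the
right end. -/
def EqStep (f₁ f₂ f₃ f₄ : ℝ → ℝ) (u v : ℝ) : Prop :=
  u < v ∧ IsDyadic u ∧ IsDyadic v ∧ CompAff f₁ f₂ u v ∧ CompAff f₃ f₄ u v ∧ f₁ (f₂ v) = f₃ (f₄ v)

section

variable {f₁ f₂ f₃ f₄ : ℝ ≃o ℝ} {p q t : ℝ}

/-- Two compositions agree on a dyadic interval if and only if a finite chain of affine pieces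
certifies it. -/
theorem eqOn_iff_reflTransGen (h₁ : IsLPL f₁) (h₂ : IsLPL f₂) (h₃ : IsLPL f₃) (h₄ : IsLPL f₄)
    (hp : IsDyadic p) (hq : IsDyadic q) (hpq : p ≤ q) :
    (∀ x ∈ Icc p q, f₁ (f₂ x) = f₃ (f₄ x)) ↔
      f₁ (f₂ p) = f₃ (f₄ p) ∧ ReflTransGen (EqStep f₁ f₂ f₃ f₄) p q := by
  constructor
  · intro h
    refine ⟨h p ⟨le_rfl, hpq⟩, ?_⟩
    have h5 := exists_subdivision (Q := fun u v => CompAff f₁ f₂ u v ∧ CompAff f₃ f₄ u v)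
      (fun u v u' v' h hu _ hv => ⟨h.1.mono hu hv, h.2.mono hu hv⟩) hp hq hpq
      (fun x _ => by
        obtain ⟨v, hv, h⟩ := h₁.compAff_right h₂ x
        obtain ⟨w, hw, h'⟩ := h₃.compAff_right h₄ x
        exact ⟨min v w, lt_min hv hw, h.mono le_rfl (min_le_left _ _),
          h'.mono le_rfl (min_le_right _ _)⟩)
      (fun x _ => by
        obtain ⟨v, hv, h⟩ := h₁.compAff_left h₂ x
        obtain ⟨w, hw, h'⟩ := h₃.compAff_left h₄ x
        exact ⟨max v w, max_lt hv hw, h.mono (le_max_left _ _) le_rfl,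
          h'.mono (le_max_right _ _) le_rfl⟩)
      (fun x _ hx => by
        obtain ⟨u, v, hu, hv, h⟩ := h₁.compAff_two h₂ hx
        obtain ⟨u', v', hu', hv', h'⟩ := h₃.compAff_two h₄ hx
        exact ⟨max u u', min v v', max_lt hu hu', lt_min hv hv',
          h.mono (le_max_left _ _) (min_le_left _ _),
          h'.mono (le_max_right _ _) (min_le_right _ _)⟩)
    refine (?_ : ∀ r, ReflTransGen _ r q → p ≤ r → ReflTransGen (EqStep f₁ f₂ f₃ f₄) r q)
      p h5 le_rfl
    intro r h5
    induction h5 using ReflTransGen.head_induction_on with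
    | refl => exact fun _ => .refl
    | @head u v huv hvq ih =>
      intro hu
      have hvq' : v ≤ q := by
        clear ih hq hpq h h5
        induction hvq with
        | refl => exact le_rfl
        | tail _ h ih => exact ih.trans h.1.le
      have hpv := hu.trans huv.1.le
      exact .head ⟨huv.1, huv.2.1, huv.2.2.1, huv.2.2.2.1, huv.2.2.2.2, h v ⟨hpv, hvq'⟩⟩ (ih hpv)
  · rintro ⟨h, H⟩
    clear hp hq hpq
    induction H using ReflTransGen.head_induction_on with
    | refl =>
      intro x hx
      rw [le_antisymm hx.2 hx.1, h]
    | @head u v huv _ ih =>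
      intro x hx
      obtain ⟨huv, -, -, h1, h2, h3⟩ := huv
      rcases le_total x v with hxv | hxv
      · obtain ⟨e, he⟩ := h1.affOn
        obtain ⟨e', he'⟩ := h2.affOn
        exact he.eqOn he' h ⟨huv, le_rfl⟩ h3 x ⟨hx.1, hxv⟩
      · exact ih h3 x ⟨hxv, hx.2⟩

/-- A single point of difference within a common affine piece certifies that two compositions differ
right after `t`. -/
theorem diffAfter_iff_exists (h₁ : IsLPL f₁) (h₂ : IsLPL f₂) (h₃ : IsLPL f₃) (h₄ : IsLPL f₄)
    (ht : f₁ (f₂ t) = f₃ (f₄ t)) :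
    DiffAfter (fun x => f₁ (f₂ x)) (fun x => f₃ (f₄ x)) t ↔ ∃ v, IsDyadic v ∧ t < v ∧
      CompAff f₁ f₂ t v ∧ CompAff f₃ f₄ t v ∧ f₁ (f₂ v) ≠ f₃ (f₄ v) := by
  constructor
  · intro H
    obtain ⟨v, hv, h⟩ := h₁.compAff_right h₂ t
    obtain ⟨w, hw, h'⟩ := h₃.compAff_right h₄ t
    obtain ⟨x, hx1, hx2, hx3⟩ := H _ (lt_min hv hw)
    obtain ⟨d, hd, hxd, hdv⟩ := exists_dyadic_between hx2
    have htd := hx1.trans hxd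
    have h1 := h.mono le_rfl (hdv.trans_le (min_le_left _ _)).le
    have h2 := h'.mono le_rfl (hdv.trans_le (min_le_right _ _)).le
    refine ⟨d, hd, htd, h1, h2, fun h3 => hx3 ?_⟩
    obtain ⟨e, he⟩ := h1.affOn
    obtain ⟨e', he'⟩ := h2.affOn
    exact he.eqOn he' ht ⟨htd, le_rfl⟩ h3 x ⟨hx1.le, hxd.le⟩
  · rintro ⟨v, -, htv, h1, h2, h3⟩ w hw
    obtain ⟨x, hx1, hx2⟩ := exists_between (lt_min htv hw)
    refine ⟨x, hx1, hx2.trans_le (min_le_right _ _), fun hx3 => h3 ?_⟩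
    obtain ⟨e, he⟩ := h1.affOn
    obtain ⟨e', he'⟩ := h2.affOn
    exact he.eqOn he' ht ⟨hx1, (hx2.trans_le (min_le_left _ _)).le⟩ hx3 v ⟨htv.le, le_rfl⟩

end

section Sig

variable {α β : Type} [Primcodable α] [Primcodable β]

theorem PrimDyadic.isDyadic {f : α → ℝ} (hf : PrimDyadic f) (a : α) : IsDyadic (f a) := by
  obtain ⟨c, -, h⟩ := hf
  rw [h]
  exact isDyadic_val _

theorem Sig1.exists_dyadic_of {P : α → ℝ → Prop} (hd : ∀ a x, P a x → IsDyadic x)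
    (h : Sig1 fun p : α × DyadicCode => P p.1 p.2.val) : Sig1 fun a => ∃ x, P a x :=
  h.exists_dyadic.of_iff fun a => exists_congr fun x => ⟨fun h => ⟨hd a x h, h⟩, And.right⟩

theorem Sig1.exists_idx {P : α → β → Prop} (h : Sig1 fun p : α × β => P p.1 p.2)
    {l : α → List β} (hl : Primrec l) : Sig1 fun a => ∃ i : {b // b ∈ l a}, P a i :=
  (h.exists_mem hl).of_iff fun a => by simp

theorem Sig1.forall_idx {P : α → β → Prop} (h : Sig1 fun p : α × β => P p.1 p.2)
    {l : α → List β} (hl : Primrec l) : Sig1 fun a => ∀ i : {b // b ∈ l a}, P a i :=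
  (h.forall_mem hl).of_iff fun a => by simp

variable {L : α → DyadicCode} {c₁ c₂ c₃ c₄ : α → PLCode} {p q : α → ℝ}

theorem Sig1.compAff (hL : Primrec L) (h₁ : Primrec c₁) (h₂ : Primrec c₂) (hp : PrimDyadic p)
    (hq : PrimDyadic q) :
    Sig1 fun a => CompAff (plMap (L a).val (c₁ a)) (plMap (L a).val (c₂ a)) (p a) (q a) := by
  refine .and (.exists (.of_primrec ?_)) (.exists (.of_primrec ?_))
  · exact PrimDyadic.affOn (hL.comp .fst) (h₂.comp .fst) (hp.comp .fst) (hq.comp .fst) .snd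
  · exact PrimDyadic.affOn (hL.comp .fst) (h₁.comp .fst) ((PrimDyadic.plMap hL h₂ hp).comp .fst)
      ((PrimDyadic.plMap hL h₂ hq).comp .fst) .snd

theorem Sig1.eqOn (hL : Primrec L) (h₁ : Primrec c₁) (h₂ : Primrec c₂) (h₃ : Primrec c₃)
    (h₄ : Primrec c₄) (hp : PrimDyadic p) (hq : PrimDyadic q) :
    Sig1 fun a => ∀ x ∈ Icc (p a) (q a),
      plMap (L a).val (c₁ a) (plMap (L a).val (c₂ a) x) =
        plMap (L a).val (c₃ a) (plMap (L a).val (c₄ a) x) := by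
  have key : Sig1 fun a => q a < p a ∨ (p a ≤ q a ∧ plMap (L a).val (c₁ a)
      (plMap (L a).val (c₂ a) (p a)) = plMap (L a).val (c₃ a) (plMap (L a).val (c₄ a) (p a)) ∧
      ReflTransGen (EqStep (plMap (L a).val (c₁ a)) (plMap (L a).val (c₂ a))
        (plMap (L a).val (c₃ a)) (plMap (L a).val (c₄ a))) (p a) (q a)) := by
    refine .or (.of_primrec (hq.lt hp)) (.and (.of_primrec (hp.le hq)) (.and
      (.of_primrec (PrimDyadic.eq (by fun_prop) (by fun_prop))) ?_))
    refine Sig1.reflTransGen_dyadic (R := fun a => EqStep (plMap (L a).val (c₁ a))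
      (plMap (L a).val (c₂ a)) (plMap (L a).val (c₃ a)) (plMap (L a).val (c₄ a))) ?_
      (fun a x y h => h.2.2.1) hp hq
    have : Sig1 fun p : α × DyadicCode × DyadicCode => p.2.1.val < p.2.2.val ∧
        CompAff (plMap (L p.1).val (c₁ p.1)) (plMap (L p.1).val (c₂ p.1)) p.2.1.val p.2.2.val ∧
        CompAff (plMap (L p.1).val (c₃ p.1)) (plMap (L p.1).val (c₄ p.1)) p.2.1.val p.2.2.val ∧
        plMap (L p.1).val (c₁ p.1) (plMap (L p.1).val (c₂ p.1) p.2.2.val) =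
          plMap (L p.1).val (c₃ p.1) (plMap (L p.1).val (c₄ p.1) p.2.2.val) :=
      .and (.of_primrec (PrimDyadic.lt (by fun_prop) (by fun_prop)))
        (.and (.compAff (by fun_prop) (by fun_prop) (by fun_prop) (by fun_prop) (by fun_prop))
        (.and (.compAff (by fun_prop) (by fun_prop) (by fun_prop) (by fun_prop) (by fun_prop))
        (.of_primrec (PrimDyadic.eq (by fun_prop) (by fun_prop)))))
    exact this.of_iff fun p => by simp [EqStep, isDyadic_val]
  refine key.of_iff fun a => ?_
  have hl := fun c => plMap_lpl c (isDyadic_val (L a))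
  rcases lt_or_ge (q a) (p a) with h | h
  · simp [h]
  · rw [eqOn_iff_reflTransGen (hl _) (hl _) (hl _) (hl _) (hp.isDyadic a) (hq.isDyadic a) h]
    simp [h, not_lt.2 h]

end Sig

end ThompsonPL

namespace ThompsonPL

open Set Filter Topology Relation

/-! ### The deduction rules are semidecidable -/

/-- The family of the first components of a list of pairs of codes. -/
noncomputable abbrev leftFam (L : DyadicCode) (l : List (PLCode × PLCode)) :
    {p // p ∈ l} → ℝ ≃o ℝ := fun p => plMap L.val p.1.1

/-- The family of the second components of a list of pairs of codes. -/
noncomputable abbrev rightFam (L : DyadicCode) (l : List (PLCode × PLCode)) :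
    {p // p ∈ l} → ℝ ≃o ℝ := fun p => plMap L.val p.1.2

section Sig

theorem Sig1.isDyadic {α : Type} [Primcodable α] {f : α → ℝ} (hf : PrimDyadic f) :
    Sig1 fun a => IsDyadic (f a) :=
  (Sig1.of_primrec (primrecPred_eq (.const 0) (.const 0))).of_iff fun a => by
    simp [hf.isDyadic a]

theorem Sig1.exists_dyadic_prod_of {α : Type} [Primcodable α] {P : α → ℝ × ℝ → Prop}
    (hd : ∀ a x, P a x → IsDyadic x.1 ∧ IsDyadic x.2)
    (h : Sig1 fun p : α × DyadicCode × DyadicCode => P p.1 (p.2.1.val, p.2.2.val)) :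
    Sig1 fun a => ∃ x, P a x :=
  (Sig1.exists (P := fun a (c : DyadicCode × DyadicCode) => P a (c.1.val, c.2.val)) h).of_iff
    fun a => by
      constructor
      · rintro ⟨⟨x, y⟩, hx⟩
        obtain ⟨c, rfl⟩ := isDyadic_iff_exists_val.1 (hd a _ hx).1
        obtain ⟨c', rfl⟩ := isDyadic_iff_exists_val.1 (hd a _ hx).2
        exact ⟨(c, c'), hx⟩
      · rintro ⟨c, hc⟩
        exact ⟨_, hc⟩

variable {α : Type} [Primcodable α] {L : α → DyadicCode} {l : α → List (PLCode × PLCode)}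

theorem Sig1.eqFam {c₁ c₂ c₃ c₄ : α → PLCode × PLCode → PLCode}
    (hL : Primrec L) (hl : Primrec l)
    (h₁ : Primrec fun p : α × PLCode × PLCode => c₁ p.1 p.2)
    (h₂ : Primrec fun p : α × PLCode × PLCode => c₂ p.1 p.2)
    (h₃ : Primrec fun p : α × PLCode × PLCode => c₃ p.1 p.2)
    (h₄ : Primrec fun p : α × PLCode × PLCode => c₄ p.1 p.2) {p t : α → ℝ} (hp : PrimDyadic p)
    (ht : PrimDyadic t) :
    Sig1 fun a => EqFam
      (fun (k : {b // b ∈ l a}) x => plMap (L a).val (c₁ a k) (plMap (L a).val (c₂ a k) x))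
      (fun (k : {b // b ∈ l a}) x => plMap (L a).val (c₃ a k) (plMap (L a).val (c₄ a k) x))
      (p a) (t a) :=
  .and (.of_primrec (hp.le ht)) (.forall_idx (P := fun a k => ∀ x ∈ Icc (p a) (t a),
    plMap (L a).val (c₁ a k) (plMap (L a).val (c₂ a k) x) =
      plMap (L a).val (c₃ a k) (plMap (L a).val (c₄ a k) x))
    (.eqOn (hL.comp .fst) h₁ h₂ h₃ h₄ (hp.comp .fst) (ht.comp .fst)) hl)

theorem Sig1.firstDiff {c₁ c₂ c₃ c₄ : α → PLCode × PLCode → PLCode}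
    (hL : Primrec L) (hl : Primrec l)
    (h₁ : Primrec fun p : α × PLCode × PLCode => c₁ p.1 p.2)
    (h₂ : Primrec fun p : α × PLCode × PLCode => c₂ p.1 p.2)
    (h₃ : Primrec fun p : α × PLCode × PLCode => c₃ p.1 p.2)
    (h₄ : Primrec fun p : α × PLCode × PLCode => c₄ p.1 p.2) {p t : α → ℝ} (hp : PrimDyadic p)
    (ht : PrimDyadic t) :
    Sig1 fun a => FirstDiff
      (fun (k : {b // b ∈ l a}) x => plMap (L a).val (c₁ a k) (plMap (L a).val (c₂ a k) x))
      (fun (k : {b // b ∈ l a}) x => plMap (L a).val (c₃ a k) (plMap (L a).val (c₄ a k) x))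
      (p a) (t a) := by
  have key : Sig1 fun a => EqFam
      (fun (k : {b // b ∈ l a}) x => plMap (L a).val (c₁ a k) (plMap (L a).val (c₂ a k) x))
      (fun (k : {b // b ∈ l a}) x => plMap (L a).val (c₃ a k) (plMap (L a).val (c₄ a k) x))
      (p a) (t a) ∧ ∃ k : {b // b ∈ l a}, ∃ v, IsDyadic v ∧ t a < v ∧
        CompAff (plMap (L a).val (c₁ a k)) (plMap (L a).val (c₂ a k)) (t a) v ∧
        CompAff (plMap (L a).val (c₃ a k)) (plMap (L a).val (c₄ a k)) (t a) v ∧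
        plMap (L a).val (c₁ a k) (plMap (L a).val (c₂ a k) v) ≠
          plMap (L a).val (c₃ a k) (plMap (L a).val (c₄ a k) v) := by
    refine .and (.eqFam hL hl h₁ h₂ h₃ h₄ hp ht) (.exists_idx (P := fun a k => ∃ v, IsDyadic v ∧
      t a < v ∧ CompAff (plMap (L a).val (c₁ a k)) (plMap (L a).val (c₂ a k)) (t a) v ∧
      CompAff (plMap (L a).val (c₃ a k)) (plMap (L a).val (c₄ a k)) (t a) v ∧
      plMap (L a).val (c₁ a k) (plMap (L a).val (c₂ a k) v) ≠
        plMap (L a).val (c₃ a k) (plMap (L a).val (c₄ a k) v)) (.exists_dyadic ?_) hl)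
    have hL' : Primrec fun q : (α × PLCode × PLCode) × DyadicCode => L q.1.1 := by fun_prop
    have ht' : PrimDyadic fun q : (α × PLCode × PLCode) × DyadicCode => t q.1.1 :=
      ht.comp (by fun_prop)
    replace h₁ := h₁.comp (Primrec.fst (α := α × PLCode × PLCode) (β := DyadicCode))
    replace h₂ := h₂.comp (Primrec.fst (α := α × PLCode × PLCode) (β := DyadicCode))
    replace h₃ := h₃.comp (Primrec.fst (α := α × PLCode × PLCode) (β := DyadicCode))
    replace h₄ := h₄.comp (Primrec.fst (α := α × PLCode × PLCode) (β := DyadicCode))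
    have hv : PrimDyadic fun q : (α × PLCode × PLCode) × DyadicCode => q.2.val := by fun_prop
    exact .and (.of_primrec (ht'.lt hv)) (.and (.compAff hL' h₁ h₂ ht' hv)
      (.and (.compAff hL' h₃ h₄ ht' hv) (.of_primrec (PrimDyadic.ne
        (.plMap hL' h₁ (.plMap hL' h₂ hv))
        (.plMap hL' h₃ (.plMap hL' h₄ hv))))))
  refine key.of_iff fun a => and_congr_right fun h => exists_congr fun k => ?_
  have hl := fun c => plMap_lpl c (isDyadic_val (L a))
  exact diffAfter_iff_exists (hl _) (hl _) (hl _) (hl _) (h.2 k (t a) ⟨h.1, le_rfl⟩)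

/-- One side of the data, as families of functions: `π` is one of the two projections. -/
theorem Sig1.eqFam_id (hL : Primrec L) (hl : Primrec l) {π : PLCode × PLCode → PLCode}
    (hπ : Primrec π) {p t : α → ℝ} (hp : PrimDyadic p) (ht : PrimDyadic t) :
    Sig1 fun a =>
      EqFam (fun k : {b // b ∈ l a} => ⇑(plMap (L a).val (π k))) (idFam _) (p a) (t a) :=
  (Sig1.eqFam (c₁ := fun _ => π) (c₂ := fun _ _ => []) (c₃ := fun _ _ => []) (c₄ := fun _ _ => [])
    hL hl (hπ.comp .snd) (.const _) (.const _) (.const _) hp ht).of_iff fun a => by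
      simp only [plMap_nil]; rfl

theorem Sig1.firstDiff_id (hL : Primrec L) (hl : Primrec l) {π : PLCode × PLCode → PLCode}
    (hπ : Primrec π) {p t : α → ℝ} (hp : PrimDyadic p) (ht : PrimDyadic t) :
    Sig1 fun a =>
      FirstDiff (fun k : {b // b ∈ l a} => ⇑(plMap (L a).val (π k))) (idFam _) (p a) (t a) :=
  (Sig1.firstDiff (c₁ := fun _ => π) (c₂ := fun _ _ => []) (c₃ := fun _ _ => [])
    (c₄ := fun _ _ => []) hL hl (hπ.comp .snd) (.const _) (.const _) (.const _) hp ht).of_iff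
    fun a => by simp only [plMap_nil]; rfl

theorem PrimDyadic.zone {c : α → PLCode} {u v : α → ℝ} {s : α → ℤ} (hL : Primrec L)
    (hc : Primrec c) (hu : PrimDyadic u) (hv : PrimDyadic v) (hs : Primrec s) :
    PrimrecPred fun a => Zone (ThompsonPL.plMap (L a).val (c a)) (u a) (v a) (s a) := by
  have h1 := PrimDyadic.plMap hL hc hu
  have h2 := PrimDyadic.plMap hL hc hv
  refine ((hu.lt hv).and ((PrimDyadic.affOn hL hc hu hv hs).and
    (((hu.le h1).and (h2.le hv)).or ((h1.le hu).and (hv.le h2))))).of_eq fun a => ?_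
  exact ⟨fun h => ⟨h.1, hu.isDyadic a, hv.isDyadic a, h.2.1, h.2.2⟩, fun h => ⟨h.lt, h.aff, h.fix⟩⟩

theorem Sig1.zoneStep {c c' : α → PLCode} {x y x' y' : α → ℝ} (hL : Primrec L) (hc : Primrec c)
    (hc' : Primrec c') (hx : PrimDyadic x) (hy : PrimDyadic y) (hx' : PrimDyadic x')
    (hy' : PrimDyadic y') : Sig1 fun a =>
      ZoneStep (plMap (L a).val (c a)) (plMap (L a).val (c' a)) (x a, y a) (x' a, y' a) := by
  refine .exists_dyadic_of (fun a u ⟨_, _, _, h, _⟩ => h.dyadic_left) ?_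
  refine .exists_dyadic_of (fun a v ⟨_, _, h, _⟩ => h.dyadic_right) ?_
  refine .exists (.exists (.of_primrec ?_))
  refine .and (PrimDyadic.zone (by fun_prop) (by fun_prop) (by fun_prop) (by fun_prop)
    (by fun_prop))
    <| .and (.not (primrecPred_eq (by fun_prop) (.const 0)))
    <| .and (.and (PrimDyadic.le (by fun_prop) (by fun_prop)) (PrimDyadic.le (by fun_prop)
      (by fun_prop))) <| .and (.and (PrimDyadic.le (by fun_prop) (by fun_prop)) (PrimDyadic.le
      (by fun_prop) (by fun_prop))) <| .and (PrimDyadic.ne (by fun_prop) (by fun_prop))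
    <| .and (PrimDyadic.eq (by fun_prop) (by fun_prop))
    <| .and (PrimDyadic.affOn (by fun_prop) (by fun_prop) (by fun_prop) (by fun_prop) (by fun_prop))
    <| .and (PrimDyadic.eq (by fun_prop) (by fun_prop))
    <| .or (PrimDyadic.eq (by fun_prop) (by fun_prop))
    <| .or (PrimDyadic.eq (by fun_prop) (by fun_prop))
    <| .not (PrimDyadic.isDyadic_fix (by fun_prop) (by fun_prop) (by fun_prop))

theorem Sig1.zoneClash {c c' : α → PLCode} {x y : α → ℝ} (hL : Primrec L) (hc : Primrec c)
    (hc' : Primrec c') (hx : PrimDyadic x) (hy : PrimDyadic y) : Sig1 fun a =>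
      ZoneClash (plMap (L a).val (c a)) (plMap (L a).val (c' a)) (x a, y a) := by
  refine .exists_dyadic_of (fun a u ⟨_, _, _, _, _, h, _⟩ => h.dyadic_left) ?_
  refine .exists_dyadic_of (fun a u ⟨_, _, _, _, h, _⟩ => h.dyadic_right) ?_
  refine .exists_dyadic_of (fun a u ⟨_, _, _, _, h, _⟩ => h.dyadic_left) ?_
  refine .exists_dyadic_of (fun a u ⟨_, _, _, h, _⟩ => h.dyadic_right) ?_
  refine .exists (.exists (.and (.of_primrec (PrimDyadic.zone (by fun_prop) (by fun_prop)
    (by fun_prop) (by fun_prop) (by fun_prop))) (.and (.of_primrec (PrimDyadic.zone (by fun_prop)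
    (by fun_prop) (by fun_prop) (by fun_prop) (by fun_prop))) ?_)))
  refine .and (.of_primrec (.and (PrimDyadic.le (by fun_prop) (by fun_prop)) (PrimDyadic.le
      (by fun_prop) (by fun_prop)))) <| .and (.of_primrec (.and (PrimDyadic.le (by fun_prop)
      (by fun_prop)) (PrimDyadic.le (by fun_prop) (by fun_prop))))
    <| .and (.of_primrec (primrecPred_int_lt (by fun_prop) (by fun_prop)))
    <| .and (.of_primrec (PrimDyadic.ne (by fun_prop) (by fun_prop)))
    <| .or (.of_primrec (.not (primrecPred_eq (by fun_prop) (by fun_prop))))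
    <| .exists (.and (.of_primrec (PrimDyadic.lt (by fun_prop) (by fun_prop)))
      (.of_primrec (PrimDyadic.lt (by fun_prop) (by fun_prop))))

theorem Sig1.fStep {x y x' y' : α → ℝ} (hL : Primrec L) (hl : Primrec l) (hx : PrimDyadic x)
    (hy : PrimDyadic y) (hx' : PrimDyadic x') (hy' : PrimDyadic y') : Sig1 fun a =>
      FStep (fns (leftFam (L a) (l a))) (fns (rightFam (L a) (l a))) (x a, y a) (x' a, y' a) := by
  refine .and (.isDyadic hx') (.and (.isDyadic hy') (.exists_idx (P := fun a i =>
    (plMap (L a).val i.1 (x a) = x' a ∧ plMap (L a).val i.2 (y a) = y' a) ∨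
    (plMap (L a).val i.1 (x' a) = x a ∧ plMap (L a).val i.2 (y' a) = y a) ∨
    ZoneStep (plMap (L a).val i.1) (plMap (L a).val i.2) (x a, y a) (x' a, y' a)) ?_ hl))
  exact .or (.of_primrec (.and (PrimDyadic.eq (by fun_prop) (by fun_prop))
      (PrimDyadic.eq (by fun_prop) (by fun_prop))))
    (.or (.of_primrec (.and (PrimDyadic.eq (by fun_prop) (by fun_prop))
      (PrimDyadic.eq (by fun_prop) (by fun_prop))))
    (.zoneStep (by fun_prop) (by fun_prop) (by fun_prop) (by fun_prop) (by fun_prop) (by fun_prop)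
      (by fun_prop)))

theorem Sig1.forced {x y x' y' : α → ℝ} (hL : Primrec L) (hl : Primrec l) (hx : PrimDyadic x)
    (hy : PrimDyadic y) (hx' : PrimDyadic x') (hy' : PrimDyadic y') : Sig1 fun a =>
      Forced (fns (leftFam (L a) (l a))) (fns (rightFam (L a) (l a))) (x a, y a) (x' a, y' a) :=
  .reflTransGen_dyadic_prod (R := fun a => FStep (fns (leftFam (L a) (l a)))
      (fns (rightFam (L a) (l a))))
    (.fStep (by fun_prop) (by fun_prop) (by fun_prop) (by fun_prop) (by fun_prop) (by fun_prop))
    (fun _ _ _ h => ⟨h.1, h.2.1⟩) hx hy hx' hy'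

theorem Forced.isDyadic {ι : Type*} {a b : ι → ℝ → ℝ} {T X : ℝ × ℝ}
    (hT : IsDyadic T.1 ∧ IsDyadic T.2) (h : Forced a b T X) : IsDyadic X.1 ∧ IsDyadic X.2 := by
  induction h with
  | refl => exact hT
  | tail _ h _ => exact ⟨h.1, h.2.1⟩

theorem Sig1.chainContra {p q x y : α → ℝ} (hL : Primrec L) (hl : Primrec l) (hp : PrimDyadic p)
    (hq : PrimDyadic q) (hx : PrimDyadic x) (hy : PrimDyadic y) : Sig1 fun a =>
      ChainContra (fns (leftFam (L a) (l a))) (fns (rightFam (L a) (l a))) (p a, q a)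
        (x a, y a) := by
  refine .exists_dyadic_prod_of
    (fun a X h => Forced.isDyadic ⟨hx.isDyadic a, hy.isDyadic a⟩ h.1) ?_
  refine .and (.forced (by fun_prop) (by fun_prop) (by fun_prop) (by fun_prop) (by fun_prop)
    (by fun_prop)) (.or (.of_primrec (.and (PrimDyadic.eq (by fun_prop) (by fun_prop))
      (PrimDyadic.ne (by fun_prop) (by fun_prop)))) (.or ?_ ?_))
  · refine .exists_dyadic_prod_of
      (fun a X h => Forced.isDyadic ⟨hx.isDyadic _, hy.isDyadic _⟩ h.1) ?_
    exact .and (.forced (by fun_prop) (by fun_prop) (by fun_prop) (by fun_prop) (by fun_prop)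
      (by fun_prop)) (.of_primrec (.or (.and (PrimDyadic.lt (by fun_prop) (by fun_prop))
        (PrimDyadic.le (by fun_prop) (by fun_prop))) (.and (PrimDyadic.eq (by fun_prop)
        (by fun_prop)) (PrimDyadic.ne (by fun_prop) (by fun_prop)))))
  · exact .exists_idx (P := fun (b : α × DyadicCode × DyadicCode) i =>
      ZoneClash (plMap (L b.1).val i.1) (plMap (L b.1).val i.2) (b.2.1.val, b.2.2.val))
      (.zoneClash (by fun_prop) (by fun_prop) (by fun_prop) (by fun_prop) (by fun_prop))
      (hl.comp .fst)

end Sig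

end ThompsonPL

namespace ThompsonPL

open Set Filter Topology Relation

/-! ### Refutations are semidecidable -/

section Sig

variable {α : Type} [Primcodable α] {L : α → DyadicCode} {l : α → List (PLCode × PLCode)}

theorem Sig1.comp_dyadic {β : Type} [Primcodable β] {Φ : α → ℝ × ℝ → Prop}
    (hΦ : Sig1 fun p : α × DyadicCode × DyadicCode => Φ p.1 (p.2.1.val, p.2.2.val)) {g : β → α}
    (hg : Primrec g) {x y : β → ℝ} (hx : PrimDyadic x) (hy : PrimDyadic y) :
    Sig1 fun b => Φ (g b) (x b, y b) := by
  obtain ⟨c, hc, h⟩ := hx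
  obtain ⟨c', hc', h'⟩ := hy
  simp only [h, h']
  exact hΦ.comp (f := fun b => (g b, c b, c' b)) (by fun_prop)

theorem Sig1.forall_fix (hL : Primrec L) (hl : Primrec l) (π : PLCode × PLCode → PLCode)
    (hπ : Primrec π) {x : α → ℝ} (hx : PrimDyadic x) :
    Sig1 fun a => ∀ j : {b // b ∈ l a}, plMap (L a).val (π j) (x a) = x a :=
  .forall_idx (P := fun a j => plMap (L a).val (π j) (x a) = x a)
    (.of_primrec (PrimDyadic.eq (by fun_prop) (by fun_prop))) hl

theorem Sig1.exists_move (hL : Primrec L) (hl : Primrec l) (π : PLCode × PLCode → PLCode)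
    (hπ : Primrec π) {x : α → ℝ} (hx : PrimDyadic x) :
    Sig1 fun a => ∃ y, IsDyadic y ∧ x a ≤ y ∧ ∃ j : {b // b ∈ l a}, plMap (L a).val (π j) y ≠ y :=
  .exists_dyadic (.and (.of_primrec (PrimDyadic.le (by fun_prop) (by fun_prop)))
    (.exists_idx (P := fun (q : α × DyadicCode) j => plMap (L q.1).val (π j) q.2.val ≠ q.2.val)
      (.of_primrec (PrimDyadic.ne (by fun_prop) (by fun_prop))) (hl.comp .fst)))

theorem Sig1.eqFam_comm (hL : Primrec L) (hl : Primrec l) (π : PLCode × PLCode → PLCode)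
    (hπ : Primrec π) {c : α → PLCode} (hc : Primrec c) {p t : α → ℝ} (hp : PrimDyadic p)
    (ht : PrimDyadic t) : Sig1 fun a =>
      EqFam (fun (k : {b // b ∈ l a}) z => plMap (L a).val (c a) (plMap (L a).val (π k) z))
        (fun (k : {b // b ∈ l a}) z => plMap (L a).val (π k) (plMap (L a).val (c a) z))
        (p a) (t a) :=
  .eqFam (c₁ := fun a _ => c a) (c₂ := fun _ k => π k) (c₃ := fun _ k => π k)
    (c₄ := fun a _ => c a) hL hl (by fun_prop) (by fun_prop) (by fun_prop) (by fun_prop) hp ht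

theorem Sig1.firstDiff_comm (hL : Primrec L) (hl : Primrec l) (π : PLCode × PLCode → PLCode)
    (hπ : Primrec π) {c : α → PLCode} (hc : Primrec c) {p t : α → ℝ} (hp : PrimDyadic p)
    (ht : PrimDyadic t) : Sig1 fun a =>
      FirstDiff (fun (k : {b // b ∈ l a}) z => plMap (L a).val (c a) (plMap (L a).val (π k) z))
        (fun (k : {b // b ∈ l a}) z => plMap (L a).val (π k) (plMap (L a).val (c a) z))
        (p a) (t a) :=
  .firstDiff (c₁ := fun a _ => c a) (c₂ := fun _ k => π k) (c₃ := fun _ k => π k)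
    (c₄ := fun a _ => c a) hL hl (by fun_prop) (by fun_prop) (by fun_prop) (by fun_prop) hp ht

theorem Sig1.seeds {x y : α → ℝ} (hL : Primrec L) (hl : Primrec l) (hx : PrimDyadic x)
    (hy : PrimDyadic y) {Φ : α → ℝ × ℝ → Prop}
    (hΦ : Sig1 fun p : α × DyadicCode × DyadicCode => Φ p.1 (p.2.1.val, p.2.2.val)) :
    Sig1 fun a =>
      Seeds (fns (leftFam (L a) (l a))) (fns (rightFam (L a) (l a))) (x a, y a) (Φ a) := by
  refine .or (.exists_idx (P := fun a (i : PLCode × PLCode) => ∃ (s : ℤ) (v v' t r : ℝ), s ≠ 0 ∧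
      IsDyadic v ∧ IsDyadic v' ∧ IsDyadic t ∧ IsDyadic r ∧ x a < v ∧ y a < v' ∧ x a < t ∧ t ≤ v ∧
      y a + 2 ^ (s.natAbs : ℤ) * (t - x a) ≤ v' ∧ x a < r ∧
      AffOn (plMap (L a).val i.1) (x a) v s ∧ AffOn (plMap (L a).val i.2) (y a) v' s ∧
      (∀ j : {b // b ∈ l a}, plMap (L a).val j.1.1 (x a) = x a) ∧
      (∀ j : {b // b ∈ l a}, plMap (L a).val j.1.1 r = r) ∧
      EqFam (fun (k : {b // b ∈ l a}) z => plMap (L a).val i.1 (plMap (L a).val k.1.1 z))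
        (fun (k : {b // b ∈ l a}) z => plMap (L a).val k.1.1 (plMap (L a).val i.1 z)) (x a) r ∧
      ∀ m < s.natAbs, Φ a (t, y a + 2 ^ (m : ℤ) * (t - x a))) ?_ hl)
    (.exists_idx (P := fun a (i : PLCode × PLCode) => ∃ (t t' : ℝ), IsDyadic t ∧ IsDyadic t' ∧
      FirstDiff (fun (k : {b // b ∈ l a}) z => plMap (L a).val i.1 (plMap (L a).val k.1.1 z))
        (fun (k : {b // b ∈ l a}) z => plMap (L a).val k.1.1 (plMap (L a).val i.1 z)) (x a) t ∧
      FirstDiff (fun (k : {b // b ∈ l a}) z => plMap (L a).val i.2 (plMap (L a).val k.1.2 z))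
        (fun (k : {b // b ∈ l a}) z => plMap (L a).val k.1.2 (plMap (L a).val i.2 z)) (y a) t' ∧
      Φ a (t, t')) ?_ hl)
  · refine .exists ?_
    refine .exists_dyadic_of (fun a v ⟨_, _, _, _, h, _⟩ => h) ?_
    refine .exists_dyadic_of (fun a v ⟨_, _, _, _, h, _⟩ => h) ?_
    refine .exists_dyadic_of (fun a v ⟨_, _, _, _, h, _⟩ => h) ?_
    refine .exists_dyadic_of (fun a v ⟨_, _, _, _, h, _⟩ => h) ?_
    refine .and (.of_primrec (.not (primrecPred_eq (by fun_prop) (.const 0))))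
      <| .and (.isDyadic (by fun_prop)) <| .and (.isDyadic (by fun_prop))
      <| .and (.isDyadic (by fun_prop)) <| .and (.isDyadic (by fun_prop))
      <| .and (.of_primrec (PrimDyadic.lt (by fun_prop) (by fun_prop)))
      <| .and (.of_primrec (PrimDyadic.lt (by fun_prop) (by fun_prop)))
      <| .and (.of_primrec (PrimDyadic.lt (by fun_prop) (by fun_prop)))
      <| .and (.of_primrec (PrimDyadic.le (by fun_prop) (by fun_prop)))
      <| .and (.of_primrec (PrimDyadic.le (by fun_prop) (by fun_prop)))
      <| .and (.of_primrec (PrimDyadic.lt (by fun_prop) (by fun_prop)))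
      <| .and (.of_primrec (PrimDyadic.affOn (by fun_prop) (by fun_prop) (by fun_prop)
        (by fun_prop) (by fun_prop)))
      <| .and (.of_primrec (PrimDyadic.affOn (by fun_prop) (by fun_prop) (by fun_prop)
        (by fun_prop) (by fun_prop)))
      <| .and (.forall_fix (by fun_prop) (by fun_prop) Prod.fst .fst (by fun_prop))
      <| .and (.forall_fix (by fun_prop) (by fun_prop) Prod.fst .fst (by fun_prop))
      <| .and ?_ (.forall_lt (.comp_dyadic (g := fun q : ((((((α × PLCode ×
        PLCode) × ℤ) × DyadicCode) × DyadicCode) × DyadicCode) × DyadicCode) × ℕ =>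
        q.1.1.1.1.1.1.1) hΦ (by fun_prop)
        (by fun_prop) (by fun_prop)) (by fun_prop))
    exact .eqFam_comm (by fun_prop) (by fun_prop) Prod.fst .fst (by fun_prop) (by fun_prop)
      (by fun_prop)
  · refine .exists_dyadic_of (fun a v ⟨_, h, _⟩ => h) ?_
    refine .exists_dyadic_of (fun a v ⟨_, h, _⟩ => h) ?_
    refine .and (.isDyadic (by fun_prop)) <| .and (.isDyadic (by fun_prop)) <| .and ?_ <| .and ?_ <|
      .comp_dyadic (g := fun q : ((α × PLCode × PLCode) × DyadicCode) × DyadicCode => q.1.1.1) hΦ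
        (by fun_prop) (by fun_prop) (by fun_prop)
    · exact .firstDiff_comm (by fun_prop) (by fun_prop) Prod.fst .fst (by fun_prop) (by fun_prop)
        (by fun_prop)
    · exact .firstDiff_comm (by fun_prop) (by fun_prop) Prod.snd .snd (by fun_prop) (by fun_prop)
        (by fun_prop)

theorem Sig1.frameStep {x y x' y' : α → ℝ} (hL : Primrec L) (hl : Primrec l) (hx : PrimDyadic x)
    (hy : PrimDyadic y) (hx' : PrimDyadic x') (hy' : PrimDyadic y') : Sig1 fun a =>
      FrameStep (fns (leftFam (L a) (l a))) (fns (rightFam (L a) (l a))) (x a, y a)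
        (x' a, y' a) := by
  refine .and (.isDyadic hx') (.and (.isDyadic hy') (.or (.and
    (.firstDiff_id hL hl .fst hx hx') (.firstDiff_id hL hl .snd hy hy'))
    (.and (.forall_fix hL hl Prod.fst .fst hx') (.seeds hL hl hx hy ?_))))
  exact .or (.chainContra (by fun_prop) (by fun_prop) (by fun_prop) (by fun_prop) (by fun_prop)
    (by fun_prop)) (.forced (by fun_prop) (by fun_prop) (by fun_prop) (by fun_prop) (by fun_prop)
    (by fun_prop))

theorem Sig1.frameContra {R x y : α → ℝ} (hL : Primrec L) (hl : Primrec l) (hR : PrimDyadic R)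
    (hx : PrimDyadic x) (hy : PrimDyadic y) : Sig1 fun a =>
      FrameContra (fns (leftFam (L a) (l a))) (fns (rightFam (L a) (l a))) (R a) (x a, y a) := by
  refine .or (.seeds hL hl hx hy (.chainContra (by fun_prop) (by fun_prop) (by fun_prop)
    (by fun_prop) (by fun_prop) (by fun_prop))) <| .or ?_ <|
    .or (.and (.eqFam_id hL hl .fst hx hR) (.exists_move hL hl Prod.snd .snd hy)) <|
    .or (.and (.eqFam_id hL hl .snd hy hR) (.exists_move hL hl Prod.fst .fst hx)) <|
    .or ?_ <| .or ?_ <| .or (.of_primrec (.and (hx.lt hR) (hR.le hy)))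
    (.of_primrec (.and (hR.le hx) (hy.ne hx)))
  · refine .exists_dyadic_of (fun a v ⟨_, h, _⟩ => h) ?_
    refine .exists_dyadic_of (fun a v ⟨_, h, _⟩ => h) ?_
    exact .and (.isDyadic (by fun_prop)) <| .and (.isDyadic (by fun_prop)) <|
      .and (.firstDiff_id (by fun_prop) (by fun_prop) .fst (by fun_prop) (by fun_prop)) <|
      .and (.firstDiff_id (by fun_prop) (by fun_prop) .snd (by fun_prop) (by fun_prop)) <|
      .of_primrec <| .or (.and (PrimDyadic.eq (by fun_prop) (by fun_prop))
        (PrimDyadic.ne (by fun_prop) (by fun_prop))) (.and (PrimDyadic.ne (by fun_prop)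
        (by fun_prop)) (PrimDyadic.eq (by fun_prop) (by fun_prop)))
  · refine .exists_idx (P := fun a (i : PLCode × PLCode) => ∃ (s s' : ℤ) (v v' : ℝ),
      IsDyadic v ∧ IsDyadic v' ∧ x a < v ∧ y a < v' ∧
      plMap (L a).val i.1 (x a) = x a ∧ AffOn (plMap (L a).val i.1) (x a) v s ∧
      AffOn (plMap (L a).val i.2) (y a) v' s' ∧ s ≠ s') (.exists (.exists ?_)) hl
    refine .exists_dyadic_of (fun a v ⟨_, h, _⟩ => h) ?_
    refine .exists_dyadic_of (fun a v ⟨_, h, _⟩ => h) ?_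
    exact .and (.isDyadic (by fun_prop)) <| .and (.isDyadic (by fun_prop)) <| .of_primrec <|
      .and (PrimDyadic.lt (by fun_prop) (by fun_prop)) <|
      .and (PrimDyadic.lt (by fun_prop) (by fun_prop)) <|
      .and (PrimDyadic.eq (by fun_prop) (by fun_prop)) <|
      .and (PrimDyadic.affOn (by fun_prop) (by fun_prop) (by fun_prop) (by fun_prop)
        (by fun_prop)) <|
      .and (PrimDyadic.affOn (by fun_prop) (by fun_prop) (by fun_prop) (by fun_prop)
        (by fun_prop)) <| .not (primrecPred_eq (by fun_prop) (by fun_prop))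
  · refine .exists_idx (P := fun a (i : PLCode × PLCode) =>
      EqFam (fun (k : {b // b ∈ l a}) z => plMap (L a).val i.2 (plMap (L a).val k.1.2 z))
        (fun (k : {b // b ∈ l a}) z => plMap (L a).val k.1.2 (plMap (L a).val i.2 z)) (y a) (R a) ∧
      ∃ z, IsDyadic z ∧ x a ≤ z ∧ ∃ j : {b // b ∈ l a},
        plMap (L a).val i.1 (plMap (L a).val j.1.1 z) ≠
          plMap (L a).val j.1.1 (plMap (L a).val i.1 z)) (.and ?_ (.exists_dyadic (.and
        (.of_primrec (PrimDyadic.le (by fun_prop) (by fun_prop))) ?_))) hl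
    · exact .eqFam_comm (by fun_prop) (by fun_prop) Prod.snd .snd (by fun_prop) (by fun_prop)
        (by fun_prop)
    · exact .exists_idx (P := fun (q : (α × PLCode × PLCode) × DyadicCode) j =>
        plMap (L q.1.1).val q.1.2.1 (plMap (L q.1.1).val j.1 q.2.val) ≠
          plMap (L q.1.1).val j.1 (plMap (L q.1.1).val q.1.2.1 q.2.val))
        (.of_primrec (PrimDyadic.ne (by fun_prop) (by fun_prop))) (l := fun q => l q.1.1)
        (by fun_prop)

theorem Sig1.refuted {R : α → ℝ} (hL : Primrec L) (hl : Primrec l) (hR : PrimDyadic R) :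
    Sig1 fun a =>
      Refuted (fns (leftFam (L a) (l a))) (fns (rightFam (L a) (l a))) (L a).val (R a) := by
  have hd : ∀ a (P : ℝ × ℝ), ReflTransGen (FrameStep (fns (leftFam (L a) (l a)))
      (fns (rightFam (L a) (l a)))) ((L a).val, (L a).val) P → IsDyadic P.1 ∧ IsDyadic P.2 := by
    intro a P h
    induction h with
    | refl => exact ⟨isDyadic_val _, isDyadic_val _⟩
    | tail _ h _ => exact ⟨h.1, h.2.1⟩
  refine .exists_dyadic_prod_of (fun a P h => hd a P h.1) (.and ?_ (.frameContra (by fun_prop)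
    (by fun_prop) (by fun_prop) (by fun_prop) (by fun_prop)))
  exact .reflTransGen_dyadic_prod (R := fun (b : α × DyadicCode × DyadicCode) =>
      FrameStep (fns (leftFam (L b.1) (l b.1))) (fns (rightFam (L b.1) (l b.1))))
    (.frameStep (by fun_prop) (by fun_prop) (by fun_prop) (by fun_prop) (by fun_prop)
      (by fun_prop)) (fun _ _ _ h => ⟨h.1, h.2.1⟩) (by fun_prop) (by fun_prop) (by fun_prop)
    (by fun_prop)

end Sig

end ThompsonPL

namespace ThompsonPL

open Set Filter Topology Relation

/-! ### Codes of elements of `PL₂(J)` -/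

theorem CodesFrom.le_right {J : DyadicInterval} {f : PL2 J} {c : PLCode} {a : ℝ}
    (h : CodesFrom f a c) : a ≤ J.right := by
  induction c generalizing a with
  | nil => exact le_of_eq h
  | cons p c ih => exact h.1.le.trans (ih h.2.2)

theorem CodesFrom.entry_le {J : DyadicInterval} {f : PL2 J} {c : PLCode} {a : ℝ}
    (h : CodesFrom f a c) : ∀ p ∈ c, p.1.val ≤ J.right := by
  induction c generalizing a with
  | nil => simp
  | cons q c ih =>
    intro p hp
    rcases List.mem_cons.1 hp with rfl | hp
    · exact h.2.2.le_right
    · exact ih h.2.2 p hp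

/-- The map given by a code of an element of `PL₂(J)`, from the point `a` on, extends this
element. -/
theorem CodesFrom.plIso_eq {J : DyadicInterval} {f : PL2 J} {c : PLCode} {a : J.Pt}
    (h : CodesFrom f a c) (t : J.Pt) (hat : a ≤ t) : (plIso c a (f.1 a)).1 t = f.1 t := by
  induction c generalizing a with
  | nil =>
    have : t = a := Subtype.ext (le_antisymm (t.2.2.trans_eq h.symm) hat)
    rw [this, (plIso [] a _).2 _ le_rfl]
    simp
  | cons p c ih =>
    obtain ⟨d, e⟩ := p
    obtain ⟨had, hf, hc⟩ := h
    have hdJ : d.val ∈ Icc J.left J.right := ⟨a.2.1.trans had.le, hc.le_right⟩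
    rcases le_total (t : ℝ) d.val with htd | htd
    · rw [plIso_cons_of_le had hat htd, ← hf a t le_rfl hat htd]
      ring
    · rw [plIso_cons_of_ge had htd, ← ih (a := ⟨d.val, hdJ⟩) hc htd]
      refine plIso_congr c rfl ?_ t
      rw [← hf a ⟨d.val, hdJ⟩ le_rfl had.le le_rfl]
      ring

theorem Codes.plMap_eq {J : DyadicInterval} {f : PL2 J} {c : PLCode} (h : Codes c f) (t : J.Pt) :
    plMap J.left c t = f.1 t := by
  rw [← CodesFrom.plIso_eq (a := J.bot) h t t.2.1]
  refine plIso_congr c rfl ?_ t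
  rw [map_bot]
  rfl

theorem coe_map_right {J : DyadicInterval} (f : J.Pt ≃o J.Pt) (t : J.Pt) (ht : (t : ℝ) = J.right) :
    (f t : ℝ) = J.right := by
  refine le_antisymm (f t).2.2 ?_
  have : f.symm t ≤ t := (f.symm t).2.2.trans_eq ht.symm
  rw [f.symm_apply_le] at this
  exact ht.symm.trans_le this

/-- A code whose pieces end at `R` at the latest describes a map of slope `1` to the right
of `R`. -/
theorem plIso_of_entry_le {c : PLCode} {u w R x : ℝ} (hc : ∀ p ∈ c, p.1.val ≤ R) (hu : u ≤ R)
    (hx : R ≤ x) : (plIso c u w).1 x = (plIso c u w).1 R + (x - R) := by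
  induction c generalizing u w with
  | nil => simp [plIso]; ring
  | cons p c ih =>
    obtain ⟨d, e⟩ := p
    have hd : d.val ≤ R := hc (d, e) List.mem_cons_self
    have hc' : ∀ p ∈ c, p.1.val ≤ R := fun p hp => hc p (List.mem_cons_of_mem _ hp)
    rcases le_or_gt d.val u with h | h
    · rw [plIso_skip h]
      exact ih hc' hu
    · rw [plIso_cons_of_ge h (hd.trans hx), plIso_cons_of_ge h hd]
      exact ih hc' hd

/-! ### Restriction to the interval -/

/-- A locally piecewise linear map has finitely many breakpoints in a compact interval. -/
theorem IsLPL.exists_finset {g : ℝ → ℝ} (hg : IsLPL g) {p r : ℝ} (hp : IsDyadic p)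
    (hr : IsDyadic r) (hpr : p ≤ r) : ∃ S : Finset ℝ, (∀ s ∈ S, IsDyadic s) ∧
      ∀ a b, p ≤ a → a < b → b ≤ r → (∀ s ∈ S, s ∉ Ioo a b) → ∃ e, AffOn g a b e := by
  classical
  have h := exists_subdivision (Q := fun u v => ∃ e, AffOn g u v e)
    (fun u v u' v' ⟨e, he⟩ hu _ hv => ⟨e, he.mono hu hv⟩) hp hr hpr
    (fun x _ => hg.right x) (fun x _ => hg.left x) (fun x _ hx => hg.two x hx)
  clear hr hpr
  induction h with
  | refl => exact ⟨∅, by simp, fun a b h1 h2 h3 => absurd (h1.trans_lt h2) (not_lt.2 h3)⟩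
  | @tail r r' _ h ih =>
    obtain ⟨S, hS, hSa⟩ := ih
    obtain ⟨-, hrd, -, e, he⟩ := h
    refine ⟨insert r S, fun s hs => ?_, fun a b h1 h2 h3 h4 => ?_⟩
    · rcases Finset.mem_insert.1 hs with rfl | hs
      · exact hrd
      · exact hS s hs
    · rcases le_or_gt b r with hb | hb
      · exact hSa a b h1 h2 hb fun s hs => h4 s (Finset.mem_insert_of_mem hs)
      · have har : r ≤ a := not_lt.1 fun har => h4 r (Finset.mem_insert_self _ _) ⟨har, hb⟩
        exact ⟨e, he.mono har h3⟩

/-- The restriction to `J` of a locally piecewise linear map that preserves `J`. -/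
theorem exists_PL2_of_isLPL {J : DyadicInterval} {g : ℝ ≃o ℝ} (hg : IsLPL g)
    (hl : g J.left = J.left) (hr : g J.right = J.right) :
    ∃ f : PL2 J, ∀ t : J.Pt, (f.1 t : ℝ) = g t := by
  have hm : ∀ t ∈ Icc J.left J.right, g t ∈ Icc J.left J.right := fun t ht =>
    ⟨hl.symm.trans_le (g.monotone ht.1), (g.monotone ht.2).trans_eq hr⟩
  have hm' : ∀ t ∈ Icc J.left J.right, g.symm t ∈ Icc J.left J.right := fun t ht =>
    ⟨g.le_symm_apply.2 (hl.trans_le ht.1), g.symm_apply_le.2 (ht.2.trans_eq hr.symm)⟩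
  let F : J.Pt ≃o J.Pt :=
    { toFun := fun t => ⟨g t, hm t t.2⟩
      invFun := fun t => ⟨g.symm t, hm' t t.2⟩
      left_inv := fun t => Subtype.ext (g.symm_apply_apply t)
      right_inv := fun t => Subtype.ext (g.apply_symm_apply t)
      map_rel_iff' := g.le_iff_le }
  obtain ⟨S, hS, hSa⟩ := hg.exists_finset J.left_dyadic J.right_dyadic J.left_lt_right.le
  refine ⟨⟨F, S, hS, fun a b hab h => ?_⟩, fun t => rfl⟩
  obtain ⟨e, he⟩ := hSa a b a.2.1 hab b.2.2 h
  refine ⟨e, g a - 2 ^ e * a, fun t hat htb => ?_⟩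
  change g t = _
  rw [he a ⟨le_rfl, hab.le⟩ t ⟨hat, htb⟩]
  ring

/-! ### The decision procedure -/

/-- The input of the decision procedure: the end points of the interval, the codes of the `x i`, and
the codes of `y` and `z`. -/
abbrev ConjInput : Type := DyadicCode × DyadicCode × List PLCode × PLCode × PLCode

/-- The pairs of codes of maps that have to be conjugated to each other: each `x i` to itself, and
`z` to `y`. -/
def ConjInput.pairs (w : ConjInput) : List (PLCode × PLCode) :=
  w.2.2.1.map (fun c => (c, c)) ++ [(w.2.2.2.2, w.2.2.2.1)]

/-- The code describes a map supported in the interval. -/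
def ConjInput.ValidCode (w : ConjInput) (c : PLCode) : Prop :=
  (∀ p ∈ c, p.1.val ≤ w.2.1.val) ∧ plMap w.1.val c w.2.1.val = w.2.1.val

/-- The input consists of an interval and codes of maps supported in it. -/
def ConjInput.Valid (w : ConjInput) : Prop :=
  w.1.val < w.2.1.val ∧ ∀ p ∈ w.pairs, w.ValidCode p.1 ∧ w.ValidCode p.2

/-- There is a code of a conjugating map. -/
def ConjInput.Solvable (w : ConjInput) : Prop :=
  ∃ c : PLCode, plMap w.1.val c w.2.1.val = w.2.1.val ∧ ∀ p ∈ w.pairs, ∀ x ∈ Icc w.1.val w.2.1.val,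
    plMap w.1.val c (plMap w.1.val p.1 x) = plMap w.1.val p.2 (plMap w.1.val c x)

theorem ConjInput.ValidCode.of_ge {w : ConjInput} {c : PLCode} (h : w.ValidCode c)
    (hw : w.1.val ≤ w.2.1.val) {x : ℝ} (hx : w.2.1.val ≤ x) : plMap w.1.val c x = x := by
  have h1 := h.2
  rw [plMap] at h1 ⊢
  rw [plIso_of_entry_le h.1 hw hx, h1]
  ring

theorem ConjInput.Valid.isFam {w : ConjInput} (h : w.Valid) :
    IsFam (leftFam w.1 w.pairs) w.1.val w.2.1.val ∧
      IsFam (rightFam w.1 w.pairs) w.1.val w.2.1.val :=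
  ⟨⟨fun i => plMap_lpl i.1.1 (isDyadic_val w.1), fun i _ hx => plMap_of_le i.1.1 hx,
    fun i _ hx => (h.2 i.1 i.2).1.of_ge h.1.le hx⟩,
    ⟨fun i => plMap_lpl i.1.2 (isDyadic_val w.1), fun i _ hx => plMap_of_le i.1.2 hx,
    fun i _ hx => (h.2 i.1 i.2).2.of_ge h.1.le hx⟩⟩

/-- Codes may be replaced by maps: a solution restricts to an element of `PL₂(J)`, and this has a
code. -/
theorem ConjInput.Valid.solvable_iff {w : ConjInput} (h : w.Valid) : w.Solvable ↔
    ∃ g, IsSol (leftFam w.1 w.pairs) (rightFam w.1 w.pairs) w.1.val w.2.1.val g := by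
  obtain ⟨hA, hB⟩ := h.isFam
  have hLR := h.1
  constructor
  · rintro ⟨c, hc, hcomm⟩
    have hs : plMap w.1.val c w.2.1.val = (1 : ℝ ≃o ℝ) w.2.1.val := hc
    set g := splice w.2.1.val (plMap w.1.val c) 1 hs with hg
    have hgl : ∀ x ≤ w.1.val, g x = x := fun x hx => by
      rw [hg, splice_of_le (hx.trans hLR.le), plMap_of_le c hx]
    have hgr : ∀ x, w.2.1.val ≤ x → g x = x := fun x hx => by rw [hg, splice_of_ge hx]; rfl
    refine ⟨g, IsLPL.splice hs (isDyadic_val _) (plMap_lpl c (isDyadic_val _)) IsLPL.one, hgl, hgr,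
      fun i x => ?_⟩
    rcases le_total x w.1.val with hx | hx
    · rw [hA.left i x hx, hgl x hx, hB.left i x hx]
    rcases le_total w.2.1.val x with hx' | hx'
    · rw [hA.right i x hx', hgr x hx', hB.right i x hx']
    · rw [hg, splice_of_le hx', splice_of_le]
      · exact hcomm i.1 i.2 x ⟨hx, hx'⟩
      · exact ((leftFam w.1 w.pairs i).monotone hx').trans_eq (hA.right i _ le_rfl)
  · rintro ⟨g, hg⟩
    set J : DyadicInterval := ⟨w.1.val, w.2.1.val, isDyadic_val _, isDyadic_val _, hLR⟩
    obtain ⟨f, hf⟩ := exists_PL2_of_isLPL (J := J) hg.lpl (hg.left _ le_rfl) (hg.right _ le_rfl)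
    obtain ⟨c, hc⟩ := exists_codes f
    have hcg : ∀ x ∈ Icc w.1.val w.2.1.val, plMap w.1.val c x = g x := fun x hx =>
      (Codes.plMap_eq hc ⟨x, hx⟩).trans (hf ⟨x, hx⟩)
    refine ⟨c, ?_, fun p hp x hx => ?_⟩
    · rw [hcg _ ⟨hLR.le, le_rfl⟩, hg.right _ le_rfl]
    · rw [hcg x hx, hcg]
      · exact hg.comm ⟨p, hp⟩ x
      · constructor
        · exact (hA.left ⟨p, hp⟩ _ le_rfl).ge.trans ((plMap w.1.val p.1).monotone hx.1)
        · exact ((plMap w.1.val p.1).monotone hx.2).trans_eq (hA.right ⟨p, hp⟩ _ le_rfl)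

theorem ConjInput.Valid.not_solvable_iff {w : ConjInput} (h : w.Valid) : ¬ w.Solvable ↔
    Refuted (fns (leftFam w.1 w.pairs)) (fns (rightFam w.1 w.pairs)) w.1.val w.2.1.val := by
  obtain ⟨hA, hB⟩ := h.isFam
  have : Finite {p // p ∈ w.pairs} := w.pairs.finite_toSet.to_subtype
  rw [h.solvable_iff]
  constructor
  · intro hno
    by_contra hR
    exact hno (exists_isSol hA hB h.1 (isDyadic_val _) (isDyadic_val _) hR)
  · rintro hR ⟨g, hg⟩
    exact Refuted.sound hA hB (isDyadic_val _) hg hR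

theorem primrec_pairs : Primrec ConjInput.pairs := by
  refine Primrec.list_append.comp (Primrec.list_map (by fun_prop) ?_)
    (Primrec.list_cons.comp (by fun_prop) (.const []))
  exact (by fun_prop : Primrec fun q : ConjInput × PLCode => (q.2, q.2))

theorem primrecPred_validCode {α : Type} [Primcodable α] {w : α → ConjInput} {c : α → PLCode}
    (hw : Primrec w) (hc : Primrec c) : PrimrecPred fun a => (w a).ValidCode (c a) := by
  refine .and ?_ (PrimDyadic.eq (by fun_prop) (by fun_prop))
  have h : PrimrecRel fun (p : DyadicCode × ℤ) (w : ConjInput) => p.1.val ≤ w.2.1.val :=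
    PrimDyadic.le (α := (DyadicCode × ℤ) × ConjInput) (by fun_prop) (by fun_prop)
  exact h.forall_mem_list.comp hc hw

theorem primrecPred_valid : PrimrecPred ConjInput.Valid := by
  refine .and (PrimDyadic.lt (by fun_prop) (by fun_prop)) ?_
  have h : PrimrecRel fun (p : PLCode × PLCode) (w : ConjInput) =>
      w.ValidCode p.1 ∧ w.ValidCode p.2 :=
    PrimrecPred.and (α := (PLCode × PLCode) × ConjInput)
      (primrecPred_validCode (by fun_prop) (by fun_prop))
      (primrecPred_validCode (by fun_prop) (by fun_prop))
  exact h.forall_mem_list.comp primrec_pairs .id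

/-- A solution is found by a search through all codes. -/
theorem sig1_solvable : Sig1 ConjInput.Solvable := by
  refine .exists (.and (.of_primrec (PrimDyadic.eq (by fun_prop) (by fun_prop)))
    (.forall_mem ?_ (primrec_pairs.comp .fst)))
  exact .eqOn (by fun_prop) (by fun_prop) (by fun_prop) (by fun_prop) (by fun_prop) (by fun_prop)
    (by fun_prop)

/-- Solvability is decidable for valid inputs: both it and its negation are semidecidable. -/
theorem exists_decision : ∃ f : ConjInput → Bool, Computable f ∧
    ∀ w, f w = true ↔ w.Valid ∧ w.Solvable := by
  have h1 : REPred fun w : ConjInput => w.Valid ∧ w.Solvable :=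
    ((Sig1.of_primrec primrecPred_valid).and sig1_solvable).rePred
  have h2 : REPred fun w : ConjInput => ¬ (w.Valid ∧ w.Solvable) := by
    refine Sig1.rePred (.of_iff (.or (.of_primrec primrecPred_valid.not)
      (.refuted (L := fun w : ConjInput => w.1) (l := ConjInput.pairs) (R := fun w => w.2.1.val)
        (by fun_prop) primrec_pairs (by fun_prop))) fun w => ?_)
    by_cases hw : w.Valid
    · rw [← hw.not_solvable_iff]
      simp [hw]
    · simp [hw]
  obtain ⟨f, hf, hfe⟩ := ComputablePred.computable_iff.1
    (ComputablePred.computable_iff_re_compl_re'.2 ⟨h1, h2⟩)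
  exact ⟨f, hf, fun w => (iff_of_eq (congrFun hfe w)).symm⟩

end ThompsonPL

namespace ThompsonPL

open Set Filter Topology Relation

theorem Codes.validCode {J : DyadicInterval} {f : PL2 J} {c : PLCode} (h : Codes c f)
    {w : ConjInput} (hl : w.1.val = J.left) (hr : w.2.1.val = J.right) : w.ValidCode c := by
  refine ⟨fun p hp => (CodesFrom.entry_le h p hp).trans_eq hr.symm, ?_⟩
  rw [hl, hr]
  have h1 := h.plMap_eq ⟨J.right, J.left_lt_right.le, le_rfl⟩
  rw [coe_map_right _ _ rfl] at h1
  exact h1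

/-- For codes of elements of `PL₂(J)`, a solution is an element of `PL₂(J)` that centralizes each
`x i` and conjugates `y` to `z`. -/
theorem valid_and_solvable_iff {J : DyadicInterval} {k : ℕ} {x : Fin k → PL2 J} {y z : PL2 J}
    {a b : DyadicCode} {cx : Fin k → PLCode} {cy cz : PLCode} (ha : a.val = J.left)
    (hb : b.val = J.right) (hx : ∀ i, Codes (cx i) (x i)) (hy : Codes cy y) (hz : Codes cz z) :
    ConjInput.Valid (a, b, List.ofFn cx, cy, cz) ∧
        ConjInput.Solvable (a, b, List.ofFn cx, cy, cz) ↔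
      ∃ g ∈ ⨅ i, Subgroup.centralizer ({x i} : Set (PL2 J)), g⁻¹ * y * g = z := by
  set w : ConjInput := (a, b, List.ofFn cx, cy, cz) with hw
  have hmem : ∀ {Q : PLCode × PLCode → Prop},
      (∀ p ∈ w.pairs, Q p) ↔ (∀ i, Q (cx i, cx i)) ∧ Q (cz, cy) := fun {Q} => by
    simp [hw, ConjInput.pairs, List.mem_ofFn, or_imp, forall_and]
  have hvc : ∀ {c : PLCode} {f : PL2 J}, Codes c f → w.ValidCode c := fun h => h.validCode ha hb
  have hvalid : w.Valid := ⟨ha.trans_lt (J.left_lt_right.trans_eq hb.symm),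
    hmem.2 ⟨fun i => ⟨hvc (hx i), hvc (hx i)⟩, hvc hz, hvc hy⟩⟩
  -- equations in `PL₂(J)` are equations of maps on the interval
  have hmul : ∀ {c c' c₁ : PLCode} {f f' g : PL2 J}, Codes c f → Codes c' f' → Codes c₁ g →
      ((∀ t ∈ Icc a.val b.val, plMap a.val c₁ (plMap a.val c t) =
        plMap a.val c' (plMap a.val c₁ t)) ↔ g * f = f' * g) := by
    intro c c' c₁ f f' g hc hc' hc₁
    rw [ha, hb]
    constructor
    · intro H
      refine Subtype.ext (RelIso.ext fun t => Subtype.ext ?_)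
      have h1 := H t t.2
      rw [hc.plMap_eq, hc₁.plMap_eq, hc₁.plMap_eq, hc'.plMap_eq] at h1
      exact h1
    · intro H t ht
      have h1 := congrArg (fun h : PL2 J => ((h.1 ⟨t, ht⟩ : J.Pt) : ℝ)) H
      rw [hc.plMap_eq ⟨t, ht⟩, hc₁.plMap_eq, hc₁.plMap_eq ⟨t, ht⟩, hc'.plMap_eq]
      exact h1
  have hgroup : ∀ g : PL2 J, (g ∈ ⨅ i, Subgroup.centralizer ({x i} : Set (PL2 J))) ∧
      g⁻¹ * y * g = z ↔ (∀ i, g * x i = x i * g) ∧ g * z = y * g := by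
    intro g
    rw [Subgroup.mem_iInf]
    refine and_congr (forall_congr' fun i => ?_) ?_
    · rw [Subgroup.mem_centralizer_singleton_iff, eq_comm]
    · rw [mul_assoc, inv_mul_eq_iff_eq_mul, eq_comm]
  constructor
  · rintro ⟨-, c, hc, hcomm⟩
    have hcl : plMap a.val c J.left = J.left := plMap_of_le c ha.ge
    have hcr : plMap a.val c J.right = J.right := by rw [← hb]; exact hc
    obtain ⟨g, hg⟩ := exists_PL2_of_isLPL (plMap_lpl c (isDyadic_val a)) hcl hcr
    obtain ⟨c₁, hc₁⟩ := exists_codes g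
    have heq : ∀ t ∈ Icc a.val b.val, plMap a.val c t = plMap a.val c₁ t := fun t ht => by
      rw [ha, hb] at ht
      rw [← hg ⟨t, ht⟩, ← hc₁.plMap_eq, ha]
    have hm : ∀ p ∈ w.pairs, ∀ t ∈ Icc a.val b.val, plMap a.val p.1 t ∈ Icc a.val b.val := by
      intro p hp t ht
      obtain ⟨hA, -⟩ := hvalid.isFam
      exact ⟨(hA.left ⟨p, hp⟩ _ le_rfl).ge.trans ((plMap a.val p.1).monotone ht.1),
        ((plMap a.val p.1).monotone ht.2).trans_eq (hA.right ⟨p, hp⟩ _ le_rfl)⟩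
    have hcomm' : ∀ p ∈ w.pairs, ∀ t ∈ Icc a.val b.val, plMap a.val c₁ (plMap a.val p.1 t) =
        plMap a.val p.2 (plMap a.val c₁ t) := by
      intro p hp t ht
      rw [← heq t ht, ← heq _ (hm p hp t ht)]
      exact hcomm p hp t ht
    obtain ⟨h1, h2⟩ := hmem.1 hcomm'
    exact ⟨g, (hgroup g).2 ⟨fun i => (hmul (hx i) (hx i) hc₁).1 (h1 i), (hmul hz hy hc₁).1 h2⟩⟩
  · rintro ⟨g, hg⟩
    obtain ⟨h1, h2⟩ := (hgroup g).1 hg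
    obtain ⟨c, hc⟩ := exists_codes g
    exact ⟨hvalid, c, (hvc hc).2,
      hmem.2 ⟨fun i => (hmul (hx i) (hx i) hc).2 (h1 i), (hmul hz hy hc).2 h2⟩⟩

end ThompsonPL

theorem mainTheorem3 :
    ∃ decideConj : ThompsonPL.DyadicCode × ThompsonPL.DyadicCode × List ThompsonPL.PLCode ×
        ThompsonPL.PLCode × ThompsonPL.PLCode → Bool,
      Computable decideConj ∧
      ∀ (J : ThompsonPL.DyadicInterval) (k : ℕ) (x : Fin k → ThompsonPL.PL2 J)
        (y z : ThompsonPL.PL2 J) (a b : ThompsonPL.DyadicCode) (cx : Fin k → ThompsonPL.PLCode)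
        (cy cz : ThompsonPL.PLCode),
        ThompsonPL.DyadicCode.val a = J.left → ThompsonPL.DyadicCode.val b = J.right →
        (∀ i, ThompsonPL.Codes (cx i) (x i)) → ThompsonPL.Codes cy y → ThompsonPL.Codes cz z →
        (decideConj (a, b, List.ofFn cx, cy, cz) = true ↔
          ∃ g ∈ ⨅ i, Subgroup.centralizer ({x i} : Set (ThompsonPL.PL2 J)),
            g⁻¹ * y * g = z) := by
  obtain ⟨f, hf, h⟩ := ThompsonPL.exists_decision
  exact ⟨f, hf, fun J k x y z a b cx cy cz ha hb hx hy hz =>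
    (h _).trans (ThompsonPL.valid_and_solvable_iff ha hb hx hy hz)⟩
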